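/- Let $d\ge 1$, let $\Lambda_n=(\mathcal V_n,\mathcal E_n)$ be the box $\{1,\dots,n\}^d\subset\mathbb Z^d$ with nearest-neighbour edges (free boundary), and for $x\in\mathcal V_n$ let $(-1)^x=1$ on the sublattice A of sites with even coordinate sum and $(-1)^x=-1$ on the other sublattice B (interchanging A and B changes nothing below). *Quantum models.* On $\bigotimes_{x\in\mathcal V_n}\mathbb C^2$ let $S_x^{(1)},S_x^{(2)},S_x^{(3)}$ be the spin-$\frac12$ operators at $x$ ($\frac12$ times the Pauli matrices), $M_n=\sum_x S_x^{(3)}$, $H^{\rm ferro}_{n,h}=-\sum_{\{x,y\}\in\mathcal E_n}\vec S_x\cdot\vec S_y-hM_n$, $H^{\rm anti}_{n,h}=\sum_{\{x,y\}\in\mathcal E_n}\vec S_x\cdot\vec S_y-hM_n$, and $\langle A\rangle_{n,\beta,h}=\operatorname{Tr}(Ae^{-\beta H_{n,h}})/\operatorname{Tr}e^{-\beta H_{n,h}}$. Put $$m^*_{\rm res}(\beta)=\lim_{h\to0+}\liminf_{n\to\infty}\tfrac1{n^d}\langle M_n\rangle^{\rm ferro}_{n,\beta,h},\qquad m^*_{\rm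 sp}(\beta)=\liminf_{n\to\infty}\tfrac1{n^d}\langle|M_n|\rangle^{\rm ferro}_{n,\beta,0},$$ $$\overline\sigma(\beta)=\Bigl(\liminf_{n\to\infty}\tfrac1{n^{2d}}\sum_{x,y\in\mathcal V_n}(-1)^x(-1)^y\langle S_x^{(3)}S_y^{(3)}\rangle^{\rm anti}_{n,\beta,0}\Bigr)^{1/2}.$$ *Cycle and loop models.* Let $\rho_{n,\beta}$ be the law of independent unit-intensity Poisson processes on $[0,\beta]$, one for each edge of $\Lambda_n$; a point at time $t$ on the edge $\{x,y\}$ is a bridge between $(x,t)$ and $(y,t)$ in $\mathcal V_n\times[0,\beta]_{\rm per}$ (time is periodic). A cycle is a closed trajectory in this space that moves upwards in time at unit speed and crosses every bridge it meets. A loop is a closed trajectory that moves upwards on A and downwards on B at unit speed and crosses every bridge it meets. The cycles of a configuration $\omega$ form a partition of the space, denoted $\mathcal C(\omega)$, and so do the loops, denoted $\mathcal L(\omega)$. $L(\gamma)$ is the total vertical length of $\gamma$, and $\gamma_x$ is the cycle (or loop) through $(x,0)$. For $h\ge0$ the cycle model is the probability measure proportional to $\prod_{\gamma\in\mathcal C(\omega)}(1+e^{-2hL(\gamma)})\,\rho_{n,\beta}(d\omega)$;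 the loop model (with $h=0$) is the probability measure proportional to $2^{|\mathcal L(\omega)|}\rho_{n,\beta}(d\omega)$. In either model, with expectation $\mathbb E_{n,\beta,h}$, put $$\eta_\infty(\beta,h)=\lim_{K\to\infty}\liminf_{n\to\infty}\tfrac1{n^d}\mathbb E_{n,\beta,h}\bigl(\#\{x\in\mathcal V_n:L(\gamma_x)>K\}\bigr),$$ $$\eta_{\rm macro}(\beta,h)=\lim_{\varepsilon\to0+}\liminf_{n\to\infty}\tfrac1{n^d}\mathbb E_{n,\beta,h}\bigl(\#\{x\in\mathcal V_n:L(\gamma_x)>\varepsilon n^d\}\bigr).$$ **Proposition.** For every $\beta>0$, the limits in the definitions of $m^*_{\rm res}(2\beta)$, of $\eta_\infty(\beta,h)$ for $h>0$ in the cycle model, and of $\eta_{\rm macro}(\beta,0)$ in both models exist, and: (a) $m^*_{\rm res}(2\beta)\ge\frac12\limsup_{h\to0+}\eta_\infty(\beta,h)$ in the cycle model (hence $m^*_{\rm res}(2\beta)\ge\frac12\lim_{h\to0+}\eta_\infty(\beta,h)$ whenever this limit exists); (b) $m^*_{\rm sp}(2\beta)>0$ if and only if $\eta_{\rm macro}(\beta,0)>0$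 in the cycle model; (c) $\overline\sigma(2\beta)>0$ if and only if $\eta_{\rm macro}(\beta,0)>0$ in the loop model. -/

import Mathlib

open scoped MatrixOrder

namespace Heisenberg

noncomputable section

/-! ### Spin-1/2 operators

The Hilbert space `⨂_{x ∈ V} ℂ²` is used through its orthonormal product basis, indexed by the
spin configurations `s : V → Fin 2` (the value `0` stands for spin `+1/2`, `1` for `-1/2`); operators
are matrices in this basis. -/

/-- The matrix `S^{(1)}`. -/
def spin1 : Matrix (Fin 2) (Fin 2) ℂ := !![0, 1 / 2; 1 / 2, 0]

/-- The matrix `S^{(2)}`. -/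
def spin2 : Matrix (Fin 2) (Fin 2) ℂ := !![0, -Complex.I / 2; Complex.I / 2, 0]

/-- The matrix `S^{(3)}`. -/
def spin3 : Matrix (Fin 2) (Fin 2) ℂ := !![1 / 2, 0; 0, -1 / 2]

/-- The operator `A ⊗ Id_{V ∖ {x}}`. -/
def onSite {V : Type} [Fintype V] [DecidableEq V] (x : V) (A : Matrix (Fin 2) (Fin 2) ℂ) :
    Matrix (V → Fin 2) (V → Fin 2) ℂ :=
  Matrix.of fun s s' => if ∀ y, y ≠ x → s y = s' y then A (s x) (s' x) else 0

theorem onSite_mulVec {V : Type} [Fintype V] [DecidableEq V] (x : V)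
    (A : Matrix (Fin 2) (Fin 2) ℂ) (f : (V → Fin 2) → ℂ) (s : V → Fin 2) :
    (onSite x A).mulVec f s = ∑ a : Fin 2, A (s x) a * f (Function.update s x a) := by
  classical
  have hinj : Function.Injective (fun a : Fin 2 => Function.update s x a) :=
    Function.update_injective s x
  have : ∑ a : Fin 2, A (s x) a * f (Function.update s x a)
      = ∑ s' ∈ Finset.univ.map ⟨_, hinj⟩, onSite x A s s' * f s' := by
    rw [Finset.sum_map]
    refine Finset.sum_congr rfl fun a _ => ?_
    have h : ∀ y, y ≠ x → s y = Function.update s x a y := by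
      intro y hy
      simp [Function.update_of_ne hy]
    simp only [onSite, Matrix.of_apply, Function.Embedding.coeFn_mk]
    rw [if_pos h, Function.update_self]
  rw [this]
  symm
  refine Finset.sum_subset (Finset.subset_univ _) fun s' _ hs' => ?_
  have : ¬ ∀ y, y ≠ x → s y = s' y := by
    intro h
    apply hs'
    rw [Finset.mem_map]
    refine ⟨s' x, Finset.mem_univ _, ?_⟩
    funext y
    by_cases hy : y = x
    · subst hy; simp
    · simp [Function.update_of_ne hy, h y hy]
  simp only [onSite, Matrix.of_apply]
  rw [if_neg this, zero_mul]

theorem onSite_mul_comm {V : Type} [Fintype V] [DecidableEq V] (x y : V)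
    (A : Matrix (Fin 2) (Fin 2) ℂ) : onSite x A * onSite y A = onSite y A * onSite x A := by
  by_cases hxy : x = y
  · rw [hxy]
  apply Matrix.toLin'.injective
  apply LinearMap.ext
  intro f
  funext s
  simp only [Matrix.toLin'_apply, ← Matrix.mulVec_mulVec, onSite_mulVec, Finset.mul_sum]
  rw [Finset.sum_comm]
  refine Finset.sum_congr rfl fun a _ => Finset.sum_congr rfl fun b _ => ?_
  rw [Function.update_of_ne (Ne.symm hxy), Function.update_of_ne hxy,
    Function.update_comm (Ne.symm hxy)]
  ring

/-- The operator `S_x · S_y` attached to the unordered pair `{x, y}`. -/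
def spinDot {V : Type} [Fintype V] [DecidableEq V] :
    Sym2 V → Matrix (V → Fin 2) (V → Fin 2) ℂ :=
  Sym2.lift ⟨fun x y => onSite x spin1 * onSite y spin1 + onSite x spin2 * onSite y spin2
      + onSite x spin3 * onSite y spin3, fun x y => by
        simp only [onSite_mul_comm x y]⟩

/-- The magnetization operator `M = ∑_x S_x^{(3)}`. -/
def magnetization (V : Type) [Fintype V] [DecidableEq V] :
    Matrix (V → Fin 2) (V → Fin 2) ℂ :=
  ∑ x : V, onSite x spin3

/-- The ferromagnetic Hamiltonian `-∑_{{x,y}} S_x · S_y - h ∑_x S_x^{(3)}`. -/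
def hamFerro {V : Type} [Fintype V] [DecidableEq V] (G : SimpleGraph V) [DecidableRel G.Adj]
    (h : ℝ) : Matrix (V → Fin 2) (V → Fin 2) ℂ :=
  -(∑ e ∈ G.edgeFinset, spinDot e) - (h : ℂ) • magnetization V

/-- The antiferromagnetic Hamiltonian `∑_{{x,y}} S_x · S_y - h ∑_x S_x^{(3)}`. -/
def hamAnti {V : Type} [Fintype V] [DecidableEq V] (G : SimpleGraph V) [DecidableRel G.Adj]
    (h : ℝ) : Matrix (V → Fin 2) (V → Fin 2) ℂ :=
  (∑ e ∈ G.edgeFinset, spinDot e) - (h : ℂ) • magnetization V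

/-- The Gibbs state `⟨A⟩ = Tr (A e^{-βH}) / Tr e^{-βH}`. -/
def gibbs {V : Type} [Fintype V] [DecidableEq V] (H : Matrix (V → Fin 2) (V → Fin 2) ℂ) (β : ℝ)
    (A : Matrix (V → Fin 2) (V → Fin 2) ℂ) : ℂ :=
  (A * NormedSpace.exp (-(β : ℂ) • H)).trace / (NormedSpace.exp (-(β : ℂ) • H)).trace

/-! ### Boxes in `ℤ^d` -/

/-- The box of side `n` in `ℤ^d` (coordinates shifted to `0, …, n-1`) with nearest-neighbour edges:
`{x, y}` is an edge iff `‖x - y‖ = 1`. -/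
def boxGraph (d n : ℕ) : SimpleGraph (Fin d → Fin n) where
  Adj x y := ∑ i, (((x i : ℕ) : ℤ) - ((y i : ℕ) : ℤ)) ^ 2 = 1
  symm := ⟨fun x y h => by
    rw [← h]
    exact Finset.sum_congr rfl fun i _ => by ring⟩
  loopless := ⟨fun x h => by simp at h⟩

instance (d n : ℕ) : DecidableRel (boxGraph d n).Adj :=
  fun x y => inferInstanceAs (Decidable (∑ i, (((x i : ℕ) : ℤ) - ((y i : ℕ) : ℤ)) ^ 2 = 1))

/-- The bipartition of the box into even (`true`, the A sublattice) and odd sites. -/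
def boxColoring (d n : ℕ) : (boxGraph d n).Coloring Bool :=
  SimpleGraph.Coloring.mk (fun x => decide (Even (∑ i, ((x i : ℕ) : ℤ)))) (by
    intro x y hxy heq
    have h1 : ∑ i, (((x i : ℕ) : ℤ) - ((y i : ℕ) : ℤ)) ^ 2 = 1 := hxy
    have h2 : Even (∑ i, ((x i : ℕ) : ℤ)) ↔ Even (∑ i, ((y i : ℕ) : ℤ)) := by simpa using heq
    have h3 : Even (∑ i, ((((x i : ℕ) : ℤ) - ((y i : ℕ) : ℤ)) ^ 2
        - (((x i : ℕ) : ℤ) - ((y i : ℕ) : ℤ)))) := by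
      refine Finset.even_sum _ fun i _ => ?_
      have := Int.even_mul_pred_self (((x i : ℕ) : ℤ) - ((y i : ℕ) : ℤ))
      rwa [show ∀ a : ℤ, a * (a - 1) = a ^ 2 - a from fun a => by ring] at this
    rw [Finset.sum_sub_distrib, h1, Finset.sum_sub_distrib] at h3
    rw [Int.even_sub, Int.even_sub] at h3
    simp [h2] at h3)

/-- The sign `(-1)^x`: `1` on the A sublattice and `-1` on the B sublattice. -/
def sublatticeSign {V : Type} (c : V → Bool) (x : V) : ℝ := if c x then 1 else -1

/-! ### Order parameters of the quantum models -/

/-- `liminf_n n^{-d} ⟨M⟩` in the ferromagnet on the boxes of side `n`. -/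
def magnetizationDensity (d : ℕ) (β h : ℝ) : ℝ :=
  Filter.liminf (fun n : ℕ => 1 / (n : ℝ) ^ d *
    (gibbs (hamFerro (boxGraph d n) h) β (magnetization (Fin d → Fin n))).re) Filter.atTop

/-- The residual magnetization `m*_res(β)`, the limit of `magnetizationDensity` as `h → 0+`. -/
def mRes (d : ℕ) (β : ℝ) : ℝ :=
  Filter.limUnder (nhdsWithin 0 (Set.Ioi 0)) (fun h : ℝ => magnetizationDensity d β h)

/-- The spontaneous magnetization `m*_sp(β) = liminf_n n^{-d} ⟨|M|⟩` at `h = 0`. -/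
def mSp (d : ℕ) (β : ℝ) : ℝ :=
  Filter.liminf (fun n : ℕ => 1 / (n : ℝ) ^ d *
    (gibbs (hamFerro (boxGraph d n) 0) β (CFC.abs (magnetization (Fin d → Fin n)))).re)
    Filter.atTop

/-- The staggered correlation `(-1)^x (-1)^y ⟨S_x^{(3)} S_y^{(3)}⟩` of the antiferromagnet at
`h = 0`. -/
def staggeredCorr {V : Type} [Fintype V] [DecidableEq V] (G : SimpleGraph V) [DecidableRel G.Adj]
    (c : G.Coloring Bool) (β : ℝ) (x y : V) : ℝ :=
  sublatticeSign c x * sublatticeSign c y *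
    (gibbs (hamAnti G 0) β (onSite x spin3 * onSite y spin3)).re

/-- The long-range order parameter `σ̄(β)` of the antiferromagnet, where
`σ̄(β)² = liminf_n n^{-2d} ∑_{x,y} σ(x,y)`. -/
def sigmaBar (d : ℕ) (β : ℝ) : ℝ :=
  Real.sqrt (Filter.liminf (fun n : ℕ => 1 / ((n : ℝ) ^ d) ^ 2 *
    ∑ x, ∑ y, staggeredCorr (boxGraph d n) (boxColoring d n) β x y) Filter.atTop)

/-! ### The Poisson edge process -/

/-- Bridge configurations `ω = ((e₁,t₁), …, (e_k,t_k))`: `ω.1.1` is the number of bridges, `ω.1.2`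
the sequence of their edges and `ω.2` the sequence of their times. -/
abbrev BridgeConfig {V : Type} (G : SimpleGraph V) : Type :=
  Σ p : (Σ k : ℕ, Fin k → G.edgeSet), (Fin p.1 → ℝ)

/-- The simplex `0 < t₁ < ⋯ < t_k < β`. -/
def timeSimplex (k : ℕ) (β : ℝ) : Set (Fin k → ℝ) :=
  {t | StrictMono t ∧ ∀ i, 0 < t i ∧ t i < β}

/-- The law `ρ` of independent Poisson processes of unit intensity on `[0, β]`, one for each edge:
the configurations with given edges `e₁, …, e_k` have density `e^{-β|E|}` with respect to Lebesgue
measure on the simplex `0 < t₁ < ⋯ < t_k < β`. Thus the number of bridges is Poisson with mean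
`β|E|`, and given this number the edges are uniform and independent of the ordered times, which are
uniform in the simplex. -/
def poissonEdge {V : Type} [Fintype V] [DecidableEq V] (G : SimpleGraph V) [DecidableRel G.Adj]
    (β : ℝ) : MeasureTheory.Measure (BridgeConfig G) :=
  MeasureTheory.Measure.sum fun p : (Σ k : ℕ, Fin k → G.edgeSet) =>
    ENNReal.ofReal (Real.exp (-β * (G.edgeFinset.card : ℝ))) •
      MeasureTheory.Measure.map (Sigma.mk p)
        ((MeasureTheory.volume : MeasureTheory.Measure (Fin p.1 → ℝ)).restrict
          (timeSimplex p.1 β))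

/-! ### Cycles and loops

The times `0 = t₀ < t₁ < ⋯ < t_k < t_{k+1} = β` cut the cylinder `V × [0, β]_per` into vertical
segments `(x, j)` with `x ∈ V` and `j = 0, …, k`; segment `(x, j)` is `{x} × [t_j, t_{j+1}]`. A
trajectory runs through whole segments, and is described by the permutation which maps a segment to
the segment that is visited next. The closed trajectories are then the orbits of this permutation. -/

/-- The transposition of the two endpoints of an edge. -/
def edgeSwap {V : Type} [DecidableEq V] : Sym2 V → Equiv.Perm V :=
  Sym2.lift ⟨fun x y => Equiv.swap x y, fun x y => Equiv.swap_comm x y⟩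

theorem edgeSwap_edgeSwap {V : Type} [DecidableEq V] (e : Sym2 V) (x : V) :
    edgeSwap e (edgeSwap e x) = x := by
  induction e with
  | _ a b => simp [edgeSwap]

theorem edgeSwap_color {V : Type} [DecidableEq V] (G : SimpleGraph V) (c : G.Coloring Bool)
    (e : G.edgeSet) (x : V) (h : edgeSwap (e : Sym2 V) x ≠ x) :
    c (edgeSwap (e : Sym2 V) x) = !(c x) := by
  obtain ⟨e, he⟩ := e
  induction e with
  | _ a b =>
    have hab : c a ≠ c b := c.valid he
    simp only [edgeSwap, Sym2.lift_mk] at h ⊢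
    by_cases h1 : x = a
    · subst h1
      rw [Equiv.swap_apply_left]
      revert hab
      cases c x <;> cases c b <;> simp
    · by_cases h2 : x = b
      · subst h2
        rw [Equiv.swap_apply_right]
        revert hab
        cases c x <;> cases c a <;> simp
      · exact absurd (Equiv.swap_apply_of_ne_of_ne h1 h2) h

/-- The successor of a segment on cycles: time always increases; at the top of segment `(x, j)` the
trajectory crosses the bridge if `x` is one of its endpoints, and continues at `x` otherwise. -/
def cycleNext {V : Type} [DecidableEq V] (G : SimpleGraph V) {k : ℕ} (e : Fin k → G.edgeSet) :
    Equiv.Perm (V × Fin (k + 1)) where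
  toFun s := Fin.lastCases (motive := fun _ => V × Fin (k + 1)) (s.1, 0)
    (fun i => (edgeSwap (e i : Sym2 V) s.1, i.succ)) s.2
  invFun s := Fin.cases (motive := fun _ => V × Fin (k + 1)) (s.1, Fin.last k)
    (fun i => (edgeSwap (e i : Sym2 V) s.1, i.castSucc)) s.2
  left_inv := by
    rintro ⟨x, j⟩
    induction j using Fin.lastCases with
    | last => simp
    | cast i => simp [edgeSwap_edgeSwap]
  right_inv := by
    rintro ⟨x, j⟩
    induction j using Fin.cases with
    | zero => simp
    | succ i => simp [edgeSwap_edgeSwap]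

/-- The successor of a segment on loops, for a bipartition `c`: time increases on sites with
`c x = true` and decreases on the other sites. At its end the segment `(x, j)` meets the bridge at
time `t_{j+1}` (when moving up) or `t_j` (when moving down). If `x` is an endpoint of the bridge, the
loop crosses it and continues at the other endpoint, on the same time interval and in the opposite
time direction; otherwise it continues at `x` on the adjacent time interval. -/
def loopStep {V : Type} [DecidableEq V] {G : SimpleGraph V} (c : V → Bool) {k : ℕ}
    (e : Fin k → G.edgeSet) (s : V × Fin (k + 1)) : V × Fin (k + 1) :=
  if c s.1 then
    Fin.lastCases (motive := fun _ => V × Fin (k + 1)) (s.1, 0)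
      (fun i => if edgeSwap (e i : Sym2 V) s.1 = s.1 then (s.1, i.succ)
        else (edgeSwap (e i : Sym2 V) s.1, i.castSucc)) s.2
  else
    Fin.cases (motive := fun _ => V × Fin (k + 1)) (s.1, Fin.last k)
      (fun i => if edgeSwap (e i : Sym2 V) s.1 = s.1 then (s.1, i.castSucc)
        else (edgeSwap (e i : Sym2 V) s.1, i.succ)) s.2

/-- Reversing all orientations inverts the successor map. -/
theorem loopStep_loopStep {V : Type} [DecidableEq V] (G : SimpleGraph V) (c d : V → Bool)
    (hdc : ∀ x, d x = !(c x)) {k : ℕ} (e : Fin k → G.edgeSet)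
    (hc : ∀ i x, edgeSwap (e i : Sym2 V) x ≠ x → c (edgeSwap (e i : Sym2 V) x) = !(c x))
    (s : V × Fin (k + 1)) : loopStep d e (loopStep c e s) = s := by
  obtain ⟨x, j⟩ := s
  cases hx : c x with
  | true =>
    induction j using Fin.lastCases with
    | last => simp [loopStep, hx, hdc]
    | cast i =>
      by_cases h : edgeSwap (e i : Sym2 V) x = x
      · simp [loopStep, hx, hdc, h]
      · have hy := hc i x h
        have h' : ¬ x = edgeSwap (e i : Sym2 V) x := fun h2 => h h2.symm
        simp [loopStep, hx, hdc, h, hy, edgeSwap_edgeSwap, h']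
  | false =>
    induction j using Fin.cases with
    | zero => simp [loopStep, hx, hdc]
    | succ i =>
      by_cases h : edgeSwap (e i : Sym2 V) x = x
      · simp [loopStep, hx, hdc, h]
      · have hy := hc i x h
        have h' : ¬ x = edgeSwap (e i : Sym2 V) x := fun h2 => h h2.symm
        simp [loopStep, hx, hdc, h, hy, edgeSwap_edgeSwap, h']

/-- The successor map on loops, as a permutation of the segments. -/
def loopNext {V : Type} [DecidableEq V] (G : SimpleGraph V) (c : G.Coloring Bool) {k : ℕ}
    (e : Fin k → G.edgeSet) : Equiv.Perm (V × Fin (k + 1)) where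
  toFun := loopStep c e
  invFun := loopStep (fun x => !(c x)) e
  left_inv := loopStep_loopStep G c (fun x => !(c x)) (fun _ => rfl) e
    fun i x h => edgeSwap_color G c (e i) x h
  right_inv := loopStep_loopStep G (fun x => !(c x)) c (fun _ => by simp) e
    fun i x h => by simp [edgeSwap_color G c (e i) x h]

/-- The length `t_{j+1} - t_j` of the segments with index `j`. -/
def segLength (β : ℝ) {k : ℕ} (t : Fin k → ℝ) (j : Fin (k + 1)) : ℝ :=
  (Fin.snoc t β : Fin (k + 1) → ℝ) j - (Fin.cons 0 t : Fin (k + 1) → ℝ) j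

/-- The closed trajectories (cycles or loops) of a successor permutation: its orbits. -/
abbrev Orbits {V : Type} {k : ℕ} (f : Equiv.Perm (V × Fin (k + 1))) : Type :=
  Quotient (Equiv.Perm.SameCycle.setoid f)

open Classical in
/-- The vertical length `L(γ)` of a closed trajectory. -/
def orbitLength {V : Type} [Fintype V] (β : ℝ) {k : ℕ} (f : Equiv.Perm (V × Fin (k + 1)))
    (t : Fin k → ℝ) (γ : Orbits f) : ℝ :=
  ∑ s : V × Fin (k + 1), if (Quotient.mk _ s : Orbits f) = γ then segLength β t s.2 else 0

/-- The closed trajectory `γ_x` that contains `(x, 0)`. -/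
def orbitOf {V : Type} {k : ℕ} (f : Equiv.Perm (V × Fin (k + 1))) (x : V) : Orbits f :=
  Quotient.mk _ (x, 0)

/-- `L(γ_x)` in the cycle model. -/
def cycleLengthAt {V : Type} [Fintype V] [DecidableEq V] (G : SimpleGraph V) (β : ℝ) (x : V)
    (ω : BridgeConfig G) : ℝ :=
  orbitLength β (cycleNext G ω.1.2) ω.2 (orbitOf (cycleNext G ω.1.2) x)

/-- `L(γ_x)` in the loop model. -/
def loopLengthAt {V : Type} [Fintype V] [DecidableEq V] (G : SimpleGraph V) (c : G.Coloring Bool)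
    (β : ℝ) (x : V) (ω : BridgeConfig G) : ℝ :=
  orbitLength β (loopNext G c ω.1.2) ω.2 (orbitOf (loopNext G c ω.1.2) x)

open Classical in
/-- The weight `∏_{γ} (1 + e^{-2hL(γ)})` over all cycles of `ω`. -/
def cycleWeight {V : Type} [Fintype V] [DecidableEq V] (G : SimpleGraph V) (β h : ℝ)
    (ω : BridgeConfig G) : ℝ :=
  ∏ γ : Orbits (cycleNext G ω.1.2),
    (1 + Real.exp (-2 * h * orbitLength β (cycleNext G ω.1.2) ω.2 γ))

/-- The weight `2^{|𝓛(ω)|}`, where `|𝓛(ω)|` is the number of loops of `ω`. -/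
def loopWeight {V : Type} [Fintype V] [DecidableEq V] (G : SimpleGraph V) (c : G.Coloring Bool)
    (ω : BridgeConfig G) : ℝ :=
  2 ^ Nat.card (Orbits (loopNext G c ω.1.2))

/-- The measure `w μ`, normalized to a probability measure. -/
def reweight {Ω : Type} [MeasurableSpace Ω] (μ : MeasureTheory.Measure Ω) (w : Ω → ℝ) :
    MeasureTheory.Measure Ω :=
  (∫⁻ ω, ENNReal.ofReal (w ω) ∂μ)⁻¹ • μ.withDensity (fun ω => ENNReal.ofReal (w ω))

/-- The probability measure of the cycle model, with density proportional to
`∏_γ (1 + e^{-2hL(γ)})` with respect to the Poisson edge process. -/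
def cycleMeasure {V : Type} [Fintype V] [DecidableEq V] (G : SimpleGraph V) [DecidableRel G.Adj]
    (β h : ℝ) : MeasureTheory.Measure (BridgeConfig G) :=
  reweight (poissonEdge G β) (cycleWeight G β h)

/-- The probability measure of the loop model without external field, with density proportional to
`2^{|𝓛(ω)|}` with respect to the Poisson edge process. -/
def loopMeasure {V : Type} [Fintype V] [DecidableEq V] (G : SimpleGraph V) [DecidableRel G.Adj]
    (c : G.Coloring Bool) (β : ℝ) : MeasureTheory.Measure (BridgeConfig G) :=
  reweight (poissonEdge G β) (loopWeight G c)

/-! ### Infinite and macroscopic cycles and loops -/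

/-- `n^{-d} 𝔼(#{x : L(γ_x) > K})` in the cycle model on the box of side `n`. -/
def cycleFraction (d : ℕ) (β h : ℝ) (n : ℕ) (K : ℝ) : ℝ :=
  1 / (n : ℝ) ^ d * ∫ ω, (Nat.card {x : Fin d → Fin n // K < cycleLengthAt (boxGraph d n) β x ω} : ℝ)
    ∂(cycleMeasure (boxGraph d n) β h)

/-- `n^{-d} 𝔼(#{x : L(γ_x) > K})` in the loop model on the box of side `n`, at `h = 0`. -/
def loopFraction (d : ℕ) (β : ℝ) (n : ℕ) (K : ℝ) : ℝ :=
  1 / (n : ℝ) ^ d * ∫ ω, (Nat.card {x : Fin d → Fin n //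
      K < loopLengthAt (boxGraph d n) (boxColoring d n) β x ω} : ℝ)
    ∂(loopMeasure (boxGraph d n) (boxColoring d n) β)

/-- `liminf_n` of the fraction of vertices in cycles longer than `K`. -/
def cycleFractionLong (d : ℕ) (β h K : ℝ) : ℝ :=
  Filter.liminf (fun n : ℕ => cycleFraction d β h n K) Filter.atTop

/-- `liminf_n` of the fraction of vertices in cycles longer than `ε n^d`. -/
def cycleFractionMacro (d : ℕ) (β h ε : ℝ) : ℝ :=
  Filter.liminf (fun n : ℕ => cycleFraction d β h n (ε * (n : ℝ) ^ d)) Filter.atTop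

/-- `liminf_n` of the fraction of vertices in loops longer than `ε n^d`. -/
def loopFractionMacro (d : ℕ) (β ε : ℝ) : ℝ :=
  Filter.liminf (fun n : ℕ => loopFraction d β n (ε * (n : ℝ) ^ d)) Filter.atTop

/-- The fraction `η_∞(β, h)` of vertices in infinite cycles. -/
def etaInfCycles (d : ℕ) (β h : ℝ) : ℝ :=
  Filter.limUnder Filter.atTop (fun K : ℝ => cycleFractionLong d β h K)

/-- The fraction `η_macro(β, h)` of vertices in macroscopic cycles. -/
def etaMacroCycles (d : ℕ) (β h : ℝ) : ℝ :=
  Filter.limUnder (nhdsWithin 0 (Set.Ioi 0)) (fun ε : ℝ => cycleFractionMacro d β h ε)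

/-- The fraction `η_macro(β, 0)` of vertices in macroscopic loops. -/
def etaMacroLoops (d : ℕ) (β : ℝ) : ℝ :=
  Filter.limUnder (nhdsWithin 0 (Set.Ioi 0)) (fun ε : ℝ => loopFractionMacro d β ε)

end

end Heisenberg

/-!
The Gibbs states are rewritten as expectations in the cycle and loop models, after which every
claim becomes a comparison of moments.

*Representation.* With `Tₑ` the operator that exchanges the spins at the endpoints of `e` one has
`S_x · S_y = Tₑ / 2 - 1 / 4`, so `exp (-2βH)` is, up to a constant, `exp (2βhM) exp (β ∑ₑ Tₑ)`
for the ferromagnet. For the antiferromagnet, rotating the spins of one sublattice turns `1 - Tₑ`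
into a matrix `Uₑ` with entries `0` and `1` (`sublatticeRotation_swapMatrix`), and `exp (-2βH)`
becomes a constant times `exp (β ∑ₑ Uₑ)`. Expanding the exponential gives words of bridges, and
the trace of a word is a sum over the spin configurations on the space-time segments that are
constant along cycles (for `Tₑ`) or loops (for `Uₑ`); this is `trace_transfer`. The coefficient
`βᵏ / k!` of a word of length `k` is the volume of the simplex of its bridge times. Spins are
therefore independent colours of the cycles or loops.

*Cycles.* A cycle meets all time levels equally often, so its length is `β` times its number of
sites at time `0`, and its mean spin per site in the field `h` is `½ tanh (h L)`. Discarding the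
cycles with `L ≤ K` and letting `n → ∞`, then `K → ∞`, then `h → 0+` proves the bound on the
residual magnetization. At `h = 0` the expected sum of the lengths `L(γ_x)` is `4β⟨M²⟩`. As the
lengths are at most `β n^d`, this sum is of order `n^{2d}` if and only if there are macroscopic
cycles (`tendsto_and_pos_iff_of_comparison`), and `⟨M²⟩` is of order `n^{2d}` if and only if
`⟨|M|⟩` is of order `n^d`. This is the criterion for spontaneous magnetization.

*Loops.* The argument for the staggered magnetization is the same, except that the length of a
loop is not determined by its intersection with time `0`. All gaps between the ordered bridge
times have the same mean (`lintegral_segLength`), so the expected sum of the lengths is a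
combination of the correlations `f_k(j) = Tr (M Aʲ M Aᵏ⁻ʲ)` with `A = ∑ₑ Uₑ`. In an eigenbasis of
`A` these are convex and symmetric in `j`. Hence `f_k(j) ≤ f_k(0)`, and `f_k(0) - f_k(j)` is at
most `j` times the first decrement, which is bounded by `2 Tr Aᵏ` as each `Uₑ` changes `M` by at
most `2` (`corr_ge`). The expected sum of the lengths thus equals `4β⟨M²⟩` up to `O(n^d)`, where
`M` is the staggered magnetization of the antiferromagnet.
-/

namespace Heisenberg

open MeasureTheory Filter Topology
open scoped ENNReal

/-! ### Ordered times -/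

theorem measurableSet_timeSimplex (k : ℕ) (β : ℝ) : MeasurableSet (timeSimplex k β) := by
  have : timeSimplex k β = (⋂ (i : Fin k) (j : Fin k) (_ : i < j), {t | t i < t j}) ∩
      ⋂ i : Fin k, {t | 0 < t i ∧ t i < β} := by
    ext t
    simp only [timeSimplex, StrictMono, Set.mem_ofPred_eq, Set.mem_inter_iff, Set.mem_iInter]
  rw [this]
  refine MeasurableSet.inter ?_ (MeasurableSet.iInter fun i => ?_)
  · exact MeasurableSet.iInter fun i => MeasurableSet.iInter fun j => MeasurableSet.iInter fun _ =>
      measurableSet_lt (measurable_pi_apply i) (measurable_pi_apply j)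
  · exact (measurableSet_lt measurable_const (measurable_pi_apply i)).inter
      (measurableSet_lt (measurable_pi_apply i) measurable_const)

theorem insertNth_mem_timeSimplex {k : ℕ} {β : ℝ} (j : Fin (k + 1)) (u : ℝ)
    (t : Fin k → ℝ) :
    (j.insertNth u t : Fin (k + 1) → ℝ) ∈ timeSimplex (k + 1) β ↔
      t ∈ timeSimplex k β ∧ (Fin.cons 0 t : Fin (k + 1) → ℝ) j < u ∧
        u < (Fin.snoc t β : Fin (k + 1) → ℝ) j := by
  constructor
  · rintro ⟨hm, hb⟩
    refine ⟨⟨?_, ?_⟩, ?_, ?_⟩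
    · have := hm.comp (Fin.strictMono_succAbove j)
      intro a b hab
      simpa using this hab
    · intro i
      simpa using hb (j.succAbove i)
    · induction j using Fin.cases with
      | zero => simpa using (hb 0).1
      | succ i =>
        have := hm (Fin.castSucc_lt_succ (i := i))
        have h2 := Fin.insertNth_apply_succAbove (α := fun _ => ℝ) i.succ u t i
        rw [Fin.succAbove_of_castSucc_lt _ _ (Fin.castSucc_lt_succ (i := i))] at h2
        rw [h2] at this
        simpa using this
    · induction j using Fin.lastCases with
      | last => simpa using (hb (Fin.last k)).2
      | cast i =>
        have := hm (Fin.castSucc_lt_succ (i := i))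
        have h2 := Fin.insertNth_apply_succAbove (α := fun _ => ℝ) i.castSucc u t i
        rw [Fin.succAbove_of_le_castSucc _ _ le_rfl] at h2
        rw [h2] at this
        simpa using this
  · rintro ⟨⟨hm, hb⟩, h1, h2⟩
    have low : ∀ i : Fin k, i.castSucc < j → t i < u := by
      intro i hi
      refine lt_of_le_of_lt ?_ h1
      induction j using Fin.cases with
      | zero => simp at hi
      | succ l => simpa using hm.monotone (Fin.castSucc_lt_succ_iff.1 hi)
    have high : ∀ i : Fin k, j ≤ i.castSucc → u < t i := by
      intro i hi
      refine lt_of_lt_of_le h2 ?_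
      induction j using Fin.lastCases with
      | last => exact absurd hi (by simp [Fin.le_def])
      | cast l => simpa using hm.monotone (Fin.castSucc_le_castSucc_iff.1 hi)
    have hu0 : 0 < u := by
      refine lt_of_le_of_lt ?_ h1
      induction j using Fin.cases with
      | zero => simp
      | succ l => simpa using (hb l).1.le
    have huβ : u < β := by
      refine lt_of_lt_of_le h2 ?_
      induction j using Fin.lastCases with
      | last => simp
      | cast l => simpa using (hb l).2.le
    refine ⟨?_, ?_⟩
    · intro a b hab
      rcases Fin.eq_self_or_eq_succAbove j a with ha | ⟨a, rfl⟩ <;>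
      rcases Fin.eq_self_or_eq_succAbove j b with hb' | ⟨b, rfl⟩
      · exact absurd hab (by simp [ha, hb'])
      · subst a
        simpa using high b (Fin.lt_succAbove_iff_le_castSucc _ _ |>.1 hab)
      · subst b
        simpa using low a (Fin.succAbove_lt_iff_castSucc_lt _ _ |>.1 hab)
      · simpa using hm (Fin.succAbove_lt_succAbove_iff.1 hab)
    · intro a
      rcases Fin.eq_self_or_eq_succAbove j a with rfl | ⟨a, rfl⟩
      · simpa using ⟨hu0, huβ⟩
      · simpa using hb a

/-- The points of the `(k+1)`-simplex are obtained in exactly one way by inserting a `j`-th time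
between its neighbours in a point of the `k`-simplex. Hence the integral of the `j`-th gap does not
depend on `j`. -/
theorem lintegral_segLength {k : ℕ} (β : ℝ) (j : Fin (k + 1)) :
    ∫⁻ t in timeSimplex k β, ENNReal.ofReal (segLength β t j) =
      volume (timeSimplex (k + 1) β) := by
  have hmp := (volume_preserving_piFinSuccAbove (fun _ : Fin (k + 1) => ℝ) j).symm
  rw [← hmp.measure_preimage (measurableSet_timeSimplex (k + 1) β).nullMeasurableSet,
    Measure.volume_eq_prod, Measure.prod_apply_symm
      (hmp.measurable (measurableSet_timeSimplex (k + 1) β)),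
    ← lintegral_indicator (measurableSet_timeSimplex k β)]
  refine lintegral_congr fun t => ?_
  have hset : ((fun u => (u, t)) ⁻¹' ((MeasurableEquiv.piFinSuccAbove (fun _ => ℝ) j).symm ⁻¹'
      timeSimplex (k + 1) β)) = {u | t ∈ timeSimplex k β ∧
        (Fin.cons 0 t : Fin (k + 1) → ℝ) j < u ∧ u < (Fin.snoc t β : Fin (k + 1) → ℝ) j} := by
    ext u
    exact insertNth_mem_timeSimplex j u t
  rw [hset]
  by_cases ht : t ∈ timeSimplex k β
  · rw [Set.indicator_of_mem ht]
    simp only [ht, true_and]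
    exact Real.volume_Ioo.symm
  · simp [ht]

theorem sum_segLength {k : ℕ} (β : ℝ) (t : Fin k → ℝ) : ∑ j, segLength β t j = β := by
  simp only [segLength, Finset.sum_sub_distrib]
  rw [Fin.sum_univ_castSucc, Fin.sum_univ_succ]
  simp

theorem segLength_nonneg {k : ℕ} {β : ℝ} (hβ : 0 < β) {t : Fin k → ℝ} (ht : t ∈ timeSimplex k β)
    (j : Fin (k + 1)) : 0 ≤ segLength β t j := by
  rw [segLength, sub_nonneg]
  induction j using Fin.lastCases with
  | last =>
    rw [Fin.snoc_last]
    cases k with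
    | zero => simpa using hβ.le
    | succ k => rw [← Fin.succ_last, Fin.cons_succ]; exact (ht.2 _).2.le
  | cast i =>
    rw [Fin.snoc_castSucc]
    cases k with
    | zero => exact i.elim0
    | succ k =>
      induction i using Fin.cases with
      | zero => simpa using (ht.2 0).1.le
      | succ i =>
        rw [Fin.castSucc_succ, Fin.cons_succ]
        exact (ht.1 (Fin.castSucc_lt_succ (i := i))).le

theorem measurable_segLength {k : ℕ} (β : ℝ) (j : Fin (k + 1)) :
    Measurable fun t : Fin k → ℝ => segLength β t j := by
  unfold segLength
  refine Measurable.sub ?_ ?_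
  · induction j using Fin.lastCases with
    | last => simp
    | cast i => simpa using measurable_pi_apply i
  · induction j using Fin.cases with
    | zero => simp
    | succ i => simpa using measurable_pi_apply i

theorem volume_timeSimplex {β : ℝ} (hβ : 0 < β) (k : ℕ) :
    volume (timeSimplex k β) = ENNReal.ofReal (β ^ k / k.factorial) := by
  induction k with
  | zero =>
    have : timeSimplex 0 β = Set.univ := by
      ext t; simp [timeSimplex, StrictMono]
    rw [this, volume_pi, ← Set.pi_univ Set.univ, Measure.pi_pi]
    simp
  | succ k ih =>
    have h1 : ∑ j : Fin (k + 1), ∫⁻ t in timeSimplex k β, ENNReal.ofReal (segLength β t j) =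
        ENNReal.ofReal β * volume (timeSimplex k β) := by
      rw [← lintegral_finsetSum _ fun j _ => (measurable_segLength β j).ennreal_ofReal]
      rw [setLIntegral_congr_fun (g := fun _ => ENNReal.ofReal β) (measurableSet_timeSimplex k β)
        fun t ht => by
          dsimp only
          rw [← ENNReal.ofReal_sum_of_nonneg fun j _ => segLength_nonneg hβ ht j, sum_segLength]]
      rw [setLIntegral_const]
    simp only [lintegral_segLength β, Finset.sum_const, Finset.card_univ, Fintype.card_fin,
      nsmul_eq_mul] at h1
    rw [ih, ← ENNReal.ofReal_mul hβ.le] at h1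
    have hk : ((k + 1 : ℕ) : ℝ≥0∞) ≠ 0 := by simp
    rw [← ENNReal.mul_right_inj hk (ENNReal.natCast_ne_top _), h1, ← ENNReal.ofReal_natCast (k + 1),
      ← ENNReal.ofReal_mul (by positivity), Nat.factorial_succ]
    congr 1
    push_cast
    field_simp
    ring

/-! ### Expectations in the reweighted Poisson process -/

/-- The words of bridges `(k, e₁, …, e_k)`, that is, bridge configurations without their times. -/
abbrev BridgeWord {V : Type} (G : SimpleGraph V) : Type := Σ k : ℕ, Fin k → G.edgeSet

section Expectation

variable {V : Type} [Fintype V] [DecidableEq V] (G : SimpleGraph V) [DecidableRel G.Adj]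

omit [Fintype V] [DecidableEq V] [DecidableRel G.Adj] in
theorem measurable_sigmaMk (p : BridgeWord G) :
    Measurable fun t : Fin p.1 → ℝ => (⟨p, t⟩ : BridgeConfig G) := fun _ hs =>
  MeasurableSpace.measurableSet_iInf.1 hs p

omit [Fintype V] [DecidableEq V] [DecidableRel G.Adj] in
theorem measurable_of_sections {γ : Type*} [MeasurableSpace γ] {F : BridgeConfig G → γ}
    (h : ∀ p, Measurable fun t => F ⟨p, t⟩) : Measurable F := fun _ hs =>
  MeasurableSpace.measurableSet_iInf.2 fun p => h p hs

theorem lintegral_poissonEdge (β : ℝ) {F : BridgeConfig G → ℝ≥0∞} (hF : Measurable F) :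
    ∫⁻ ω, F ω ∂poissonEdge G β = ENNReal.ofReal (Real.exp (-β * (G.edgeFinset.card : ℝ))) *
      ∑' p : BridgeWord G, ∫⁻ t in timeSimplex p.1 β, F ⟨p, t⟩ := by
  rw [poissonEdge, lintegral_sum_measure, ← ENNReal.tsum_mul_left]
  refine tsum_congr fun p => ?_
  rw [lintegral_smul_measure, lintegral_map hF (measurable_sigmaMk G p), smul_eq_mul]

theorem ae_poissonEdge (β : ℝ) : ∀ᵐ ω ∂poissonEdge G β, ω.2 ∈ timeSimplex ω.1.1 β := by
  have hm : MeasurableSet {ω : BridgeConfig G | ω.2 ∈ timeSimplex ω.1.1 β} :=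
    MeasurableSpace.measurableSet_iInf.2 fun p => measurableSet_timeSimplex p.1 β
  rw [poissonEdge, Measure.ae_sum_iff' hm]
  intro p
  refine Measure.ae_smul_measure ?_ _
  rw [ae_map_iff (measurable_sigmaMk G p).aemeasurable hm]
  exact ae_restrict_mem (measurableSet_timeSimplex p.1 β)

variable {G} {β : ℝ} {W : BridgeWord G → ℝ} {Z : ℝ}

theorem lintegral_reweight {F : BridgeConfig G → ℝ≥0∞} (hF : Measurable F) :
    ∫⁻ ω, F ω ∂reweight (poissonEdge G β) (fun ω => W ω.1) =
      (∑' p : BridgeWord G, ENNReal.ofReal (W p) * volume (timeSimplex p.1 β))⁻¹ *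
        ∑' p : BridgeWord G, ENNReal.ofReal (W p) * ∫⁻ t in timeSimplex p.1 β, F ⟨p, t⟩ := by
  have hW : Measurable fun ω : BridgeConfig G => ENNReal.ofReal (W ω.1) :=
    measurable_of_sections G fun p => (measurable_const : Measurable fun _ => ENNReal.ofReal (W p))
  set c := ENNReal.ofReal (Real.exp (-β * (G.edgeFinset.card : ℝ))) with hc
  have hc0 : c ≠ 0 := by simp [hc, Real.exp_pos]
  have hct : c ≠ ∞ := ENNReal.ofReal_ne_top
  rw [reweight, lintegral_smul_measure, lintegral_withDensity_eq_lintegral_mul _ hW hF,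
    lintegral_poissonEdge G β hW, lintegral_poissonEdge G β (hW.mul hF), smul_eq_mul,
    ENNReal.mul_inv (Or.inl hc0) (Or.inl hct), ← hc]
  simp only [lintegral_const, Pi.mul_apply, lintegral_const_mul' _ _ ENNReal.ofReal_ne_top,
    Measure.restrict_apply MeasurableSet.univ, Set.univ_inter]
  rw [mul_comm c⁻¹, mul_assoc, ← mul_assoc c⁻¹, ENNReal.inv_mul_cancel hc0 hct, one_mul]

omit [DecidableEq V] in
/-- Sums over words may be taken length by length. -/
theorem tsum_bridgeWord_ofReal {g : BridgeWord G → ℝ} (hg : ∀ p, 0 ≤ g p) {X : ℝ}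
    (hX : HasSum (fun k => ∑ e : Fin k → G.edgeSet, g ⟨k, e⟩) X) :
    ∑' p, ENNReal.ofReal (g p) = ENNReal.ofReal X := by
  rw [ENNReal.tsum_sigma', ← hX.tsum_eq,
    ENNReal.ofReal_tsum_of_nonneg (fun k => Finset.sum_nonneg fun e _ => hg _) hX.summable]
  refine tsum_congr fun k => ?_
  rw [tsum_fintype, ENNReal.ofReal_sum_of_nonneg fun e _ => hg _]

omit [DecidableEq V] in
theorem tsum_weight_volume (hβ : 0 < β) (hW : ∀ p, 0 ≤ W p)
    (hZ : HasSum (fun k : ℕ => ∑ e : Fin k → G.edgeSet, W ⟨k, e⟩ * (β ^ k / k.factorial)) Z) :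
    ∑' p : BridgeWord G, ENNReal.ofReal (W p) * volume (timeSimplex p.1 β) =
      ENNReal.ofReal Z := by
  rw [← tsum_bridgeWord_ofReal (g := fun p => W p * (β ^ p.1 / p.1.factorial))
    (fun p => mul_nonneg (hW p) (by positivity)) hZ]
  refine tsum_congr fun p => ?_
  rw [volume_timeSimplex hβ, ENNReal.ofReal_mul (hW p)]

theorem isProbabilityMeasure_reweight (hβ : 0 < β) (hW : ∀ p, 0 ≤ W p) (hZ0 : 0 < Z)
    (hZ : HasSum (fun k : ℕ => ∑ e : Fin k → G.edgeSet, W ⟨k, e⟩ * (β ^ k / k.factorial)) Z) :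
    IsProbabilityMeasure (reweight (poissonEdge G β) (fun ω => W ω.1)) := by
  constructor
  rw [← lintegral_one, lintegral_reweight measurable_const]
  simp only [lintegral_const, one_mul, Measure.restrict_apply MeasurableSet.univ, Set.univ_inter]
  rw [tsum_weight_volume hβ hW hZ, ENNReal.inv_mul_cancel (by simpa using hZ0)
    ENNReal.ofReal_ne_top]

theorem ae_reweight (w : BridgeConfig G → ℝ) :
    ∀ᵐ ω ∂reweight (poissonEdge G β) w, ω.2 ∈ timeSimplex ω.1.1 β :=
  Measure.ae_smul_measure ((withDensity_absolutelyContinuous _ _).ae_le (ae_poissonEdge G β)) _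

/-- Expectations under a weight that does not depend on the times of the bridges: the expectation
of `f` is a quotient of two power series in `β`, given the integrals `I k e` of `f` over the times
of the bridges. -/
theorem integral_reweight (hβ : 0 < β) (hW : ∀ p, 0 ≤ W p) (hZ0 : 0 < Z)
    (hZ : HasSum (fun k : ℕ => ∑ e : Fin k → G.edgeSet, W ⟨k, e⟩ * (β ^ k / k.factorial)) Z)
    {f : BridgeConfig G → ℝ} (hf : Measurable f)
    (hf0 : ∀ (p : BridgeWord G), ∀ t ∈ timeSimplex p.1 β, 0 ≤ f ⟨p, t⟩) {I : BridgeWord G → ℝ}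
    (hI0 : ∀ p, 0 ≤ I p)
    (hI : ∀ p, ∫⁻ t in timeSimplex p.1 β, ENNReal.ofReal (f ⟨p, t⟩) = ENNReal.ofReal (I p))
    {X : ℝ} (hX0 : 0 ≤ X)
    (hX : HasSum (fun k : ℕ => ∑ e : Fin k → G.edgeSet, W ⟨k, e⟩ * I ⟨k, e⟩) X) :
    ∫ ω, f ω ∂reweight (poissonEdge G β) (fun ω => W ω.1) = X / Z := by
  rw [integral_eq_lintegral_of_nonneg_ae ((ae_reweight _).mono fun ω hω => hf0 ω.1 ω.2 hω)
    hf.aestronglyMeasurable, lintegral_reweight hf.ennreal_ofReal, tsum_weight_volume hβ hW hZ]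
  simp only [hI, ← ENNReal.ofReal_mul (hW _)]
  rw [tsum_bridgeWord_ofReal (fun p => mul_nonneg (hW p) (hI0 p)) hX,
    ← ENNReal.ofReal_inv_of_pos hZ0, ← ENNReal.ofReal_mul (by positivity),
    ENNReal.toReal_ofReal (by positivity)]
  ring

end Expectation

open Matrix

/-! ### Traces of words as sums over colourings of orbits -/

section Transfer

variable {S : Type} [Fintype S] [DecidableEq S]

/-- The entries of a product of matrices as a sum over paths. -/
theorem prod_ofFn_apply {k : ℕ} (C : Fin k → Matrix S S ℝ) (s s' : S) :
    (List.ofFn C).prod s s' = ∑ p : Fin (k + 1) → S,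
      if p 0 = s ∧ p (Fin.last k) = s' then ∏ i, C i (p i.castSucc) (p i.succ) else 0 := by
  induction k generalizing s s' with
  | zero =>
    rw [← (Equiv.funUnique (Fin 1) S).symm.sum_comp]
    simp [Matrix.one_apply, ite_and]
  | succ k ih =>
    rw [List.ofFn_succ, List.prod_cons, Matrix.mul_apply,
      ← (Fin.consEquiv fun _ : Fin (k + 2) => S).sum_comp, Fintype.sum_prod_type]
    simp only [ih, Finset.mul_sum]
    rw [Finset.sum_comm, Finset.sum_comm (γ := S)]
    refine Finset.sum_congr rfl fun p _ => ?_
    have hlast : ∀ a : S, (Fin.cons a p : Fin (k + 2) → S) (Fin.last (k + 1)) =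
        p (Fin.last k) := fun a => by rw [← Fin.succ_last, Fin.cons_succ]
    simp only [Fin.consEquiv, Equiv.coe_fn_mk, Fin.cons_zero, hlast, Fin.prod_univ_succ,
      Fin.castSucc_zero, Fin.cons_succ, Fin.castSucc_succ, ite_and, mul_ite, mul_zero]
    by_cases h : p (Fin.last k) = s' <;> simp [h]

/-- The trace of a product of matrices as a sum over closed paths. -/
theorem trace_diagonal_mul_prod {k : ℕ} (f : S → ℝ) (C : Fin k → Matrix S S ℝ) :
    (diagonal f * (List.ofFn C).prod).trace = ∑ p : Fin (k + 1) → S,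
      f (p 0) * if p 0 = p (Fin.last k) then ∏ i, C i (p i.castSucc) (p i.succ) else 0 := by
  simp only [Matrix.trace, Matrix.diag_apply, diagonal_mul, prod_ofFn_apply, Finset.mul_sum]
  rw [Finset.sum_comm]
  refine Finset.sum_congr rfl fun p _ => ?_
  simp only [ite_and, mul_ite, mul_zero]
  rw [Finset.sum_ite_eq]
  simp [eq_comm]

theorem prod_ofFn_sum {E : Type} [Fintype E] {k : ℕ} (C : Fin k → E → Matrix S S ℝ) :
    (List.ofFn fun i => ∑ e, C i e).prod = ∑ e : Fin k → E, (List.ofFn fun i => C i (e i)).prod := by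
  classical
  simpa using (MultilinearMap.mkPiAlgebraFin ℝ k (Matrix S S ℝ)).map_sum C

omit [DecidableEq S] in
theorem prod_ofFn_insert {R : Type} [Monoid R] (A D : R) {k : ℕ} (j : Fin k) :
    (List.ofFn fun i : Fin k => A * if i = j then D else 1).prod =
      A ^ (j + 1 : ℕ) * D * A ^ (k - (j + 1 : ℕ)) := by
  induction k with
  | zero => exact j.elim0
  | succ k ih =>
    rw [List.ofFn_succ, List.prod_cons]
    induction j using Fin.cases with
    | zero => simp [Fin.succ_ne_zero, List.ofFn_const]
    | succ j =>
      simp only [Fin.succ_inj, ih, Fin.val_succ, (Fin.succ_ne_zero j).symm, if_false, mul_one]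
      rw [pow_succ' A (j + 1), Nat.add_sub_add_right]
      simp only [mul_assoc]

end Transfer

section Orbits

variable {V : Type} {k : ℕ}

theorem orbit_mk_apply (f : Equiv.Perm (V × Fin (k + 1))) (s : V × Fin (k + 1)) :
    (Quotient.mk _ (f s) : Orbits f) = Quotient.mk _ s :=
  Quotient.sound (Equiv.Perm.sameCycle_apply_left.2 (Equiv.Perm.SameCycle.refl _ _))

/-- A colouring that is invariant under `f` is constant on the orbits of `f`. -/
theorem eq_of_sameCycle [Finite V] {α : Type*} {f : Equiv.Perm (V × Fin (k + 1))}
    {σ : V × Fin (k + 1) → α} (hσ : ∀ s, σ (f s) = σ s) {s s' : V × Fin (k + 1)}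
    (h : f.SameCycle s s') : σ s = σ s' := by
  obtain ⟨i, rfl⟩ := h.exists_nat_pow_eq
  induction i with
  | zero => simp
  | succ i ih =>
    rw [pow_succ', Equiv.Perm.mul_apply, hσ]
    exact ih (by simpa using Equiv.Perm.SameCycle.refl f s)

open Classical in
theorem sum_invariant_colorings [Fintype V] [DecidableEq V] (f : Equiv.Perm (V × Fin (k + 1)))
    (Φ : (V × Fin (k + 1) → Fin 2) → ℝ) :
    ∑ σ : V × Fin (k + 1) → Fin 2, (if ∀ s, σ (f s) = σ s then Φ σ else 0) =
      ∑ τ : Orbits f → Fin 2, Φ fun s => τ (Quotient.mk _ s) := by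
  rw [← Finset.sum_filter]
  symm
  refine Finset.sum_bij (fun τ _ s => τ (Quotient.mk _ s)) ?_ ?_ ?_ ?_
  · intro τ _
    simp [orbit_mk_apply]
  · intro τ _ τ' _ h
    funext γ
    induction γ using Quotient.ind with
    | _ s => exact congrFun h s
  · intro σ hσ
    rw [Finset.mem_filter] at hσ
    exact ⟨Quotient.lift σ fun _ _ h => eq_of_sameCycle hσ.2 h, Finset.mem_univ _, rfl⟩
  · intro τ _
    rfl

end Orbits

section TraceTransfer

variable {V : Type} [Fintype V] [DecidableEq V]

open Classical in
/-- If the weight of a closed path of spin configurations is the indicator function of the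
colourings that are invariant under `next`, then traces of words with diagonal insertions at the
levels `0` and `j` are sums over the colourings of the orbits. -/
theorem trace_transfer {E : Type} [Fintype E] (B : E → Matrix (V → Fin 2) (V → Fin 2) ℝ) {k : ℕ}
    (next : (Fin k → E) → Equiv.Perm (V × Fin (k + 1)))
    (hB : ∀ (e : Fin k → E) (p : Fin (k + 1) → V → Fin 2),
      (if p 0 = p (Fin.last k) then ∏ i, B (e i) (p i.castSucc) (p i.succ) else 0) =
        if ∀ s, p (next e s).2 (next e s).1 = p s.2 s.1 then 1 else 0)
    (f g : (V → Fin 2) → ℝ) (j : Fin (k + 1)) :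
    (diagonal f * ((∑ e, B e) ^ (j : ℕ) * diagonal g * (∑ e, B e) ^ (k - (j : ℕ)))).trace =
      ∑ e : Fin k → E, ∑ τ : Orbits (next e) → Fin 2,
        f (fun x => τ (Quotient.mk _ (x, 0))) * g (fun x => τ (Quotient.mk _ (x, j))) := by
  -- the sum over closed paths with weights `w i` at the positive levels
  have key : ∀ (f : (V → Fin 2) → ℝ) (w : Fin k → (V → Fin 2) → ℝ),
      (diagonal f * (List.ofFn fun i => (∑ e, B e) * diagonal (w i)).prod).trace =
        ∑ e : Fin k → E, ∑ τ : Orbits (next e) → Fin 2, f (fun x => τ (Quotient.mk _ (x, 0))) *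
          ∏ i, w i (fun x => τ (Quotient.mk _ (x, i.succ))) := by
    intro f w
    simp only [Finset.sum_mul]
    rw [prod_ofFn_sum, Finset.mul_sum, Matrix.trace_sum]
    refine Finset.sum_congr rfl fun e _ => ?_
    rw [trace_diagonal_mul_prod, ← sum_invariant_colorings (next e) fun σ =>
      f (fun x => σ (x, 0)) * ∏ i : Fin k, w i (fun x => σ (x, i.succ))]
    let φ : (V × Fin (k + 1) → Fin 2) ≃ (Fin (k + 1) → V → Fin 2) :=
      (Equiv.curry V (Fin (k + 1)) (Fin 2)).trans (Equiv.piComm fun _ _ => Fin 2)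
    refine (Equiv.sum_comp φ _).symm.trans (Finset.sum_congr rfl fun σ _ => ?_)
    have h := hB e (φ σ)
    simp only [mul_diagonal, Finset.prod_mul_distrib]
    rw [← ite_zero_mul, h]
    change f (fun x => σ (x, 0)) * ((if ∀ s, σ (next e s) = σ s then 1 else 0) *
      ∏ i, w i (fun x => σ (x, i.succ))) = _
    split_ifs <;> simp
  induction j using Fin.cases with
  | zero =>
    have h1 := key (fun s => f s * g s) (fun _ _ => 1)
    simp only [diagonal_one, mul_one, List.ofFn_const, List.prod_replicate,
      Finset.prod_const_one] at h1
    rw [← h1, ← diagonal_mul_diagonal, Fin.val_zero, pow_zero, one_mul, Nat.sub_zero,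
      mul_assoc]
  | succ j =>
    have h1 := key f (fun i s => if i = j then g s else 1)
    have h2 : ∀ i, diagonal (fun s => if i = j then g s else 1) =
        if i = j then diagonal g else (1 : Matrix (V → Fin 2) (V → Fin 2) ℝ) := by
      intro i
      split_ifs
      · rfl
      · exact diagonal_one
    simp only [h2, prod_ofFn_insert] at h1
    rw [Fin.val_succ, h1]
    refine Finset.sum_congr rfl fun e _ => Finset.sum_congr rfl fun τ _ => ?_
    simp

end TraceTransfer

/-! ### Transfer matrices of cycles and loops -/

section TransferMatrices

variable {V : Type} [Fintype V] [DecidableEq V]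

/-- The operator that exchanges the spins at the endpoints of an edge. -/
def swapMatrix (e : Sym2 V) : Matrix (V → Fin 2) (V → Fin 2) ℝ :=
  Matrix.of fun s s' => if ∀ x, s' (edgeSwap e x) = s x then 1 else 0

/-- The operator whose entry at `s, s'` is `1` if the spins at the two endpoints of the edge agree
in `s` and agree in `s'`, and `s = s'` at the other sites, and `0` otherwise. It is twice the
projection to the vector `(|00⟩ + |11⟩) / √2` on the edge. -/
def bridgeMatrix (e : Sym2 V) : Matrix (V → Fin 2) (V → Fin 2) ℝ :=
  Matrix.of fun s s' => if ∀ x, (edgeSwap e x = x → s x = s' x) ∧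
    (edgeSwap e x ≠ x → s (edgeSwap e x) = s x ∧ s' (edgeSwap e x) = s' x) then 1 else 0

theorem cycle_path_weight (G : SimpleGraph V) {k : ℕ} (e : Fin k → G.edgeSet)
    (p : Fin (k + 1) → V → Fin 2) :
    (if p 0 = p (Fin.last k) then
      ∏ i, swapMatrix (e i : Sym2 V) (p i.castSucc) (p i.succ) else 0) =
      if ∀ s, p (cycleNext G e s).2 (cycleNext G e s).1 = p s.2 s.1 then 1 else 0 := by
  simp only [swapMatrix, Matrix.of_apply, Finset.prod_boole, ← ite_and]
  congr 1
  rw [eq_iff_iff]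
  constructor
  · rintro ⟨h0, h⟩ ⟨x, j⟩
    induction j using Fin.lastCases with
    | last => simp [cycleNext, h0]
    | cast i => simpa [cycleNext] using h i (Finset.mem_univ i) x
  · intro h
    refine ⟨funext fun x => ?_, fun i _ x => ?_⟩
    · simpa [cycleNext] using h (x, Fin.last k)
    · simpa [cycleNext] using h (x, i.castSucc)

theorem loop_path_weight (G : SimpleGraph V) (c : G.Coloring Bool) {k : ℕ} (e : Fin k → G.edgeSet)
    (p : Fin (k + 1) → V → Fin 2) :
    (if p 0 = p (Fin.last k) then
      ∏ i, bridgeMatrix (e i : Sym2 V) (p i.castSucc) (p i.succ) else 0) =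
      if ∀ s, p (loopNext G c e s).2 (loopNext G c e s).1 = p s.2 s.1 then 1 else 0 := by
  simp only [bridgeMatrix, Matrix.of_apply, Finset.prod_boole, ← ite_and]
  congr 1
  rw [eq_iff_iff]
  have hnext : ∀ s, loopNext G c e s = loopStep c e s := fun _ => rfl
  constructor
  · rintro ⟨h0, h⟩ ⟨x, j⟩
    rw [hnext]
    cases hx : c x with
    | true =>
      induction j using Fin.lastCases with
      | last => simp [loopStep, hx, h0]
      | cast i =>
        have hi := h i (Finset.mem_univ i) x
        by_cases hs : edgeSwap (e i : Sym2 V) x = x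
        · simp [loopStep, hx, hs, hi.1 hs]
        · simp [loopStep, hx, hs, (hi.2 hs).1]
    | false =>
      induction j using Fin.cases with
      | zero => simp [loopStep, hx, h0]
      | succ i =>
        have hi := h i (Finset.mem_univ i) x
        by_cases hs : edgeSwap (e i : Sym2 V) x = x
        · simp [loopStep, hx, hs, hi.1 hs]
        · simp [loopStep, hx, hs, (hi.2 hs).2]
  · intro h
    simp only [hnext] at h
    refine ⟨funext fun x => ?_, fun i _ x => ⟨fun hs => ?_, fun hs => ?_⟩⟩
    · cases hx : c x with
      | true => simpa [loopStep, hx] using h (x, Fin.last k)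
      | false => simpa [loopStep, hx, eq_comm] using h (x, 0)
    · cases hx : c x with
      | true => simpa [loopStep, hx, hs, eq_comm] using h (x, i.castSucc)
      | false => simpa [loopStep, hx, hs] using h (x, i.succ)
    · -- one endpoint carries the agreement below the bridge, the other one above it
      have hy := edgeSwap_color G c (e i) x hs
      have hs' : ¬ x = edgeSwap (e i : Sym2 V) x := fun h2 => hs h2.symm
      cases hx : c x with
      | true =>
        refine ⟨by simpa [loopStep, hx, hs] using h (x, i.castSucc), ?_⟩
        simpa [loopStep, hx, hy, hs', edgeSwap_edgeSwap, eq_comm] using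
          h (edgeSwap (e i : Sym2 V) x, i.succ)
      | false =>
        refine ⟨?_, by simpa [loopStep, hx, hs] using h (x, i.succ)⟩
        simpa [loopStep, hx, hy, hs', edgeSwap_edgeSwap, eq_comm] using
          h (edgeSwap (e i : Sym2 V) x, i.castSucc)

end TransferMatrices

/-! ### Lengths of orbits and sums over their colourings -/

section Levels

open Classical

variable {V : Type} [Fintype V] {k : ℕ}

/-- The number of sites `x` such that the segment `(x, j)` belongs to the orbit `γ`. -/
noncomputable def levelCount (f : Equiv.Perm (V × Fin (k + 1))) (j : Fin (k + 1)) (γ : Orbits f) : ℕ :=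
  (Finset.univ.filter fun x : V => (Quotient.mk _ (x, j) : Orbits f) = γ).card

theorem orbitLength_eq_sum (β : ℝ) (f : Equiv.Perm (V × Fin (k + 1))) (t : Fin k → ℝ)
    (γ : Orbits f) : orbitLength β f t γ = ∑ j, levelCount f j γ * segLength β t j := by
  rw [orbitLength, Fintype.sum_prod_type, Finset.sum_comm]
  refine Finset.sum_congr rfl fun j _ => ?_
  simp only [← Finset.sum_filter, Finset.sum_const, nsmul_eq_mul, levelCount]

theorem levelCount_le (f : Equiv.Perm (V × Fin (k + 1))) (j : Fin (k + 1)) (γ : Orbits f) :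
    levelCount f j γ ≤ Fintype.card V :=
  Finset.card_le_univ _

/-- Summing over sites amounts to summing over orbits with the multiplicities `levelCount`. -/
theorem sum_site_eq_sum_orbit (f : Equiv.Perm (V × Fin (k + 1))) (j : Fin (k + 1))
    (F : Orbits f → ℝ) :
    ∑ x : V, F (Quotient.mk _ (x, j)) = ∑ γ : Orbits f, levelCount f j γ * F γ := by
  rw [← Finset.sum_fiberwise Finset.univ fun x : V => (Quotient.mk _ (x, j) : Orbits f)]
  refine Finset.sum_congr rfl fun γ _ => ?_
  rw [Finset.sum_congr rfl fun x hx => by rw [(Finset.mem_filter.1 hx).2], Finset.sum_const,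
    nsmul_eq_mul, levelCount]

theorem orbitLength_nonneg {β : ℝ} (hβ : 0 < β) (f : Equiv.Perm (V × Fin (k + 1)))
    {t : Fin k → ℝ} (ht : t ∈ timeSimplex k β) (γ : Orbits f) : 0 ≤ orbitLength β f t γ := by
  rw [orbitLength_eq_sum]
  exact Finset.sum_nonneg fun j _ => mul_nonneg (by positivity) (segLength_nonneg hβ ht j)

theorem orbitLength_le {β : ℝ} (hβ : 0 < β) (f : Equiv.Perm (V × Fin (k + 1)))
    {t : Fin k → ℝ} (ht : t ∈ timeSimplex k β) (γ : Orbits f) :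
    orbitLength β f t γ ≤ β * Fintype.card V := by
  rw [orbitLength_eq_sum]
  calc ∑ j, levelCount f j γ * segLength β t j
      ≤ ∑ j, (Fintype.card V : ℝ) * segLength β t j :=
        Finset.sum_le_sum fun j _ => mul_le_mul_of_nonneg_right
          (by exact_mod_cast levelCount_le f j γ) (segLength_nonneg hβ ht j)
    _ = β * Fintype.card V := by rw [← Finset.mul_sum, sum_segLength, mul_comm]

theorem measurable_orbitLength (β : ℝ) (f : Equiv.Perm (V × Fin (k + 1))) (γ : Orbits f) :
    Measurable fun t : Fin k → ℝ => orbitLength β f t γ := by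
  simp only [orbitLength_eq_sum]
  exact Finset.measurable_sum _ fun j _ => (measurable_segLength β j).const_mul _

/-- Cycles move upwards, so they meet every time level at the same number of sites. -/
theorem levelCount_cycleNext [DecidableEq V] (G : SimpleGraph V) (e : Fin k → G.edgeSet)
    (j : Fin (k + 1)) (γ : Orbits (cycleNext G e)) :
    levelCount (cycleNext G e) j γ = levelCount (cycleNext G e) 0 γ := by
  induction j using Fin.induction with
  | zero => rfl
  | succ i ih =>
    rw [← ih, levelCount, levelCount]
    symm
    refine Finset.card_equiv (edgeSwap (e i : Sym2 V)) fun x => ?_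
    have h : (Quotient.mk _ (edgeSwap (e i : Sym2 V) x, i.succ) : Orbits (cycleNext G e)) =
        Quotient.mk _ (x, i.castSucc) := by
      rw [← orbit_mk_apply _ (x, i.castSucc)]
      simp [cycleNext]
    simp only [Finset.mem_filter, Finset.mem_univ, true_and]
    rw [h]

theorem orbitLength_cycleNext [DecidableEq V] (G : SimpleGraph V) (e : Fin k → G.edgeSet) (β : ℝ)
    (t : Fin k → ℝ) (γ : Orbits (cycleNext G e)) :
    orbitLength β (cycleNext G e) t γ = β * levelCount (cycleNext G e) 0 γ := by
  simp only [orbitLength_eq_sum, levelCount_cycleNext]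
  rw [← Finset.mul_sum, sum_segLength, mul_comm]

/-- The value of `S^{(3)}` at a spin. -/
noncomputable def spinVal (a : Fin 2) : ℝ := if a = 0 then 1 / 2 else -1 / 2

/-- The magnetization of a spin configuration. -/
noncomputable def totalSpin (s : V → Fin 2) : ℝ := ∑ x, spinVal (s x)

theorem totalSpin_orbit_coloring (f : Equiv.Perm (V × Fin (k + 1))) (j : Fin (k + 1))
    (τ : Orbits f → Fin 2) : totalSpin (fun x => τ (Quotient.mk _ (x, j))) =
      ∑ γ, levelCount f j γ * spinVal (τ γ) :=
  sum_site_eq_sum_orbit f j fun γ => spinVal (τ γ)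

theorem sum_prod_coloring {ι : Type*} [Fintype ι] [DecidableEq ι] (w : ι → Fin 2 → ℝ) :
    ∑ τ : ι → Fin 2, ∏ i, w i (τ i) = ∏ i, ∑ a, w i a := by
  rw [Finset.prod_univ_sum, Fintype.piFinset_univ]

theorem sum_spinVal_mul_spinVal {ι : Type*} [Fintype ι] [DecidableEq ι] (γ γ' : ι) :
    ∑ τ : ι → Fin 2, spinVal (τ γ) * spinVal (τ γ') =
      if γ = γ' then 2 ^ Fintype.card ι * (1 / 4) else 0 := by
  have h := sum_prod_coloring fun i a =>
    (if i = γ then spinVal a else 1) * if i = γ' then spinVal a else 1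
  simp only [Finset.prod_mul_distrib, Finset.prod_ite_eq', Finset.mem_univ, if_true] at h
  rw [h]
  split_ifs with hγ
  · subst hγ
    rw [← Finset.mul_prod_erase Finset.univ _ (Finset.mem_univ γ),
      Finset.prod_congr rfl (g := fun _ => (2 : ℝ)) fun i hi => by simp [Finset.ne_of_mem_erase hi]]
    have : 0 < Fintype.card ι := Fintype.card_pos_iff.2 ⟨γ⟩
    obtain ⟨n, hn⟩ := Nat.exists_eq_succ_of_ne_zero this.ne'
    simp [Finset.card_erase_of_mem, hn, spinVal, pow_succ]
    ring
  · refine Finset.prod_eq_zero (Finset.mem_univ γ) ?_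
    simp [hγ, spinVal]
    norm_num

/-- Independent uniform colours of the orbits: only pairs of sites on the same orbit contribute
to the second moment of the magnetization. -/
theorem sum_totalSpin_mul_totalSpin (f : Equiv.Perm (V × Fin (k + 1))) (i j : Fin (k + 1)) :
    ∑ τ : Orbits f → Fin 2, totalSpin (fun x => τ (Quotient.mk _ (x, i))) *
      totalSpin (fun x => τ (Quotient.mk _ (x, j))) =
      2 ^ Fintype.card (Orbits f) * (1 / 4) *
        ∑ x, (levelCount f j (Quotient.mk _ (x, i)) : ℝ) := by
  simp only [totalSpin_orbit_coloring, Finset.sum_mul_sum]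
  rw [Finset.sum_comm]
  rw [sum_site_eq_sum_orbit f i fun γ => (levelCount f j γ : ℝ), Finset.mul_sum]
  refine Finset.sum_congr rfl fun γ _ => ?_
  rw [Finset.sum_comm]
  have h : ∀ (γ' : Orbits f) (τ : Orbits f → Fin 2),
      (levelCount f i γ : ℝ) * spinVal (τ γ) * (levelCount f j γ' * spinVal (τ γ')) =
        levelCount f i γ * levelCount f j γ' * (spinVal (τ γ) * spinVal (τ γ')) :=
    fun γ' τ => by ring
  simp only [h, ← Finset.mul_sum, sum_spinVal_mul_spinVal]
  simp
  ring

theorem sum_levelCount (f : Equiv.Perm (V × Fin (k + 1))) (j : Fin (k + 1)) :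
    ∑ γ : Orbits f, (levelCount f j γ : ℝ) = Fintype.card V := by
  have := sum_site_eq_sum_orbit f j fun _ => (1 : ℝ)
  simpa using this.symm

theorem exp_totalSpin_orbit (f : Equiv.Perm (V × Fin (k + 1))) (b : ℝ) (τ : Orbits f → Fin 2) :
    Real.exp (2 * b * totalSpin (fun x => τ (Quotient.mk _ (x, 0)))) =
      ∏ γ, Real.exp (2 * b * levelCount f 0 γ * spinVal (τ γ)) := by
  rw [totalSpin_orbit_coloring, ← Real.exp_sum, Finset.mul_sum]
  simp only [mul_assoc]

theorem prod_one_add_exp (f : Equiv.Perm (V × Fin (k + 1))) (b : ℝ) :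
    ∏ γ : Orbits f, ∑ a, Real.exp (2 * b * levelCount f 0 γ * spinVal a) =
      Real.exp (b * Fintype.card V) *
        ∏ γ : Orbits f, (1 + Real.exp (-2 * b * levelCount f 0 γ)) := by
  rw [← sum_levelCount f 0, Finset.mul_sum, Real.exp_sum, ← Finset.prod_mul_distrib]
  refine Finset.prod_congr rfl fun γ _ => ?_
  rw [mul_add, ← Real.exp_add, Fin.sum_univ_two, mul_one]
  simp only [spinVal]
  congr 2 <;> norm_num <;> ring

theorem sum_exp_totalSpin (f : Equiv.Perm (V × Fin (k + 1))) (b : ℝ) :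
    ∑ τ : Orbits f → Fin 2, Real.exp (2 * b * totalSpin (fun x => τ (Quotient.mk _ (x, 0)))) =
      Real.exp (b * Fintype.card V) *
        ∏ γ : Orbits f, (1 + Real.exp (-2 * b * levelCount f 0 γ)) := by
  rw [← prod_one_add_exp, ← sum_prod_coloring]
  exact Finset.sum_congr rfl fun τ _ => exp_totalSpin_orbit f b τ

theorem sum_spinVal_mul_exp (x : ℝ) : ∑ a, spinVal a * Real.exp (2 * x * spinVal a) =
    1 / 2 * Real.tanh x * ∑ a, Real.exp (2 * x * spinVal a) := by
  have h := Real.tanh_eq_sinh_div_cosh x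
  have hc := (Real.cosh_pos x).ne'
  have h1 : Real.exp x = Real.cosh x + Real.sinh x := (Real.cosh_add_sinh x).symm
  have h2 : Real.exp (-x) = Real.cosh x - Real.sinh x := (Real.cosh_sub_sinh x).symm
  simp only [Fin.sum_univ_two, spinVal]
  norm_num
  rw [show 2 * x * (1 / 2) = x by ring, h, h1, h2]
  field_simp
  ring

/-- In the field `h` (here `b = βh`), an orbit that meets the time `0` at `m` sites has mean spin
`½ tanh (b m)`. -/
theorem sum_totalSpin_mul_exp (f : Equiv.Perm (V × Fin (k + 1))) (b : ℝ) :
    ∑ τ : Orbits f → Fin 2, totalSpin (fun x => τ (Quotient.mk _ (x, 0))) *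
        Real.exp (2 * b * totalSpin (fun x => τ (Quotient.mk _ (x, 0)))) =
      Real.exp (b * Fintype.card V) *
        (∏ γ : Orbits f, (1 + Real.exp (-2 * b * levelCount f 0 γ))) *
        ∑ x : V, 1 / 2 * Real.tanh (b * levelCount f 0 (Quotient.mk _ (x, 0))) := by
  rw [← prod_one_add_exp, sum_site_eq_sum_orbit f 0 fun γ =>
    1 / 2 * Real.tanh (b * levelCount f 0 γ), Finset.mul_sum]
  have h1 : ∀ γ : Orbits f, ∑ τ : Orbits f → Fin 2, spinVal (τ γ) *
      Real.exp (2 * b * totalSpin (fun x => τ (Quotient.mk _ (x, 0)))) =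
      (1 / 2 * Real.tanh (b * levelCount f 0 γ)) *
        ∏ γ : Orbits f, ∑ a, Real.exp (2 * b * levelCount f 0 γ * spinVal a) := by
    intro γ
    have h := sum_prod_coloring fun (i : Orbits f) a =>
      (if i = γ then spinVal a else 1) * Real.exp (2 * b * levelCount f 0 i * spinVal a)
    simp only [Finset.prod_mul_distrib, Finset.prod_ite_eq', Finset.mem_univ, if_true] at h
    simp only [exp_totalSpin_orbit, h]
    have h2 : ∀ i : Orbits f, ∑ a, (if i = γ then spinVal a else 1) *
        Real.exp (2 * b * levelCount f 0 i * spinVal a) =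
        (if i = γ then 1 / 2 * Real.tanh (b * levelCount f 0 γ) else 1) *
          ∑ a, Real.exp (2 * b * levelCount f 0 i * spinVal a) := by
      intro i
      split_ifs with hi
      · subst hi
        simpa only [mul_assoc] using sum_spinVal_mul_exp (b * levelCount f 0 i)
      · simp
    simp only [h2, Finset.prod_mul_distrib, Finset.prod_ite_eq', Finset.mem_univ, if_true]
  conv_lhs =>
    enter [2, τ]
    rw [totalSpin_orbit_coloring f 0 τ, Finset.sum_mul]
  rw [Finset.sum_comm]
  refine Finset.sum_congr rfl fun γ _ => ?_
  simp only [mul_assoc, ← Finset.mul_sum]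
  have := h1 γ
  simp only [totalSpin_orbit_coloring, mul_assoc] at this
  rw [this]
  ring

end Levels

/-! ### The Heisenberg Hamiltonians in the basis of spin configurations -/

section Quantum

theorem hasSum_exp_apply {S : Type} [Fintype S] [DecidableEq S] (A : Matrix S S ℝ) (b : ℝ)
    (s s' : S) :
    HasSum (fun k : ℕ => b ^ k / k.factorial * (A ^ k) s s') (NormedSpace.exp (b • A) s s') := by
  have h : HasSum (fun k : ℕ => (k.factorial : ℝ)⁻¹ • (b • A) ^ k) (NormedSpace.exp (b • A)) := by
    open scoped Matrix.Norms.Operator in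
    exact NormedSpace.exp_series_hasSum_exp' (𝕂 := ℝ) (b • A)
  have h2 := h.map (Matrix.entryAddMonoidHom ℝ s s') (continuous_id.matrix_elem s s')
  convert h2 using 1
  · funext k
    simp [smul_pow]
    ring
  · rfl

/-- The embedding of real into complex matrices. -/
noncomputable def toComplex {S : Type} [Fintype S] [DecidableEq S] :
    Matrix S S ℝ →+* Matrix S S ℂ :=
  (algebraMap ℝ ℂ).mapMatrix

theorem exp_toComplex {S : Type} [Fintype S] [DecidableEq S] (A : Matrix S S ℝ) :
    NormedSpace.exp (toComplex A) = toComplex (NormedSpace.exp A) := by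
  symm
  open scoped Matrix.Norms.Operator in
  exact NormedSpace.map_exp toComplex
    (continuous_id.matrix_map Complex.continuous_ofReal) A

variable {V : Type} [Fintype V] [DecidableEq V]

theorem onSite_mul_onSite_apply {x y : V} (hxy : x ≠ y) (A B : Matrix (Fin 2) (Fin 2) ℂ)
    (s s' : V → Fin 2) : (onSite x A * onSite y B) s s' =
      if ∀ z, z ≠ x → z ≠ y → s z = s' z then A (s x) (s' x) * B (s y) (s' y) else 0 := by
  rw [Matrix.mul_apply, Finset.sum_eq_single (Function.update s x (s' x))]
  · have h1 : ∀ z, z ≠ x → s z = Function.update s x (s' x) z := fun z hz => by simp [hz]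
    have h2 : (∀ z, z ≠ y → Function.update s x (s' x) z = s' z) ↔
        ∀ z, z ≠ x → z ≠ y → s z = s' z := by
      constructor
      · intro h z hx hy
        simpa [hx] using h z hy
      · intro h z hy
        by_cases hx : z = x
        · subst hx; simp
        · simpa [hx] using h z hx hy
    simp only [onSite, Matrix.of_apply, if_pos h1, h2, Function.update_self,
      Function.update_of_ne hxy.symm, mul_ite, mul_zero]
  · intro u _ hu
    simp only [onSite, Matrix.of_apply]
    by_cases h1 : ∀ z, z ≠ x → s z = u z
    · by_cases h2 : ∀ z, z ≠ y → u z = s' z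
      · refine absurd (funext fun z => ?_) hu
        by_cases hz : z = x
        · subst hz; simpa using h2 z hxy
        · simpa [hz] using (h1 z hz).symm
      · simp [h2]
    · simp [h1]
  · simp

omit [Fintype V] in
theorem edgeSwap_mk_self_iff {x y : V} (hxy : x ≠ y) (z : V) :
    edgeSwap s(x, y) z = z ↔ z ≠ x ∧ z ≠ y := by
  simp only [edgeSwap, Sym2.lift_mk]
  constructor
  · intro h
    refine ⟨?_, ?_⟩
    · rintro rfl; rw [Equiv.swap_apply_left] at h; exact hxy h.symm
    · rintro rfl; rw [Equiv.swap_apply_right] at h; exact hxy h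
  · rintro ⟨h1, h2⟩
    exact Equiv.swap_apply_of_ne_of_ne h1 h2

theorem swapMatrix_mk_apply {x y : V} (hxy : x ≠ y) (s s' : V → Fin 2) :
    swapMatrix s(x, y) s s' = if ∀ z, z ≠ x → z ≠ y → s z = s' z then
      (if s x = s' y ∧ s y = s' x then 1 else 0) else 0 := by
  rw [swapMatrix, Matrix.of_apply, ← ite_and]
  refine if_congr ⟨fun h => ⟨fun z hx hy => ?_, ?_, ?_⟩, fun h z => ?_⟩ rfl rfl
  · rw [← h z, (edgeSwap_mk_self_iff hxy z).2 ⟨hx, hy⟩]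
  · rw [← h x]; simp [edgeSwap]
  · rw [← h y]; simp [edgeSwap]
  · by_cases hx : z = x
    · subst hx; simpa [edgeSwap] using h.2.1.symm
    · by_cases hy : z = y
      · subst hy; simpa [edgeSwap] using h.2.2.symm
      · rw [(edgeSwap_mk_self_iff hxy z).2 ⟨hx, hy⟩, h.1 z hx hy]

theorem bridgeMatrix_mk_apply {x y : V} (hxy : x ≠ y) (s s' : V → Fin 2) :
    bridgeMatrix s(x, y) s s' = if ∀ z, z ≠ x → z ≠ y → s z = s' z then
      (if s x = s y ∧ s' x = s' y then 1 else 0) else 0 := by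
  rw [bridgeMatrix, Matrix.of_apply, ← ite_and]
  refine if_congr ⟨fun h => ⟨fun z hx hy => ?_, ?_⟩, fun h z => ⟨fun hz => ?_, fun hz => ?_⟩⟩ rfl rfl
  · exact (h z).1 ((edgeSwap_mk_self_iff hxy z).2 ⟨hx, hy⟩)
  · have := (h y).2 (by simp [edgeSwap_mk_self_iff hxy])
    simpa [edgeSwap] using this
  · rw [edgeSwap_mk_self_iff hxy] at hz
    exact h.1 z hz.1 hz.2
  · rw [ne_eq, edgeSwap_mk_self_iff hxy, not_and_or, not_ne_iff, not_ne_iff] at hz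
    rcases hz with rfl | rfl
    · simpa [edgeSwap] using ⟨h.2.1.symm, h.2.2.symm⟩
    · simpa [edgeSwap] using h.2

theorem one_apply_of_pair (x y : V) (s s' : V → Fin 2) :
    (1 : Matrix (V → Fin 2) (V → Fin 2) ℝ) s s' = if ∀ z, z ≠ x → z ≠ y → s z = s' z then
      (if s x = s' x ∧ s y = s' y then 1 else 0) else 0 := by
  rw [Matrix.one_apply, ← ite_and]
  refine if_congr ⟨fun h => by simp [h], fun h => funext fun z => ?_⟩ rfl rfl
  by_cases hx : z = x
  · rw [hx]; exact h.2.1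
  · by_cases hy : z = y
    · rw [hy]; exact h.2.2
    · exact h.1 z hx hy

theorem spin_dot_entries (a a' b b' : Fin 2) :
    spin1 a a' * spin1 b b' + spin2 a a' * spin2 b b' + spin3 a a' * spin3 b b' =
      ((1 / 2 * (if a = b' ∧ b = a' then 1 else 0) -
        1 / 4 * (if a = a' ∧ b = b' then 1 else 0) : ℝ) : ℂ) := by
  have hI : Complex.I / 2 * (Complex.I / 2) = -1 / 4 := by
    rw [div_mul_div_comm, Complex.I_mul_I]; norm_num
  fin_cases a <;> fin_cases a' <;> fin_cases b <;> fin_cases b' <;>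
    simp [spin1, spin2, spin3, neg_div, hI] <;> norm_num

theorem spinDot_eq_swapMatrix {e : Sym2 V} (he : ¬ e.IsDiag) :
    spinDot e = toComplex ((1 / 2 : ℝ) • swapMatrix e - (1 / 4 : ℝ) • 1) := by
  induction e with
  | _ x y =>
  have hxy : x ≠ y := by simpa using he
  ext s s'
  have h : toComplex ((1 / 2 : ℝ) • swapMatrix s(x, y) - (1 / 4 : ℝ) • 1) s s' =
      ((1 / 2 * swapMatrix s(x, y) s s' -
        1 / 4 * (1 : Matrix (V → Fin 2) (V → Fin 2) ℝ) s s' : ℝ) : ℂ) := by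
    simp [toComplex]
  rw [h, swapMatrix_mk_apply hxy, one_apply_of_pair x y]
  simp only [spinDot, Sym2.lift_mk, Matrix.add_apply, onSite_mul_onSite_apply hxy]
  by_cases hoff : ∀ z, z ≠ x → z ≠ y → s z = s' z
  · simp only [if_pos hoff]
    exact spin_dot_entries _ _ _ _
  · simp [if_neg hoff]

theorem onSite_spin3 (x : V) :
    onSite x spin3 = toComplex (diagonal fun s : V → Fin 2 => spinVal (s x)) := by
  ext s s'
  simp only [onSite, Matrix.of_apply, toComplex, RingHom.mapMatrix_apply, Matrix.map_apply]
  by_cases h : s = s'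
  · subst h
    simp only [diagonal_apply_eq, implies_true, if_true]
    generalize s x = a
    fin_cases a <;> simp [spin3, spinVal]
  · rw [diagonal_apply_ne _ h]
    split_ifs with h1
    · have : s x ≠ s' x := fun h2 => h (funext fun z => by
        by_cases hz : z = x
        · rw [hz, h2]
        · exact h1 z hz)
      generalize s x = a at *
      generalize s' x = a' at *
      fin_cases a <;> fin_cases a' <;> simp_all [spin3]
    · simp

theorem magnetization_eq : magnetization V = toComplex (diagonal (totalSpin (V := V))) := by
  rw [magnetization]
  simp only [onSite_spin3, ← map_sum]
  congr 1
  ext s s'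
  rw [Matrix.sum_apply]
  by_cases h : s = s'
  · subst h; simp [totalSpin]
  · simp [h]

theorem onSite_mul_onSite_spin3 (x y : V) : onSite x spin3 * onSite y spin3 =
    toComplex (diagonal fun s : V → Fin 2 => spinVal (s x) * spinVal (s y)) := by
  rw [onSite_spin3, onSite_spin3, ← map_mul, diagonal_mul_diagonal]

open scoped ComplexOrder in
theorem abs_magnetization :
    CFC.abs (magnetization V) = toComplex (diagonal fun s : V → Fin 2 => |totalSpin s|) := by
  rw [CFC.abs, magnetization_eq]
  refine CFC.sqrt_unique ?_ ?_
  · rw [← map_mul, diagonal_mul_diagonal]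
    simp only [abs_mul_abs_self, ← diagonal_mul_diagonal, map_mul]
    congr 1
    rw [star_eq_conjTranspose]
    simp [toComplex, diagonal_map, diagonal_conjTranspose]
  · rw [Matrix.nonneg_iff_posSemidef]
    have : toComplex (diagonal fun s : V → Fin 2 => |totalSpin s|) =
        diagonal fun s : V → Fin 2 => ((|totalSpin s| : ℝ) : ℂ) := by
      simp [toComplex, diagonal_map]
    rw [this]
    exact Matrix.PosSemidef.diagonal fun s => by
      simp

theorem trace_toComplex {S : Type} [Fintype S] [DecidableEq S] (M : Matrix S S ℝ) :
    (toComplex M).trace = ((M.trace : ℝ) : ℂ) := by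
  simp [toComplex, Matrix.trace]

theorem gibbs_toComplex {H : Matrix (V → Fin 2) (V → Fin 2) ℂ} {b : ℝ}
    {X : Matrix (V → Fin 2) (V → Fin 2) ℝ} (hX : -(b : ℂ) • H = toComplex X)
    (D : (V → Fin 2) → ℝ) : (gibbs H b (toComplex (diagonal D))).re =
      (∑ s, D s * NormedSpace.exp X s s) / ∑ s, NormedSpace.exp X s s := by
  rw [gibbs, hX, exp_toComplex, ← map_mul, trace_toComplex, trace_toComplex, ← Complex.ofReal_div,
    Complex.ofReal_re]
  simp [Matrix.trace]

/-- The sum `∑ₑ Tₑ` of the exchange operators over the edges of the graph. -/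
noncomputable def swapSum (G : SimpleGraph V) [DecidableRel G.Adj] :
    Matrix (V → Fin 2) (V → Fin 2) ℝ :=
  ∑ e : G.edgeSet, swapMatrix (e : Sym2 V)

/-- The sum `∑ₑ Uₑ` of the bridge matrices over the edges of the graph. -/
noncomputable def bridgeSum (G : SimpleGraph V) [DecidableRel G.Adj] :
    Matrix (V → Fin 2) (V → Fin 2) ℝ :=
  ∑ e : G.edgeSet, bridgeMatrix (e : Sym2 V)

theorem sum_spinDot (G : SimpleGraph V) [DecidableRel G.Adj] :
    ∑ e ∈ G.edgeFinset, spinDot e =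
      toComplex ((1 / 2 : ℝ) • swapSum G - (G.edgeFinset.card / 4 : ℝ) • 1) := by
  rw [Finset.sum_subtype G.edgeFinset (p := fun e => e ∈ G.edgeSet)
    (fun e => SimpleGraph.mem_edgeFinset)]
  rw [Finset.sum_congr rfl fun e _ => spinDot_eq_swapMatrix (G.not_isDiag_of_mem_edgeSet e.2),
    ← map_sum, Finset.sum_sub_distrib, ← Finset.smul_sum, Finset.sum_const, Finset.card_univ,
    swapSum, ← SimpleGraph.edgeFinset_card]
  congr 2
  rw [← Nat.cast_smul_eq_nsmul ℝ, smul_smul]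
  congr 1
  ring

theorem toComplex_smul {S : Type} [Fintype S] [DecidableEq S] (r : ℝ) (M : Matrix S S ℝ) :
    toComplex (r • M) = (r : ℂ) • toComplex M := by
  ext; simp [toComplex]

omit [DecidableEq V] in
theorem totalSpin_comp_perm (s : V → Fin 2) (π : Equiv.Perm V) :
    totalSpin (fun x => s (π x)) = totalSpin s :=
  Equiv.sum_comp π fun x => spinVal (s x)

theorem exp_diagonal_add_smul {S : Type} [Fintype S] [DecidableEq S] (v : S → ℝ) (β : ℝ)
    (A : Matrix S S ℝ) (h : Commute (diagonal v) A) :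
    NormedSpace.exp (diagonal v + β • A) =
      diagonal (fun s => Real.exp (v s)) * NormedSpace.exp (β • A) := by
  rw [Matrix.exp_add_of_commute _ _ (h.smul_right β), Matrix.exp_diagonal]
  congr 2
  funext s
  rw [Pi.coe_exp, Real.exp_eq_exp_ℝ]

theorem commute_diagonal_totalSpin (G : SimpleGraph V) [DecidableRel G.Adj] (F : ℝ → ℝ) :
    Commute (diagonal fun s : V → Fin 2 => F (totalSpin s)) (swapSum G) := by
  refine Commute.sum_right _ _ _ fun e _ => ?_
  ext s s'
  rw [diagonal_mul, mul_diagonal, swapMatrix, Matrix.of_apply]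
  split_ifs with h
  · rw [← totalSpin_comp_perm s' (edgeSwap (e : Sym2 V)), funext h, mul_comm]
  · simp

/-- The ferromagnet at inverse temperature `2β` in terms of the operator `exp (β ∑ₑ Tₑ)`. -/
theorem gibbs_hamFerro (G : SimpleGraph V) [DecidableRel G.Adj] (β h : ℝ) (D : (V → Fin 2) → ℝ) :
    (gibbs (hamFerro G h) (2 * β) (toComplex (diagonal D))).re =
      (∑ s, D s * Real.exp (2 * (β * h) * totalSpin s) * NormedSpace.exp (β • swapSum G) s s) /
        ∑ s, Real.exp (2 * (β * h) * totalSpin s) * NormedSpace.exp (β • swapSum G) s s := by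
  set C : ℝ := β * G.edgeFinset.card / 2 with hC
  have hX : -(((2 * β : ℝ)) : ℂ) • hamFerro G h = toComplex
      (diagonal (fun s => 2 * (β * h) * totalSpin s - C) + β • swapSum G) := by
    rw [hamFerro, sum_spinDot, magnetization_eq, ← toComplex_smul, ← map_neg, ← map_sub,
      ← Complex.ofReal_neg, ← toComplex_smul]
    congr 1
    ext s s'
    by_cases hs : s = s'
    · subst hs
      simp [hC]
      ring
    · simp [hs]
      ring
  rw [gibbs_toComplex hX, exp_diagonal_add_smul _ _ _
    (commute_diagonal_totalSpin G fun m => 2 * (β * h) * m - C)]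
  simp only [diagonal_mul, sub_eq_add_neg, Real.exp_add]
  have hc : Real.exp (-C) ≠ 0 := (Real.exp_pos _).ne'
  refine Eq.trans ?_ (mul_div_mul_left _ _ hc)
  rw [Finset.mul_sum, Finset.mul_sum]
  congr 1 <;> refine Finset.sum_congr rfl fun s _ => by ring

end Quantum

/-! ### Rotation of one sublattice -/

section Rotation

variable {V : Type} [Fintype V] [DecidableEq V]

/-- The spin configuration with the spins of the sublattice `c x = false` reversed. -/
def flipConf (c : V → Bool) (s : V → Fin 2) : V → Fin 2 := fun x => if c x then s x else (s x).rev

/-- The Marshall sign of a spin configuration. -/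
def marshallSign (c : V → Bool) (s : V → Fin 2) : ℝ :=
  ∏ x, if c x then 1 else if s x = 0 then 1 else -1

omit [Fintype V] [DecidableEq V] in
theorem flipConf_flipConf (c : V → Bool) (s : V → Fin 2) : flipConf c (flipConf c s) = s := by
  funext x
  cases h : c x <;> simp [flipConf, h]

/-- `flipConf` as a permutation of the spin configurations. -/
def flipEquiv (c : V → Bool) : Equiv.Perm (V → Fin 2) where
  toFun := flipConf c
  invFun := flipConf c
  left_inv := flipConf_flipConf c
  right_inv := flipConf_flipConf c

omit [DecidableEq V] in
theorem marshallSign_mul_self (c : V → Bool) (s : V → Fin 2) :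
    marshallSign c s * marshallSign c s = 1 := by
  rw [marshallSign, ← Finset.prod_mul_distrib]
  refine Finset.prod_eq_one fun x _ => ?_
  split_ifs <;> norm_num

/-- Conjugation by the rotation by `π` around the second axis of the spins of the sublattice
`c x = false`, as a ring homomorphism. -/
def sublatticeRotation (c : V → Bool) :
    Matrix (V → Fin 2) (V → Fin 2) ℝ →+* Matrix (V → Fin 2) (V → Fin 2) ℝ where
  toFun M := Matrix.of fun s s' =>
    marshallSign c s * marshallSign c s' * M (flipConf c s) (flipConf c s')
  map_one' := by
    ext s s'
    by_cases h : s = s'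
    · subst h; simp [marshallSign_mul_self]
    · have h2 : flipConf c s ≠ flipConf c s' := fun h3 => h ((flipEquiv c).injective h3)
      simp [h, h2]
  map_mul' M N := by
    ext s s'
    simp only [Matrix.of_apply, Matrix.mul_apply]
    rw [← Equiv.sum_comp (flipEquiv c), Finset.mul_sum]
    refine Finset.sum_congr rfl fun u _ => ?_
    change _ * (M _ (flipConf c u) * N (flipConf c u) _) = _
    linear_combination (-(marshallSign c s * marshallSign c s' * M (flipConf c s) (flipConf c u) *
      N (flipConf c u) (flipConf c s'))) * marshallSign_mul_self c u
  map_zero' := by ext; simp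
  map_add' M N := by ext; simp [mul_add]

theorem marshall_entries (a a' b b' : Fin 2) :
    ((if b = 0 then 1 else -1) * (if b' = 0 then 1 else -1) : ℝ) *
      (if a = b'.rev ∧ b.rev = a' then 1 else 0) =
      (if a = a' ∧ b = b' then 1 else 0) - if a = b ∧ a' = b' then 1 else 0 := by
  fin_cases a <;> fin_cases a' <;> fin_cases b <;> fin_cases b' <;> simp

/-- On a bipartite graph the rotation of one sublattice maps the projection to the singlet,
`(1 - Tₑ) / 2`, to half of the bridge matrix. -/
theorem sublatticeRotation_swapMatrix (G : SimpleGraph V) (c : G.Coloring Bool) {e : Sym2 V}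
    (he : e ∈ G.edgeSet) : sublatticeRotation c (swapMatrix e) = 1 - bridgeMatrix e := by
  induction e with
  | _ x y =>
  -- the endpoint on the rotated sublattice may be taken to be `y`
  wlog hx : c x = true generalizing x y
  · have hc : c x ≠ c y := c.valid he
    have hy : c y = true := by
      cases h1 : c x <;> cases h2 : c y <;> simp_all
    rw [Sym2.eq_swap]
    exact this y x (by rwa [Sym2.eq_swap]) hy
  have hc : c x ≠ c y := c.valid he
  have hy : c y = false := by
    cases h2 : c y <;> simp_all
  have hxy : x ≠ y := fun h => hc (by rw [h])
  ext s s'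
  change marshallSign c s * marshallSign c s' * _ = _
  rw [Matrix.sub_apply, swapMatrix_mk_apply hxy, bridgeMatrix_mk_apply hxy, one_apply_of_pair x y]
  have hoff : (∀ z, z ≠ x → z ≠ y → flipConf c s z = flipConf c s' z) ↔
      ∀ z, z ≠ x → z ≠ y → s z = s' z := by
    refine forall_congr' fun z => imp_congr_right fun _ => imp_congr_right fun _ => ?_
    cases h : c z <;> simp [flipConf, h]
  simp only [hoff]
  by_cases h : ∀ z, z ≠ x → z ≠ y → s z = s' z
  · simp only [if_pos h]
    rw [← marshall_entries]
    have hsign : marshallSign c s * marshallSign c s' =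
        (if s y = 0 then 1 else -1) * (if s' y = 0 then 1 else -1) := by
      rw [marshallSign, marshallSign, ← Finset.prod_mul_distrib,
        Finset.prod_eq_single y _ (by simp)]
      · simp [hy]
      · intro z _ hz
        by_cases hzx : z = x
        · subst hzx; simp [hx]
        · rw [h z hzx hz]
          split_ifs <;> norm_num
    rw [hsign]
    simp [flipConf, hx, hy]
  · simp [if_neg h]

theorem continuous_sublatticeRotation (c : V → Bool) : Continuous (sublatticeRotation c) := by
  refine continuous_matrix fun s s' => ?_
  exact continuous_const.mul (continuous_id.matrix_elem (flipConf c s) (flipConf c s'))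

theorem sublatticeRotation_smul (c : V → Bool) (r : ℝ) (M : Matrix (V → Fin 2) (V → Fin 2) ℝ) :
    sublatticeRotation c (r • M) = r • sublatticeRotation c M := by
  ext s s'
  change marshallSign c s * marshallSign c s' * (r * M (flipConf c s) (flipConf c s')) =
    r * (marshallSign c s * marshallSign c s' * M (flipConf c s) (flipConf c s'))
  ring

theorem exp_sublatticeRotation (c : V → Bool) (M : Matrix (V → Fin 2) (V → Fin 2) ℝ) :
    sublatticeRotation c (NormedSpace.exp M) = NormedSpace.exp (sublatticeRotation c M) := by
  open scoped Matrix.Norms.Operator in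
  exact NormedSpace.map_exp (sublatticeRotation c) (continuous_sublatticeRotation c) M

theorem sublatticeRotation_apply_self (c : V → Bool) (M : Matrix (V → Fin 2) (V → Fin 2) ℝ)
    (s : V → Fin 2) : sublatticeRotation c M s s = M (flipConf c s) (flipConf c s) := by
  change marshallSign c s * marshallSign c s * M (flipConf c s) (flipConf c s) = _
  rw [marshallSign_mul_self, one_mul]

/-- The antiferromagnet at inverse temperature `2β` in terms of the operator `exp (β ∑ₑ Uₑ)` with
the bridge matrices `Uₑ`. -/
theorem gibbs_hamAnti (G : SimpleGraph V) [DecidableRel G.Adj] (c : G.Coloring Bool) (β : ℝ)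
    (D : (V → Fin 2) → ℝ) :
    (gibbs (hamAnti G 0) (2 * β) (toComplex (diagonal D))).re =
      (∑ s, D (flipConf c s) * NormedSpace.exp (β • bridgeSum G) s s) /
        ∑ s, NormedSpace.exp (β • bridgeSum G) s s := by
  set C : ℝ := β * G.edgeFinset.card / 2 with hC
  have hX : -(((2 * β : ℝ)) : ℂ) • hamAnti G 0 = toComplex (C • 1 - β • swapSum G) := by
    rw [hamAnti, sum_spinDot, Complex.ofReal_zero, zero_smul, sub_zero,
      ← Complex.ofReal_neg, ← toComplex_smul]
    congr 1
    ext s s'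
    simp [hC]
    ring
  have hrot : sublatticeRotation c (C • 1 - β • swapSum G) =
      diagonal (fun _ => C - β * G.edgeFinset.card) + β • bridgeSum G := by
    rw [map_sub, sublatticeRotation_smul, sublatticeRotation_smul, map_one, swapSum, map_sum,
      Finset.sum_congr rfl fun (e : G.edgeSet) _ => sublatticeRotation_swapMatrix G c e.2,
      Finset.sum_sub_distrib, Finset.sum_const, Finset.card_univ, ← SimpleGraph.edgeFinset_card,
      ← bridgeSum, nsmul_one, ← Matrix.diagonal_natCast]
    ext s s'
    by_cases hs : s = s'
    · subst hs
      simp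
      ring
    · simp [hs]
  have hdiag : ∀ s, NormedSpace.exp (C • 1 - β • swapSum G) (flipConf c s) (flipConf c s) =
      Real.exp (C - β * G.edgeFinset.card) * NormedSpace.exp (β • bridgeSum G) s s := by
    intro s
    rw [← sublatticeRotation_apply_self c (NormedSpace.exp (C • 1 - β • swapSum G)), exp_sublatticeRotation, hrot,
      exp_diagonal_add_smul _ _ _ ?_, diagonal_mul]
    rw [← smul_one_eq_diagonal]
    exact (Commute.one_left _).smul_left _
  rw [gibbs_toComplex hX, ← Equiv.sum_comp (flipEquiv c), ← Equiv.sum_comp (flipEquiv c) fun s =>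
    NormedSpace.exp (C • 1 - β • swapSum G) s s]
  change (∑ s, D (flipConf c s) *
    NormedSpace.exp (C • 1 - β • swapSum G) (flipConf c s) (flipConf c s)) / _ = _
  refine Eq.trans ?_ (mul_div_mul_left _ _ (Real.exp_pos (C - β * G.edgeFinset.card)).ne')
  rw [Finset.mul_sum, Finset.mul_sum]
  congr 1
  · refine Finset.sum_congr rfl fun s _ => ?_
    rw [hdiag]; ring
  · exact Finset.sum_congr rfl fun s _ => hdiag s

omit [DecidableEq V] [Fintype V] in
theorem spinVal_flipConf (c : V → Bool) (s : V → Fin 2) (x : V) :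
    spinVal (flipConf c s x) = sublatticeSign c x * spinVal (s x) := by
  rw [flipConf, sublatticeSign]
  generalize s x = a
  cases c x <;> fin_cases a <;> simp [spinVal] <;> norm_num

/-- The staggered correlations of the antiferromagnet add up to the second moment of the
magnetization in the rotated frame. -/
theorem sum_staggeredCorr (G : SimpleGraph V) [DecidableRel G.Adj] (c : G.Coloring Bool) (β : ℝ) :
    ∑ x, ∑ y, staggeredCorr G c (2 * β) x y =
      (∑ s, totalSpin s ^ 2 * NormedSpace.exp (β • bridgeSum G) s s) /
        ∑ s, NormedSpace.exp (β • bridgeSum G) s s := by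
  have hsq : ∀ x, sublatticeSign c x * sublatticeSign c x = 1 := by
    intro x
    rw [sublatticeSign]
    split_ifs <;> norm_num
  have h : ∀ x y, staggeredCorr G c (2 * β) x y =
      (∑ s, spinVal (s x) * spinVal (s y) * NormedSpace.exp (β • bridgeSum G) s s) /
        ∑ s, NormedSpace.exp (β • bridgeSum G) s s := by
    intro x y
    rw [staggeredCorr, onSite_mul_onSite_spin3, gibbs_hamAnti G c, ← mul_div_assoc, Finset.mul_sum]
    congr 1
    refine Finset.sum_congr rfl fun s _ => ?_
    rw [spinVal_flipConf, spinVal_flipConf]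
    linear_combination (spinVal (s x) * spinVal (s y) * NormedSpace.exp (β • bridgeSum G) s s) *
      (sublatticeSign c y * sublatticeSign c y * hsq x + hsq y)
  simp only [h, ← Finset.sum_div]
  congr 1
  rw [Finset.sum_congr rfl fun x _ => Finset.sum_comm, Finset.sum_comm]
  refine Finset.sum_congr rfl fun s _ => ?_
  rw [sq, totalSpin, Finset.sum_mul_sum, Finset.sum_mul]
  simp only [Finset.sum_mul]

end Rotation

/-! ### Convexity of imaginary-time correlations -/

section Spectral

variable {S : Type} [Fintype S] [DecidableEq S]

omit [DecidableEq S] in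
theorem sum_sum_symm {w : S → S → ℝ} (hsymm : ∀ a b, w a b = w b a) (F : S → S → ℝ) :
    ∑ a, ∑ b, w a b * F a b = 1 / 2 * ∑ a, ∑ b, w a b * (F a b + F b a) := by
  have h : ∑ a, ∑ b, w a b * F b a = ∑ a, ∑ b, w a b * F a b := by
    rw [Finset.sum_comm]
    exact Finset.sum_congr rfl fun a _ => Finset.sum_congr rfl fun b _ => by rw [hsymm]
  simp only [mul_add, Finset.sum_add_distrib, h]
  ring

/-- The imaginary-time correlations of a symmetric matrix `D` are nonnegative combinations of
products of powers of the eigenvalues. -/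
theorem exists_spectral_weights {A D : Matrix S S ℝ} (hA : A.PosSemidef) (hD : D.IsHermitian) :
    ∃ (l : S → ℝ) (w : S → S → ℝ), (∀ a, 0 ≤ l a) ∧ (∀ a b, 0 ≤ w a b) ∧
      ∀ i j : ℕ, (D * (A ^ i * D * A ^ j)).trace =
        ∑ a, ∑ b, w a b * (l a ^ i * l b ^ j + l b ^ i * l a ^ j) := by
  let U : Matrix S S ℝ := (hA.1.eigenvectorUnitary : Matrix S S ℝ)
  have hU : star U * U = 1 := Unitary.coe_star_mul_self hA.1.eigenvectorUnitary
  have hspec : A = U * diagonal hA.1.eigenvalues * star U := by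
    have := hA.1.spectral_theorem
    rw [Unitary.conjStarAlgAut_apply] at this
    exact this
  have hpow : ∀ i, A ^ i = U * diagonal (fun a => hA.1.eigenvalues a ^ i) * star U := by
    intro i
    induction i with
    | zero =>
      have : U * star U = 1 := Unitary.coe_mul_star_self hA.1.eigenvectorUnitary
      simp [this]
    | succ i ih =>
      rw [pow_succ, ih]
      conv_lhs => enter [2]; rw [hspec]
      calc _ = U * diagonal (fun a => hA.1.eigenvalues a ^ i) * (star U * U) *
            diagonal hA.1.eigenvalues * star U := by simp only [mul_assoc]
        _ = _ := by
          rw [hU, mul_one, mul_assoc U, diagonal_mul_diagonal]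
          simp only [pow_succ]
  have hD' : ∀ a b, (star U * D * U) a b = (star U * D * U) b a := by
    intro a b
    have h1 : (star U * D * U).IsHermitian := by
      rw [star_eq_conjTranspose]
      exact isHermitian_conjTranspose_mul_mul U hD
    have := h1.apply b a
    simpa using this
  refine ⟨hA.1.eigenvalues, fun a b => 1 / 2 * (star U * D * U) a b ^ 2,
    fun a => hA.eigenvalues_nonneg a, fun a b => by positivity, fun i j => ?_⟩
  have h1 : (D * (A ^ i * D * A ^ j)).trace =
      ((star U * D * U) * diagonal (fun a => hA.1.eigenvalues a ^ i) * ((star U * D * U) *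
        diagonal (fun a => hA.1.eigenvalues a ^ j))).trace := by
    rw [hpow, hpow]
    have : D * (U * diagonal (fun a => hA.1.eigenvalues a ^ i) * star U * D *
        (U * diagonal (fun a => hA.1.eigenvalues a ^ j) * star U)) =
        (D * U * diagonal (fun a => hA.1.eigenvalues a ^ i) * star U * D * U *
          diagonal (fun a => hA.1.eigenvalues a ^ j)) * star U := by
      simp only [mul_assoc]
    rw [this, Matrix.trace_mul_comm]
    simp only [mul_assoc]
  simp only [mul_assoc (1 / 2 : ℝ), ← Finset.mul_sum]
  rw [← sum_sum_symm (w := fun a b => (star U * D * U) a b ^ 2) (fun a b => by simp only [hD' a b])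
    fun a b => hA.1.eigenvalues a ^ i * hA.1.eigenvalues b ^ j, h1, Matrix.trace, Finset.sum_comm]
  refine Finset.sum_congr rfl fun b _ => ?_
  rw [diag_apply, Matrix.mul_apply]
  refine Finset.sum_congr rfl fun a _ => ?_
  rw [mul_diagonal, mul_diagonal, hD' b a]
  ring

theorem pow_mul_pow_add_le {a b : ℝ} (ha : 0 ≤ a) (hb : 0 ≤ b) (i j : ℕ) :
    a ^ i * b ^ j + b ^ i * a ^ j ≤ a ^ (i + j) + b ^ (i + j) := by
  have h : 0 ≤ (a ^ i - b ^ i) * (a ^ j - b ^ j) := by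
    rcases le_total a b with hab | hab
    · exact mul_nonneg_of_nonpos_of_nonpos (sub_nonpos.2 (pow_le_pow_left₀ ha hab i))
        (sub_nonpos.2 (pow_le_pow_left₀ ha hab j))
    · exact mul_nonneg (sub_nonneg.2 (pow_le_pow_left₀ hb hab i))
        (sub_nonneg.2 (pow_le_pow_left₀ hb hab j))
  rw [pow_add, pow_add]
  linarith

/-- The symmetrized products `a ^ i b ^ j + b ^ i a ^ j` with `i + j` fixed form a convex sequence,
so the decrease after `i` steps is at most `i` times the decrease of the first step. -/
theorem pow_mul_pow_decrease_le {a b : ℝ} (ha : 0 ≤ a) (hb : 0 ≤ b) (i j : ℕ) :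
    (a ^ (i + j + 1) + b ^ (i + j + 1)) - (a ^ (i + 1) * b ^ j + b ^ (i + 1) * a ^ j) ≤
      (i + 1) * ((a ^ (i + j + 1) + b ^ (i + j + 1)) - (a * b ^ (i + j) + b * a ^ (i + j))) := by
  -- both sides are products with the factor `a - b`
  wlog hab : b ≤ a generalizing a b
  · have := this hb ha (le_of_not_ge hab)
    linarith
  induction i generalizing j with
  | zero => simp
  | succ i ih =>
    have h1 := ih (j + 1)
    have e1 : i + (j + 1) + 1 = i + 1 + j + 1 := by ring
    have e2 : i + (j + 1) = i + 1 + j := by ring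
    rw [e1, e2] at h1
    have h2 : (a ^ (i + 1) * b ^ (j + 1) + b ^ (i + 1) * a ^ (j + 1)) -
        (a ^ (i + 1 + 1) * b ^ j + b ^ (i + 1 + 1) * a ^ j) ≤
        (a ^ (i + 1 + j + 1) + b ^ (i + 1 + j + 1)) - (a * b ^ (i + 1 + j) + b * a ^ (i + 1 + j)) := by
      have h3 : 0 ≤ (a - b) * (a ^ (i + 1 + j) - b ^ (i + 1) * a ^ j) := by
        refine mul_nonneg (sub_nonneg.2 hab) (sub_nonneg.2 ?_)
        rw [pow_add a (i + 1) j]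
        exact mul_le_mul_of_nonneg_right (pow_le_pow_left₀ hb hab _) (pow_nonneg ha _)
      have h4 : 0 ≤ (a - b) * (a ^ (i + 1) * b ^ j - b ^ (i + 1 + j)) := by
        refine mul_nonneg (sub_nonneg.2 hab) (sub_nonneg.2 ?_)
        rw [pow_add b (i + 1) j]
        exact mul_le_mul_of_nonneg_right (pow_le_pow_left₀ hb hab _) (pow_nonneg hb _)
      simp only [pow_add, pow_one] at h3 h4 ⊢
      nlinarith
    push_cast
    linarith

variable {A D : Matrix S S ℝ}

theorem corr_nonneg (hA : A.PosSemidef) (hD : D.IsHermitian) (i j : ℕ) :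
    0 ≤ (D * (A ^ i * D * A ^ j)).trace := by
  obtain ⟨l, w, hl, hw, h⟩ := exists_spectral_weights hA hD
  rw [h]
  exact Finset.sum_nonneg fun a _ => Finset.sum_nonneg fun b _ =>
    mul_nonneg (hw a b) (add_nonneg (mul_nonneg (pow_nonneg (hl a) _) (pow_nonneg (hl b) _))
      (mul_nonneg (pow_nonneg (hl b) _) (pow_nonneg (hl a) _)))

theorem corr_le_zero (hA : A.PosSemidef) (hD : D.IsHermitian) (i j : ℕ) :
    (D * (A ^ i * D * A ^ j)).trace ≤ (D * (A ^ 0 * D * A ^ (i + j))).trace := by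
  obtain ⟨l, w, hl, hw, h⟩ := exists_spectral_weights hA hD
  rw [h, h]
  refine Finset.sum_le_sum fun a _ => Finset.sum_le_sum fun b _ =>
    mul_le_mul_of_nonneg_left ?_ (hw a b)
  have := pow_mul_pow_add_le (hl a) (hl b) i j
  simp only [pow_zero, one_mul]
  linarith

theorem corr_decrease_le (hA : A.PosSemidef) (hD : D.IsHermitian) (i j : ℕ) :
    (D * (A ^ 0 * D * A ^ (i + j + 1))).trace - (D * (A ^ (i + 1) * D * A ^ j)).trace ≤
      (i + 1) * ((D * (A ^ 0 * D * A ^ (i + j + 1))).trace -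
        (D * (A ^ 1 * D * A ^ (i + j))).trace) := by
  obtain ⟨l, w, hl, hw, h⟩ := exists_spectral_weights hA hD
  rw [h, h, h]
  simp only [← Finset.sum_sub_distrib, Finset.mul_sum]
  refine Finset.sum_le_sum fun a _ => Finset.sum_le_sum fun b _ => ?_
  rw [← mul_sub, ← mul_sub, mul_left_comm]
  refine mul_le_mul_of_nonneg_left ?_ (hw a b)
  have := pow_mul_pow_decrease_le (hl a) (hl b) i j
  simp only [pow_zero, one_mul, pow_one]
  linarith

end Spectral

section BridgeSum

variable {V : Type} [Fintype V] [DecidableEq V]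

theorem swapMatrix_mul_self (e : Sym2 V) : swapMatrix e * swapMatrix e = 1 := by
  ext s s'
  rw [Matrix.mul_apply, Finset.sum_eq_single (fun x => s' (edgeSwap e x))]
  · simp only [swapMatrix, Matrix.of_apply, implies_true, if_true, mul_one, edgeSwap_edgeSwap,
      Matrix.one_apply]
    exact if_congr ⟨fun h => funext fun x => (h x).symm, fun h x => by rw [h]⟩ rfl rfl
  · intro u _ hu
    have : ¬ ∀ x, s' (edgeSwap e x) = u x := fun h => hu (funext fun x => (h x).symm)
    simp [swapMatrix, this]
  · simp

theorem bridgeMatrix_isHermitian (e : Sym2 V) : (bridgeMatrix e).IsHermitian := by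
  ext s s'
  simp only [conjTranspose_apply, star_trivial, bridgeMatrix, Matrix.of_apply]
  refine if_congr (forall_congr' fun x => ?_) rfl rfl
  rw [and_comm (a := s' _ = _), eq_comm (a := s' x)]

theorem bridgeMatrix_mul_self (G : SimpleGraph V) (c : G.Coloring Bool) {e : Sym2 V}
    (he : e ∈ G.edgeSet) : bridgeMatrix e * bridgeMatrix e = (2 : ℝ) • bridgeMatrix e := by
  have h := congrArg (sublatticeRotation c) (swapMatrix_mul_self e)
  rw [map_mul, map_one, sublatticeRotation_swapMatrix G c he] at h
  have h2 : (1 - bridgeMatrix e) * (1 - bridgeMatrix e) =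
      1 - (2 : ℝ) • bridgeMatrix e + bridgeMatrix e * bridgeMatrix e := by
    rw [sub_mul, mul_sub, mul_sub, one_mul, mul_one, one_mul, two_smul]
    abel
  rw [h2] at h
  have h3 := sub_eq_zero.2 h
  rw [← sub_eq_zero, ← h3]
  abel

theorem posSemidef_of_mul_self {S : Type} [Fintype S] [DecidableEq S] {M : Matrix S S ℝ}
    (hM : M.IsHermitian) (h2 : M * M = (2 : ℝ) • M) : M.PosSemidef := by
  have h : M = (1 / 2 : ℝ) • (Mᴴ * M) := by
    rw [hM.eq, h2, smul_smul]; norm_num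
  rw [h]
  exact (posSemidef_conjTranspose_mul_self M).smul (by norm_num)

variable (G : SimpleGraph V) [DecidableRel G.Adj]

theorem bridgeSum_posSemidef (c : G.Coloring Bool) : (bridgeSum G).PosSemidef :=
  Matrix.posSemidef_sum _ fun e _ =>
    posSemidef_of_mul_self (bridgeMatrix_isHermitian _) (bridgeMatrix_mul_self G c e.2)

/-- The operator `∑ₑ Uₑ` is bounded by `2 |E|`. -/
theorem trace_bridgeSum_pow_succ_le (c : G.Coloring Bool) (k : ℕ) :
    (bridgeSum G ^ (k + 1)).trace ≤ 2 * G.edgeFinset.card * (bridgeSum G ^ k).trace := by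
  have hA := (bridgeSum_posSemidef G c).pow k
  have h1 : ∀ e : G.edgeSet, (bridgeSum G ^ k * bridgeMatrix (e : Sym2 V)).trace ≤
      2 * (bridgeSum G ^ k).trace := by
    intro e
    have hH : ((2 : ℝ) • (1 : Matrix (V → Fin 2) (V → Fin 2) ℝ) -
        bridgeMatrix (e : Sym2 V)).IsHermitian := by
      refine IsHermitian.sub ?_ (bridgeMatrix_isHermitian _)
      rw [smul_one_eq_diagonal]
      exact isHermitian_diagonal _
    have h2 : ((2 : ℝ) • (1 : Matrix (V → Fin 2) (V → Fin 2) ℝ) - bridgeMatrix (e : Sym2 V)) *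
        ((2 : ℝ) • 1 - bridgeMatrix (e : Sym2 V)) =
          (2 : ℝ) • ((2 : ℝ) • 1 - bridgeMatrix (e : Sym2 V)) := by
      rw [sub_mul, mul_sub, mul_sub, bridgeMatrix_mul_self G c e.2]
      simp only [smul_mul_assoc, one_mul, mul_smul_comm, mul_one]
      module
    have h3 := (hA.mul_mul_conjTranspose_same ((2 : ℝ) • (1 : Matrix (V → Fin 2) (V → Fin 2) ℝ) -
        bridgeMatrix (e : Sym2 V))).trace_nonneg
    rw [hH.eq, Matrix.trace_mul_cycle, h2, Matrix.trace_mul_comm] at h3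
    simp only [Matrix.mul_smul, mul_sub, Matrix.trace_smul, Matrix.trace_sub, mul_one,
      smul_eq_mul] at h3
    linarith
  rw [pow_succ]
  have hsum : bridgeSum G ^ k * bridgeSum G =
      ∑ e : G.edgeSet, bridgeSum G ^ k * bridgeMatrix (e : Sym2 V) := by
    rw [← Finset.mul_sum, ← bridgeSum]
  rw [hsum, Matrix.trace_sum]
  refine (Finset.sum_le_sum fun e _ => h1 e).trans ?_
  rw [Finset.sum_const, Finset.card_univ, ← SimpleGraph.edgeFinset_card, nsmul_eq_mul]
  exact le_of_eq (by ring)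

theorem bridgeMatrix_nonneg (e : Sym2 V) (s s' : V → Fin 2) : 0 ≤ bridgeMatrix e s s' := by
  rw [bridgeMatrix, Matrix.of_apply]
  split_ifs <;> norm_num

theorem pow_apply_nonneg {S : Type} [Fintype S] [DecidableEq S] {M : Matrix S S ℝ}
    (hM : ∀ s s', 0 ≤ M s s') (k : ℕ) (s s' : S) : 0 ≤ (M ^ k) s s' := by
  induction k generalizing s s' with
  | zero => rw [pow_zero, Matrix.one_apply]; split_ifs <;> norm_num
  | succ k ih =>
    rw [pow_succ, Matrix.mul_apply]
    exact Finset.sum_nonneg fun u _ => mul_nonneg (ih _ _) (hM _ _)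

/-- A bridge matrix changes the magnetization by at most `2`. -/
theorem sq_totalSpin_sub_mul_bridgeMatrix_le {e : Sym2 V} (he : ¬ e.IsDiag) (s s' : V → Fin 2) :
    (totalSpin s - totalSpin s') ^ 2 * bridgeMatrix e s s' ≤ 4 * bridgeMatrix e s s' := by
  induction e with
  | _ x y =>
  have hxy : x ≠ y := by simpa using he
  by_cases h : ∀ z, z ≠ x → z ≠ y → s z = s' z
  · refine mul_le_mul_of_nonneg_right ?_ (bridgeMatrix_nonneg _ _ _)
    have h1 : totalSpin s - totalSpin s' =
        (spinVal (s x) - spinVal (s' x)) + (spinVal (s y) - spinVal (s' y)) := by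
      rw [totalSpin, totalSpin, ← Finset.sum_sub_distrib,
        Finset.sum_eq_add x y hxy (fun z _ hz => by rw [h z hz.1 hz.2, sub_self]) (by simp) (by simp)]
    rw [h1]
    have h2 : ∀ a a' : Fin 2, |spinVal a - spinVal a'| ≤ 1 := by
      intro a a'
      fin_cases a <;> fin_cases a' <;> simp [spinVal] <;> norm_num [abs_le]
    have h3 := abs_le.1 (h2 (s x) (s' x))
    have h4 := abs_le.1 (h2 (s y) (s' y))
    nlinarith
  · rw [bridgeMatrix_mk_apply hxy, if_neg h]
    simp

/-- The double commutator of the magnetization with `∑ₑ Uₑ` is controlled by `∑ₑ Uₑ` itself,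
because each term changes the magnetization by a bounded amount. -/
theorem corr_first_decrease_le (c : G.Coloring Bool) (k : ℕ) :
    (diagonal totalSpin * (bridgeSum G ^ 0 * diagonal totalSpin * bridgeSum G ^ (k + 1))).trace -
      (diagonal totalSpin * (bridgeSum G ^ 1 * diagonal totalSpin * bridgeSum G ^ k)).trace ≤
      2 * (bridgeSum G ^ (k + 1)).trace := by
  have hA := (bridgeSum_posSemidef G c).1
  have hsymm : ∀ s s', bridgeSum G s s' * (bridgeSum G ^ k) s' s =
      bridgeSum G s' s * (bridgeSum G ^ k) s s' := by
    intro s s'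
    have h1 := hA.apply s s'
    have h2 := (hA.pow k).apply s s'
    simp only [star_trivial] at h1 h2
    rw [h1, h2]
  have hent : ∀ s s', bridgeSum G s s' = ∑ e : G.edgeSet, bridgeMatrix (e : Sym2 V) s s' :=
    fun s s' => by rw [bridgeSum, Matrix.sum_apply]
  have hpos : ∀ s s', 0 ≤ bridgeSum G s s' := fun s s' => by
    rw [hent]; exact Finset.sum_nonneg fun e _ => bridgeMatrix_nonneg _ _ _
  have hbound : ∀ s s', (totalSpin s - totalSpin s') ^ 2 * bridgeSum G s s' ≤
      4 * bridgeSum G s s' := by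
    intro s s'
    rw [hent, Finset.mul_sum, Finset.mul_sum]
    exact Finset.sum_le_sum fun e _ =>
      sq_totalSpin_sub_mul_bridgeMatrix_le (G.not_isDiag_of_mem_edgeSet e.2) s s'
  have t0 : (diagonal totalSpin * (bridgeSum G ^ 0 * diagonal totalSpin *
      bridgeSum G ^ (k + 1))).trace =
      ∑ s, ∑ s', bridgeSum G s s' * (bridgeSum G ^ k) s' s * totalSpin s ^ 2 := by
    rw [pow_zero, one_mul, pow_succ', Matrix.trace]
    refine Finset.sum_congr rfl fun s _ => ?_
    rw [diag_apply, diagonal_mul, diagonal_mul, Matrix.mul_apply, Finset.mul_sum, Finset.mul_sum]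
    exact Finset.sum_congr rfl fun s' _ => by ring
  have t1 : (diagonal totalSpin * (bridgeSum G ^ 1 * diagonal totalSpin *
      bridgeSum G ^ k)).trace =
      ∑ s, ∑ s', bridgeSum G s s' * (bridgeSum G ^ k) s' s * (totalSpin s * totalSpin s') := by
    rw [pow_one, Matrix.trace]
    refine Finset.sum_congr rfl fun s _ => ?_
    rw [diag_apply, diagonal_mul, Matrix.mul_apply, Finset.mul_sum]
    exact Finset.sum_congr rfl fun s' _ => by rw [mul_diagonal]; ring
  have t2 : (bridgeSum G ^ (k + 1)).trace =
      ∑ s, ∑ s', bridgeSum G s s' * (bridgeSum G ^ k) s' s := by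
    rw [pow_succ', Matrix.trace]
    exact Finset.sum_congr rfl fun s _ => by rw [diag_apply, Matrix.mul_apply]
  rw [t0, t1, t2, sum_sum_symm hsymm fun s _ => totalSpin s ^ 2, Finset.mul_sum,
    ← Finset.sum_sub_distrib, Finset.mul_sum]
  refine Finset.sum_le_sum fun s _ => ?_
  rw [Finset.mul_sum, ← Finset.sum_sub_distrib, Finset.mul_sum]
  refine Finset.sum_le_sum fun s' _ => ?_
  have := mul_le_mul_of_nonneg_right (hbound s s')
    (pow_apply_nonneg hpos k s' s)
  linarith

/-- Imaginary-time correlations of the magnetization differ little from the equal-time one. -/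
theorem corr_ge (c : G.Coloring Bool) {j k : ℕ} (hj : j ≤ k) :
    (diagonal totalSpin * (bridgeSum G ^ 0 * diagonal totalSpin * bridgeSum G ^ k)).trace -
      2 * k * (bridgeSum G ^ k).trace ≤
    (diagonal totalSpin * (bridgeSum G ^ j * diagonal totalSpin * bridgeSum G ^ (k - j))).trace := by
  have hA := bridgeSum_posSemidef G c
  have htr : 0 ≤ (bridgeSum G ^ k).trace := (hA.pow k).trace_nonneg
  obtain ⟨i, rfl⟩ := Nat.exists_eq_add_of_le hj
  cases j with
  | zero =>
    have : (0 : ℝ) ≤ ((0 + i : ℕ) : ℝ) := by positivity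
    rw [Nat.sub_zero]
    nlinarith
  | succ j =>
    have e1 : j + 1 + i = j + i + 1 := by ring
    have e2 : j + 1 + i - (j + 1) = i := by omega
    rw [e2]
    rw [e1] at htr ⊢
    have h1 := corr_decrease_le hA (isHermitian_diagonal totalSpin) j i
    have h2 := corr_first_decrease_le G c (j + i)
    have h3 : ((j : ℝ) + 1) ≤ ((j + i + 1 : ℕ) : ℝ) := by push_cast; linarith [(Nat.cast_nonneg i : (0:ℝ) ≤ i)]
    have h4 : ((j : ℝ) + 1) * (2 * (bridgeSum G ^ (j + i + 1)).trace) ≤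
        ((j + i + 1 : ℕ) : ℝ) * (2 * (bridgeSum G ^ (j + i + 1)).trace) :=
      mul_le_mul_of_nonneg_right h3 (by linarith)
    have h5 := mul_le_mul_of_nonneg_left h2 (by positivity : (0 : ℝ) ≤ (j : ℝ) + 1)
    linarith

end BridgeSum

/-! ### Probabilistic representations of the Gibbs states -/

theorem hasSum_of_eq {f g : ℕ → ℝ} {a : ℝ} (h : HasSum f a) (e : ∀ k, f k = g k) : HasSum g a :=
  funext e ▸ h

theorem tanh_monotone : Monotone Real.tanh := by
  intro x y hxy
  rw [Real.tanh_eq_sinh_div_cosh, Real.tanh_eq_sinh_div_cosh,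
    div_le_div_iff₀ (Real.cosh_pos x) (Real.cosh_pos y)]
  have h := Real.sinh_sub y x
  have h2 := Real.sinh_nonneg_iff.2 (sub_nonneg.2 hxy)
  linarith

section ExpDiagonal

variable {S : Type} [Fintype S] [DecidableEq S]

theorem hasSum_trace_exp (A : Matrix S S ℝ) (F : S → ℝ) (b : ℝ) :
    HasSum (fun k : ℕ => b ^ k / k.factorial * (diagonal F * A ^ k).trace)
      (∑ s, F s * NormedSpace.exp (b • A) s s) := by
  have h := hasSum_sum (s := Finset.univ) fun s (_ : s ∈ Finset.univ) =>
    (hasSum_exp_apply A b s s).mul_left (F s)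
  refine hasSum_of_eq (h) fun k => ?_
  simp only [Matrix.trace, diag_apply, diagonal_mul, Finset.mul_sum]
  exact Finset.sum_congr rfl fun s _ => by ring

theorem one_le_exp_apply {A : Matrix S S ℝ} (hA : ∀ s s', 0 ≤ A s s') {b : ℝ} (hb : 0 ≤ b)
    (s : S) : 1 ≤ NormedSpace.exp (b • A) s s := by
  have h := le_hasSum (hasSum_exp_apply A b s s) 0 fun k _ =>
    mul_nonneg (by positivity) (pow_apply_nonneg hA k s s)
  simpa using h

end ExpDiagonal

variable {V : Type} [Fintype V] [DecidableEq V] (G : SimpleGraph V) [DecidableRel G.Adj]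

section Ferro

theorem swapSum_nonneg (s s' : V → Fin 2) : 0 ≤ swapSum G s s' := by
  rw [swapSum, Matrix.sum_apply]
  refine Finset.sum_nonneg fun e _ => ?_
  rw [swapMatrix, Matrix.of_apply]
  split_ifs <;> norm_num

/-- The diagonal of `exp (β ∑ₑ Tₑ)`, an unnormalized weight on spin configurations. -/
noncomputable def ferroWeight (β : ℝ) (s : V → Fin 2) : ℝ := NormedSpace.exp (β • swapSum G) s s

theorem ferroWeight_pos {β : ℝ} (hβ : 0 < β) (s : V → Fin 2) : 0 < ferroWeight G β s :=
  lt_of_lt_of_le one_pos (one_le_exp_apply (swapSum_nonneg G) hβ.le s)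

open Classical in
theorem hasSum_ferroWeight (β : ℝ) (F : (V → Fin 2) → ℝ) :
    HasSum (fun k : ℕ => ∑ e : Fin k → G.edgeSet, (∑ τ : Orbits (cycleNext G e) → Fin 2,
      F fun x => τ (Quotient.mk _ (x, 0))) * (β ^ k / k.factorial))
      (∑ s, F s * ferroWeight G β s) := by
  refine hasSum_of_eq (hasSum_trace_exp (swapSum G) F β) fun k => ?_
  symm
  have h := trace_transfer (fun e : G.edgeSet => swapMatrix (e : Sym2 V)) (cycleNext G (k := k))
    (cycle_path_weight G) F (fun _ => 1) 0
  simp only [diagonal_one, mul_one, Fin.val_zero, pow_zero, one_mul, Nat.sub_zero] at h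
  rw [← swapSum] at h
  rw [h, ← Finset.sum_mul, mul_comm]

open Classical in
/-- The weight of the cycle model as a function of the word of bridges. -/
noncomputable def wordCycleWeight (β h : ℝ) (p : BridgeWord G) : ℝ :=
  ∏ γ : Orbits (cycleNext G p.2), (1 + Real.exp (-2 * (β * h) * levelCount (cycleNext G p.2) 0 γ))

omit [DecidableRel G.Adj] in
theorem cycleWeight_eq (β h : ℝ) : cycleWeight G β h = fun ω => wordCycleWeight G β h ω.1 := by
  funext ω
  rw [cycleWeight, wordCycleWeight]
  refine Finset.prod_congr rfl fun γ _ => ?_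
  rw [orbitLength_cycleNext]
  congr 2
  ring

omit [DecidableRel G.Adj] in
theorem wordCycleWeight_nonneg (β h : ℝ) (p : BridgeWord G) : 0 ≤ wordCycleWeight G β h p :=
  Finset.prod_nonneg fun γ _ => by positivity

/-- The partition function of the cycle model. -/
noncomputable def cyclePartition (β h : ℝ) : ℝ :=
  Real.exp (-(β * h * Fintype.card V)) *
    ∑ s, Real.exp (2 * (β * h) * totalSpin s) * ferroWeight G β s

theorem cyclePartition_pos {β : ℝ} (hβ : 0 < β) (h : ℝ) : 0 < cyclePartition G β h := by
  refine mul_pos (Real.exp_pos _) (Finset.sum_pos (fun s _ => ?_) Finset.univ_nonempty)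
  exact mul_pos (Real.exp_pos _) (ferroWeight_pos G hβ s)

theorem hasSum_cyclePartition (β h : ℝ) :
    HasSum (fun k : ℕ => ∑ e : Fin k → G.edgeSet,
      wordCycleWeight G β h ⟨k, e⟩ * (β ^ k / k.factorial)) (cyclePartition G β h) := by
  have h1 := (hasSum_ferroWeight G β fun s => Real.exp (2 * (β * h) * totalSpin s)).mul_left
    (Real.exp (-(β * h * Fintype.card V)))
  refine hasSum_of_eq (h1) fun k => ?_
  rw [Finset.mul_sum]
  refine Finset.sum_congr rfl fun e _ => ?_
  rw [sum_exp_totalSpin, wordCycleWeight, ← mul_assoc, ← mul_assoc, ← Real.exp_add, neg_add_cancel,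
    Real.exp_zero, one_mul]

theorem isProbabilityMeasure_cycleMeasure {β : ℝ} (hβ : 0 < β) (h : ℝ) :
    IsProbabilityMeasure (cycleMeasure G β h) := by
  rw [cycleMeasure, cycleWeight_eq]
  exact isProbabilityMeasure_reweight hβ (wordCycleWeight_nonneg G β h) (cyclePartition_pos G hβ h)
    (hasSum_cyclePartition G β h)

omit [DecidableRel G.Adj] in
theorem cycleLengthAt_eq (β : ℝ) (x : V) (ω : BridgeConfig G) :
    cycleLengthAt G β x ω =
      β * levelCount (cycleNext G ω.1.2) 0 (Quotient.mk _ (x, 0)) :=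
  orbitLength_cycleNext G _ _ _ _

/-- Expectations in the cycle model of functions of the word of bridges. -/
theorem integral_cycleMeasure {β : ℝ} (hβ : 0 < β) (h : ℝ) {f : BridgeWord G → ℝ}
    (hf : ∀ p, 0 ≤ f p) {X : ℝ}
    (hX : HasSum (fun k : ℕ => ∑ e : Fin k → G.edgeSet,
      wordCycleWeight G β h ⟨k, e⟩ * (f ⟨k, e⟩ * (β ^ k / k.factorial))) X) :
    ∫ ω, f ω.1 ∂cycleMeasure G β h = X / cyclePartition G β h := by
  rw [cycleMeasure, cycleWeight_eq]
  refine integral_reweight hβ (wordCycleWeight_nonneg G β h) (cyclePartition_pos G hβ h)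
    (hasSum_cyclePartition G β h) (I := fun p => f p * (β ^ p.1 / p.1.factorial))
    (measurable_of_sections G fun p => (measurable_const : Measurable fun _ => f p))
    (fun p _ _ => hf p) (fun p => mul_nonneg (hf p) (by positivity)) (fun p => ?_) ?_ hX
  · change ∫⁻ _ in timeSimplex p.1 β, ENNReal.ofReal (f p) = _
    rw [setLIntegral_const, volume_timeSimplex hβ, ENNReal.ofReal_mul (hf p)]
  · exact hX.nonneg fun k => Finset.sum_nonneg fun e _ =>
      mul_nonneg (wordCycleWeight_nonneg G β h _) (mul_nonneg (hf _) (by positivity))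

/-- The magnetization of the ferromagnet: a cycle of length `L` has mean spin `½ tanh (h L)` per
site. -/
theorem integral_tanh_cycleLength {β h : ℝ} (hβ : 0 < β) (hh : 0 ≤ h) :
    ∫ ω, ∑ x, 1 / 2 * Real.tanh (h * cycleLengthAt G β x ω) ∂cycleMeasure G β h =
      (∑ s, totalSpin s * Real.exp (2 * (β * h) * totalSpin s) * ferroWeight G β s) /
        ∑ s, Real.exp (2 * (β * h) * totalSpin s) * ferroWeight G β s := by
  have h0 := (hasSum_ferroWeight G β fun s => totalSpin s *
    Real.exp (2 * (β * h) * totalSpin s)).mul_left (Real.exp (-(β * h * Fintype.card V)))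
  have h1 := integral_cycleMeasure G hβ h (f := fun p => ∑ x, 1 / 2 *
    Real.tanh (h * (β * levelCount (cycleNext G p.2) 0 (Quotient.mk _ (x, 0)))))
    (fun p => Finset.sum_nonneg fun x _ => mul_nonneg (by norm_num) ?_)
    (X := Real.exp (-(β * h * Fintype.card V)) * ∑ s, totalSpin s *
      Real.exp (2 * (β * h) * totalSpin s) * ferroWeight G β s) ?_
  · simp only [cycleLengthAt_eq]
    rw [h1, cyclePartition]
    exact mul_div_mul_left _ _ (Real.exp_pos _).ne'
  · exact Real.tanh_zero ▸ tanh_monotone (by positivity : (0 : ℝ) ≤ _)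
  · refine hasSum_of_eq (h0) fun k => ?_
    rw [Finset.mul_sum]
    refine Finset.sum_congr rfl fun e _ => ?_
    rw [sum_totalSpin_mul_exp, wordCycleWeight, ← mul_assoc, ← mul_assoc, ← mul_assoc,
      ← Real.exp_add, neg_add_cancel, Real.exp_zero, one_mul, mul_assoc]
    congr 2
    refine Finset.sum_congr rfl fun x _ => ?_
    rw [← mul_assoc, mul_comm h β]

/-- Without field, the cycle lengths give the second moment of the magnetization. -/
theorem integral_cycleLength {β : ℝ} (hβ : 0 < β) :
    ∫ ω, ∑ x, cycleLengthAt G β x ω ∂cycleMeasure G β 0 =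
      4 * β * ((∑ s, totalSpin s ^ 2 * ferroWeight G β s) / ∑ s, ferroWeight G β s) := by
  have h0 := (hasSum_ferroWeight G β fun s => totalSpin s ^ 2).mul_left (4 * β)
  have h1 := integral_cycleMeasure G hβ 0 (f := fun p => ∑ x,
    β * levelCount (cycleNext G p.2) 0 (Quotient.mk _ (x, 0)))
    (fun p => Finset.sum_nonneg fun x _ => by positivity)
    (X := 4 * β * ∑ s, totalSpin s ^ 2 * ferroWeight G β s) ?_
  · simp only [cycleLengthAt_eq]
    rw [h1, cyclePartition, mul_div_assoc]
    simp
  · refine hasSum_of_eq (h0) fun k => ?_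
    rw [Finset.mul_sum]
    refine Finset.sum_congr rfl fun e _ => ?_
    simp only [sq]
    rw [sum_totalSpin_mul_totalSpin, wordCycleWeight, ← Finset.mul_sum]
    simp only [mul_zero, zero_mul, Real.exp_zero, Finset.prod_const, Finset.card_univ]
    norm_num
    ring

end Ferro

section Anti

variable (c : G.Coloring Bool)

theorem bridgeSum_nonneg (s s' : V → Fin 2) : 0 ≤ bridgeSum G s s' := by
  rw [bridgeSum, Matrix.sum_apply]
  exact Finset.sum_nonneg fun e _ => bridgeMatrix_nonneg _ _ _

/-- The diagonal of `exp (β ∑ₑ Uₑ)`, an unnormalized weight on spin configurations. -/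
noncomputable def antiWeight (β : ℝ) (s : V → Fin 2) : ℝ :=
  NormedSpace.exp (β • bridgeSum G) s s

theorem antiWeight_pos {β : ℝ} (hβ : 0 < β) (s : V → Fin 2) : 0 < antiWeight G β s :=
  lt_of_lt_of_le one_pos (one_le_exp_apply (bridgeSum_nonneg G) hβ.le s)

/-- The weight `2^{#loops}` of a word of bridges. -/
noncomputable def wordLoopWeight (p : BridgeWord G) : ℝ :=
  2 ^ Nat.card (Orbits (loopNext G c p.2))

omit [DecidableRel G.Adj] [Fintype V] in
theorem wordLoopWeight_nonneg (p : BridgeWord G) : 0 ≤ wordLoopWeight G c p := by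
  rw [wordLoopWeight]; positivity

theorem trace_bridgeSum_pow (k : ℕ) :
    (bridgeSum G ^ k).trace = ∑ e : Fin k → G.edgeSet, wordLoopWeight G c ⟨k, e⟩ := by
  classical
  have h := trace_transfer (fun e : G.edgeSet => bridgeMatrix (e : Sym2 V)) (loopNext G c (k := k))
    (loop_path_weight G c) (fun _ => 1) (fun _ => 1) 0
  simp only [diagonal_one, mul_one, Fin.val_zero, pow_zero, one_mul, Nat.sub_zero] at h
  rw [← bridgeSum] at h
  rw [h]
  refine Finset.sum_congr rfl fun e _ => ?_
  simp [wordLoopWeight]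

open Classical in
/-- The correlation of the magnetizations at two levels counts the pairs of segments at these
levels on a common loop. -/
theorem corr_bridgeSum (k : ℕ) (j : Fin (k + 1)) :
    (diagonal totalSpin * (bridgeSum G ^ (j : ℕ) * diagonal totalSpin *
      bridgeSum G ^ (k - (j : ℕ)))).trace = 1 / 4 * ∑ e : Fin k → G.edgeSet,
        wordLoopWeight G c ⟨k, e⟩ *
          ∑ x, (levelCount (loopNext G c e) j (Quotient.mk _ (x, 0)) : ℝ) := by
  have h := trace_transfer (fun e : G.edgeSet => bridgeMatrix (e : Sym2 V)) (loopNext G c (k := k))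
    (loop_path_weight G c) totalSpin totalSpin j
  rw [← bridgeSum] at h
  rw [h, Finset.mul_sum]
  refine Finset.sum_congr rfl fun e _ => ?_
  rw [sum_totalSpin_mul_totalSpin, wordLoopWeight, Nat.card_eq_fintype_card]
  ring

/-- The partition function of the loop model. -/
noncomputable def loopPartition (β : ℝ) : ℝ := ∑ s, antiWeight G β s

theorem loopPartition_pos {β : ℝ} (hβ : 0 < β) : 0 < loopPartition G β :=
  Finset.sum_pos (fun s _ => antiWeight_pos G hβ s) Finset.univ_nonempty

theorem hasSum_trace_bridgeSum (β : ℝ) :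
    HasSum (fun k : ℕ => β ^ k / k.factorial * (bridgeSum G ^ k).trace) (loopPartition G β) := by
  simpa [loopPartition, antiWeight] using hasSum_trace_exp (bridgeSum G) (fun _ => 1) β

theorem hasSum_loopPartition (β : ℝ) :
    HasSum (fun k : ℕ => ∑ e : Fin k → G.edgeSet,
      wordLoopWeight G c ⟨k, e⟩ * (β ^ k / k.factorial)) (loopPartition G β) := by
  refine hasSum_of_eq ((hasSum_trace_bridgeSum G β)) fun k => ?_
  rw [trace_bridgeSum_pow G c, ← Finset.sum_mul, mul_comm]

theorem isProbabilityMeasure_loopMeasure {β : ℝ} (hβ : 0 < β) :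
    IsProbabilityMeasure (loopMeasure G c β) :=
  isProbabilityMeasure_reweight (W := wordLoopWeight G c) hβ (wordLoopWeight_nonneg G c) (loopPartition_pos G hβ)
    (hasSum_loopPartition G c β)

/-- The contribution of the words of length `k` to the expected total length of the loops, up to the
factor `4`: each of the `k + 1` time levels has the weight `βᵏ⁺¹ / (k + 1)!`. -/
noncomputable def levelCorrSum (β : ℝ) (k : ℕ) : ℝ :=
  β ^ (k + 1) / (k + 1).factorial * ∑ j : Fin (k + 1),
    (diagonal totalSpin * (bridgeSum G ^ (j : ℕ) * diagonal totalSpin *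
      bridgeSum G ^ (k - (j : ℕ)))).trace

theorem hasSum_equalTimeCorr (β : ℝ) :
    HasSum (fun k : ℕ => β ^ k / k.factorial *
      (diagonal totalSpin * (bridgeSum G ^ 0 * diagonal totalSpin * bridgeSum G ^ k)).trace)
      (∑ s, totalSpin s ^ 2 * antiWeight G β s) := by
  refine hasSum_of_eq (hasSum_trace_exp (bridgeSum G) (fun s => totalSpin s ^ 2) β) fun k => ?_
  rw [pow_zero, one_mul, ← mul_assoc, diagonal_mul_diagonal]
  simp only [sq]

include c in
theorem levelCorrSum_nonneg {β : ℝ} (hβ : 0 < β) (k : ℕ) : 0 ≤ levelCorrSum G β k :=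
  mul_nonneg (by positivity) (Finset.sum_nonneg fun j _ =>
    corr_nonneg (bridgeSum_posSemidef G c) (isHermitian_diagonal totalSpin) _ _)

include c in
theorem levelCorrSum_le {β : ℝ} (hβ : 0 < β) (k : ℕ) :
    levelCorrSum G β k ≤ β * (β ^ k / k.factorial *
      (diagonal totalSpin * (bridgeSum G ^ 0 * diagonal totalSpin * bridgeSum G ^ k)).trace) := by
  set f0 := (diagonal totalSpin * (bridgeSum G ^ 0 * diagonal totalSpin * bridgeSum G ^ k)).trace
  have h : ∑ j : Fin (k + 1), (diagonal totalSpin * (bridgeSum G ^ (j : ℕ) * diagonal totalSpin *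
      bridgeSum G ^ (k - (j : ℕ)))).trace ≤ (k + 1) * f0 := by
    refine (Finset.sum_le_sum (g := fun _ => f0) fun j _ => ?_).trans (by simp)
    have := corr_le_zero (bridgeSum_posSemidef G c) (isHermitian_diagonal totalSpin) (j : ℕ)
      (k - (j : ℕ))
    rwa [Nat.add_sub_cancel' (Nat.lt_succ_iff.1 j.2)] at this
  refine (mul_le_mul_of_nonneg_left h (by positivity)).trans (le_of_eq ?_)
  rw [Nat.factorial_succ]
  push_cast
  field_simp
  ring

include c in
theorem le_levelCorrSum {β : ℝ} (hβ : 0 < β) (k : ℕ) :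
    β * (β ^ k / k.factorial *
      (diagonal totalSpin * (bridgeSum G ^ 0 * diagonal totalSpin * bridgeSum G ^ k)).trace) -
      2 * β * (k * (β ^ k / k.factorial * (bridgeSum G ^ k).trace)) ≤ levelCorrSum G β k := by
  set f0 := (diagonal totalSpin * (bridgeSum G ^ 0 * diagonal totalSpin * bridgeSum G ^ k)).trace
  have h : (k + 1) * (f0 - 2 * k * (bridgeSum G ^ k).trace) ≤
      ∑ j : Fin (k + 1), (diagonal totalSpin * (bridgeSum G ^ (j : ℕ) * diagonal totalSpin *
        bridgeSum G ^ (k - (j : ℕ)))).trace := by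
    refine le_trans (le_of_eq (by simp; ring)) (Finset.sum_le_sum
      (f := fun _ => f0 - 2 * k * (bridgeSum G ^ k).trace) fun j _ => ?_)
    exact corr_ge G c (Nat.lt_succ_iff.1 j.2)
  refine le_trans (le_of_eq ?_) (mul_le_mul_of_nonneg_left h (by positivity))
  rw [Nat.factorial_succ]
  push_cast
  field_simp
  ring

include c in
/-- The mean number of bridges is at most of the order of the number of edges. -/
theorem exists_hasSum_mul_trace {β : ℝ} (hβ : 0 < β) :
    ∃ T, HasSum (fun k : ℕ => k * (β ^ k / k.factorial * (bridgeSum G ^ k).trace)) T ∧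
      T ≤ 2 * β * G.edgeFinset.card * loopPartition G β := by
  have hle : ∀ k : ℕ, ((k + 1 : ℕ) : ℝ) * (β ^ (k + 1) / (k + 1).factorial *
      (bridgeSum G ^ (k + 1)).trace) ≤
      2 * β * G.edgeFinset.card * (β ^ k / k.factorial * (bridgeSum G ^ k).trace) := by
    intro k
    have h1 := mul_le_mul_of_nonneg_left (trace_bridgeSum_pow_succ_le G c k)
      (by positivity : 0 ≤ β * (β ^ k / k.factorial))
    refine le_trans (le_of_eq ?_) (h1.trans (le_of_eq (by ring)))
    rw [Nat.factorial_succ]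
    push_cast
    field_simp
    ring
  have hs := (hasSum_trace_bridgeSum G β).mul_left (2 * β * G.edgeFinset.card)
  have h0 : ∀ k : ℕ, 0 ≤ ((k + 1 : ℕ) : ℝ) * (β ^ (k + 1) / (k + 1).factorial *
      (bridgeSum G ^ (k + 1)).trace) := fun k => mul_nonneg (by positivity)
    (mul_nonneg (by positivity) ((bridgeSum_posSemidef G c).pow _).trace_nonneg)
  have hsum := Summable.of_nonneg_of_le h0 hle hs.summable
  refine ⟨_, (hasSum_nat_add_iff (f := fun k : ℕ => (k : ℝ) * (β ^ k / k.factorial *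
    (bridgeSum G ^ k).trace)) 1).1 hsum.hasSum, ?_⟩
  have := hasSum_le hle hsum.hasSum hs
  simpa using this

omit [DecidableRel G.Adj] in
theorem measurable_loopLengthAt (β : ℝ) (x : V) : Measurable (loopLengthAt G c β x) :=
  measurable_of_sections G fun p => by
    have h := measurable_orbitLength β (loopNext G c p.2) (orbitOf (loopNext G c p.2) x)
    exact h

omit [DecidableRel G.Adj] in
theorem loopLengthAt_nonneg {β : ℝ} (hβ : 0 < β) (x : V) {ω : BridgeConfig G}
    (hω : ω.2 ∈ timeSimplex ω.1.1 β) : 0 ≤ loopLengthAt G c β x ω :=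
  orbitLength_nonneg hβ _ hω _

omit [DecidableRel G.Adj] in
theorem loopLengthAt_le {β : ℝ} (hβ : 0 < β) (x : V) {ω : BridgeConfig G}
    (hω : ω.2 ∈ timeSimplex ω.1.1 β) : loopLengthAt G c β x ω ≤ β * Fintype.card V :=
  orbitLength_le hβ _ hω _

/-- The expected total length of the loops through the time `0`. The gaps between the bridges have
the same mean, so that all levels contribute equally. -/
theorem integral_loopLength_eq {β : ℝ} (hβ : 0 < β) {T : ℝ} (hT : HasSum (levelCorrSum G β) T) :
    ∫ ω, ∑ x, loopLengthAt G c β x ω ∂loopMeasure G c β = 4 * T / loopPartition G β := by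
  classical
  have hlen : ∀ (p : BridgeWord G) (t : Fin p.1 → ℝ), ∑ x, loopLengthAt G c β x ⟨p, t⟩ =
      ∑ j, (∑ x, (levelCount (loopNext G c p.2) j (Quotient.mk _ (x, 0)) : ℝ)) *
        segLength β t j := by
    intro p t
    simp only [loopLengthAt, orbitLength_eq_sum, Finset.sum_mul, orbitOf]
    exact Finset.sum_comm
  refine integral_reweight (W := wordLoopWeight G c) hβ (wordLoopWeight_nonneg G c)
    (loopPartition_pos G hβ) (hasSum_loopPartition G c β)
    (I := fun p => β ^ (p.1 + 1) / (p.1 + 1).factorial *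
      ∑ j, ∑ x, (levelCount (loopNext G c p.2) j (Quotient.mk _ (x, 0)) : ℝ))
    (Finset.measurable_sum _ fun x _ => measurable_loopLengthAt G c β x)
    (fun p t ht => Finset.sum_nonneg fun x _ => loopLengthAt_nonneg G c hβ x ht)
    (fun p => mul_nonneg (by positivity)
      (Finset.sum_nonneg fun j _ => Finset.sum_nonneg fun x _ => Nat.cast_nonneg _))
    (fun p => ?_) ?_ ?_
  · rw [setLIntegral_congr_fun (measurableSet_timeSimplex p.1 β)
      (g := fun t => ∑ j, ENNReal.ofReal
        (∑ x, (levelCount (loopNext G c p.2) j (Quotient.mk _ (x, 0)) : ℝ)) *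
          ENNReal.ofReal (segLength β t j)) fun t ht => ?_]
    · rw [lintegral_finsetSum _ fun j _ => (measurable_segLength β j).ennreal_ofReal.const_mul _,
        mul_comm, ENNReal.ofReal_mul (by positivity),
        ENNReal.ofReal_sum_of_nonneg fun j _ => by positivity, Finset.sum_mul]
      refine Finset.sum_congr rfl fun j _ => ?_
      rw [lintegral_const_mul _ (measurable_segLength β j).ennreal_ofReal,
        lintegral_segLength, volume_timeSimplex hβ]
    · dsimp only
      rw [hlen, ENNReal.ofReal_sum_of_nonneg fun j _ =>
        mul_nonneg (by positivity) (segLength_nonneg hβ ht j)]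
      exact Finset.sum_congr rfl fun j _ => ENNReal.ofReal_mul (by positivity)
  · exact mul_nonneg (by norm_num) (hT.nonneg (levelCorrSum_nonneg G c hβ))
  · refine hasSum_of_eq ((hT.mul_left 4)) fun k => ?_
    rw [levelCorrSum]
    simp only [corr_bridgeSum G c]
    rw [← Finset.mul_sum, Finset.sum_comm, Finset.mul_sum, Finset.mul_sum, Finset.mul_sum]
    refine Finset.sum_congr rfl fun e _ => ?_
    rw [← Finset.mul_sum]
    ring

/-- Up to a term of the order of the number of edges, the expected total length of the loops
through the time `0` is given by the second moment of the magnetization. -/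
theorem integral_loopLength_bounds {β : ℝ} (hβ : 0 < β) :
    4 * β * ((∑ s, totalSpin s ^ 2 * antiWeight G β s) / ∑ s, antiWeight G β s) -
        16 * β ^ 2 * G.edgeFinset.card ≤
      ∫ ω, ∑ x, loopLengthAt G c β x ω ∂loopMeasure G c β ∧
    ∫ ω, ∑ x, loopLengthAt G c β x ω ∂loopMeasure G c β ≤
      4 * β * ((∑ s, totalSpin s ^ 2 * antiWeight G β s) / ∑ s, antiWeight G β s) := by
  have hZ := loopPartition_pos G hβ
  have hM := (hasSum_equalTimeCorr G β).mul_left β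
  obtain ⟨T', hT', hT'le⟩ := exists_hasSum_mul_trace G c hβ
  have hsum : Summable (levelCorrSum G β) :=
    Summable.of_nonneg_of_le (levelCorrSum_nonneg G c hβ) (levelCorrSum_le G c hβ) hM.summable
  have h1 := hasSum_le (levelCorrSum_le G c hβ) hsum.hasSum hM
  have h2 := hasSum_le (le_levelCorrSum G c hβ) (hM.sub (hT'.mul_left (2 * β))) hsum.hasSum
  rw [integral_loopLength_eq G c hβ hsum.hasSum, ← loopPartition]
  constructor
  · rw [le_div_iff₀ hZ, sub_mul, mul_assoc, div_mul_cancel₀ _ hZ.ne']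
    have h3 := mul_le_mul_of_nonneg_left hT'le (by positivity : 0 ≤ 2 * β)
    nlinarith
  · rw [div_le_iff₀ hZ, mul_assoc, div_mul_cancel₀ _ hZ.ne']
    linarith

end Anti

/-! ### Lower limits and monotone limits -/

section Liminf

variable {u v : ℕ → ℝ} {b : ℝ}

theorem le_liminf_of_eventually (hub : ∀ n, u n ≤ b) {a : ℝ} (h : ∀ᶠ n in atTop, a ≤ u n) :
    a ≤ liminf u atTop :=
  le_liminf_of_le (isBoundedUnder_of ⟨b, hub⟩).isCoboundedUnder_ge h

theorem eventually_lt_of_lt_liminf' {a : ℝ} (hu : ∀ n, a ≤ u n) {c : ℝ}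
    (h : c < liminf u atTop) : ∀ᶠ n in atTop, c < u n :=
  eventually_lt_of_lt_liminf h (isBoundedUnder_of ⟨a, hu⟩)

theorem liminf_pos_iff (hu0 : ∀ n, 0 ≤ u n) (hub : ∀ n, u n ≤ b) :
    0 < liminf u atTop ↔ ∃ c > 0, ∀ᶠ n in atTop, c ≤ u n := by
  constructor
  · intro h
    exact ⟨liminf u atTop / 2, half_pos h,
      (eventually_lt_of_lt_liminf' hu0 (half_lt_self h)).mono fun n => le_of_lt⟩
  · rintro ⟨c, hc, h⟩
    exact hc.trans_le (le_liminf_of_eventually hub h)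

theorem liminf_mono {a : ℝ} (hu : ∀ n, a ≤ u n) (hv : ∀ n, v n ≤ b) (h : ∀ n, u n ≤ v n) :
    liminf u atTop ≤ liminf v atTop :=
  liminf_le_liminf (Eventually.of_forall h) (isBoundedUnder_of ⟨a, hu⟩)
    (isBoundedUnder_of ⟨b, hv⟩).isCoboundedUnder_ge

theorem liminf_mem {a : ℝ} (hu : ∀ n, a ≤ u n) (hub : ∀ n, u n ≤ b) :
    a ≤ liminf u atTop ∧ liminf u atTop ≤ b :=
  ⟨le_liminf_of_eventually hub (Eventually.of_forall hu),
    liminf_le_of_frequently_le (Frequently.of_forall hub) (isBoundedUnder_of ⟨a, hu⟩)⟩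

/-- The limit of `liminf_n u ε n` as `ε → 0+` exists for a family that is decreasing in `ε`, and it is
positive if and only if the sequence `g` is bounded away from `0`, provided that `u ε` and `g`
control each other up to an error `ε`. -/
theorem tendsto_and_pos_iff_of_comparison {w : ℝ → ℕ → ℝ} {g : ℕ → ℝ} {β : ℝ} (hβ : 0 < β)
    (hw0 : ∀ ε n, 0 ≤ w ε n) (hw1 : ∀ ε n, w ε n ≤ 1) (hanti : ∀ n, Antitone fun ε => w ε n)
    (hlow : ∀ ε > 0, ∀ n, ε * w ε n ≤ g n) (hup : ∀ ε > 0, ∀ n, g n ≤ β * w ε n + ε) :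
    Tendsto (fun ε => liminf (w ε) atTop) (𝓝[>] 0)
      (𝓝 (limUnder (𝓝[>] 0) fun ε => liminf (w ε) atTop)) ∧
    (0 < limUnder (𝓝[>] 0) (fun ε => liminf (w ε) atTop) ↔
      ∃ c > 0, ∀ᶠ n in atTop, c ≤ g n) := by
  have hA : Antitone fun ε => liminf (w ε) atTop := fun ε ε' h =>
    liminf_mono (hw0 ε') (hw1 ε) fun n => hanti n h
  have hbdd : BddAbove ((fun ε => liminf (w ε) atTop) '' Set.Ioi 0) :=
    ⟨1, by rintro _ ⟨ε, -, rfl⟩; exact (liminf_mem (hw0 ε) (hw1 ε)).2⟩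
  have hT := hA.tendsto_nhdsGT 0
  rw [hT.limUnder_eq]
  refine ⟨hT, ?_⟩
  rw [lt_csSup_iff hbdd ⟨_, 1, by simp, rfl⟩]
  constructor
  · rintro ⟨_, ⟨ε, hε, rfl⟩, h⟩
    obtain ⟨c, hc, hcw⟩ := (liminf_pos_iff (hw0 ε) (hw1 ε)).1 h
    exact ⟨ε * c, mul_pos hε hc, hcw.mono fun n hn =>
      (mul_le_mul_of_nonneg_left hn (le_of_lt hε)).trans (hlow ε hε n)⟩
  · rintro ⟨c, hc, h⟩
    refine ⟨_, ⟨c / 2, half_pos hc, rfl⟩, (liminf_pos_iff (hw0 _) (hw1 _)).2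
      ⟨c / 2 / β, by positivity, h.mono fun n hn => ?_⟩⟩
    have := hup (c / 2) (half_pos hc) n
    rw [div_le_iff₀ hβ]
    linarith

end Liminf

/-! ### Numbers of long trajectories -/

section LongCount

variable {Ω : Type} [MeasurableSpace Ω] {V : Type} [Fintype V] (μ : Measure Ω)
  [IsProbabilityMeasure μ] {l : V → Ω → ℝ} {b : ℝ}

theorem card_long_eq (l : V → ℝ) (K : ℝ) :
    (Nat.card {x // K < l x} : ℝ) = ∑ x, if K < l x then (1 : ℝ) else 0 := by
  classical
  rw [Nat.card_eq_fintype_card, Fintype.card_subtype, Finset.card_filter]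
  push_cast
  rfl

theorem measurable_card_long (hl : ∀ x, Measurable (l x)) (K : ℝ) :
    Measurable fun ω => (Nat.card {x // K < l x ω} : ℝ) := by
  simp only [card_long_eq]
  exact Finset.measurable_sum _ fun x _ => Measurable.ite
    (measurableSet_lt measurable_const (hl x)) measurable_const measurable_const

theorem card_long_le (l : V → ℝ) (K : ℝ) : (Nat.card {x // K < l x} : ℝ) ≤ Fintype.card V := by
  rw [← Nat.card_eq_fintype_card]
  exact_mod_cast Nat.card_le_card_of_injective _ Subtype.val_injective

theorem integrable_card_long (hl : ∀ x, Measurable (l x)) (K : ℝ) :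
    Integrable (fun ω => (Nat.card {x // K < l x ω} : ℝ)) μ :=
  Integrable.of_bound (measurable_card_long hl K).aestronglyMeasurable (Fintype.card V)
    (Eventually.of_forall fun ω => by
      rw [Real.norm_of_nonneg (Nat.cast_nonneg _)]
      exact card_long_le _ K)

/-- `𝔼 #{x : l x > K}` divided by the number of sites. -/
noncomputable def longFraction (l : V → Ω → ℝ) (K : ℝ) : ℝ :=
  1 / (Fintype.card V : ℝ) * ∫ ω, (Nat.card {x // K < l x ω} : ℝ) ∂μ

omit [IsProbabilityMeasure μ] in
theorem longFraction_nonneg (l : V → Ω → ℝ) (K : ℝ) : 0 ≤ longFraction μ l K :=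
  mul_nonneg (by positivity) (integral_nonneg fun ω => Nat.cast_nonneg _)

theorem longFraction_le_one (hl : ∀ x, Measurable (l x)) (K : ℝ) : longFraction μ l K ≤ 1 := by
  rw [longFraction, one_div_mul_eq_div]
  refine div_le_one_of_le₀ ?_ (Nat.cast_nonneg _)
  refine (integral_mono (integrable_card_long μ hl K) (integrable_const _) fun ω =>
    card_long_le _ K).trans ?_
  simp

theorem longFraction_antitone (hl : ∀ x, Measurable (l x)) : Antitone (longFraction μ l) := by
  intro K K' hK
  refine mul_le_mul_of_nonneg_left ?_ (by positivity)
  refine integral_mono (integrable_card_long μ hl K') (integrable_card_long μ hl K) fun ω => ?_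
  simp only [card_long_eq]
  refine Finset.sum_le_sum fun x _ => ?_
  split_ifs with h1 h2 h2
  · exact le_rfl
  · exact absurd (hK.trans_lt h1) h2
  · exact zero_le_one
  · exact le_rfl

theorem integrable_sum_length (hl : ∀ x, Measurable (l x))
    (hb : ∀ᵐ ω ∂μ, ∀ x, 0 ≤ l x ω ∧ l x ω ≤ b) : Integrable (fun ω => ∑ x, l x ω) μ :=
  integrable_finsetSum _ fun x _ => Integrable.of_bound (hl x).aestronglyMeasurable b
    (hb.mono fun ω h => by rw [Real.norm_of_nonneg (h x).1]; exact (h x).2)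

/-- The mean length and the number of macroscopic trajectories control each other. -/
theorem longFraction_bounds (hl : ∀ x, Measurable (l x)) {β : ℝ}
    (hb : ∀ᵐ ω ∂μ, ∀ x, 0 ≤ l x ω ∧ l x ω ≤ β * Fintype.card V) {ε : ℝ} (hε : 0 < ε) :
    ε * longFraction μ l (ε * Fintype.card V) ≤
      (∫ ω, ∑ x, l x ω ∂μ) / (Fintype.card V : ℝ) ^ 2 ∧
    (∫ ω, ∑ x, l x ω ∂μ) / (Fintype.card V : ℝ) ^ 2 ≤
      β * longFraction μ l (ε * Fintype.card V) + ε := by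
  rcases isEmpty_or_nonempty V with hV | hV
  · simp [longFraction, hε.le]
  set N : ℝ := (Fintype.card V : ℝ) with hN
  have hN0 : 0 < N := by rw [hN]; exact_mod_cast Fintype.card_pos
  have hint := integrable_card_long μ hl (ε * N)
  have h1 : ε * N * ∫ ω, (Nat.card {x // ε * N < l x ω} : ℝ) ∂μ ≤ ∫ ω, ∑ x, l x ω ∂μ := by
    rw [← integral_const_mul]
    refine integral_mono_ae (hint.const_mul _) (integrable_sum_length μ hl hb)
      (hb.mono fun ω h => ?_)
    dsimp only
    rw [card_long_eq, Finset.mul_sum]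
    refine Finset.sum_le_sum fun x _ => ?_
    split_ifs with hx
    · rw [mul_one]; exact hx.le
    · rw [mul_zero]; exact (h x).1
  have h2 : ∫ ω, ∑ x, l x ω ∂μ ≤
      β * N * (∫ ω, (Nat.card {x // ε * N < l x ω} : ℝ) ∂μ) + N * (ε * N) := by
    have h3 : ∫ ω, ∑ x, l x ω ∂μ ≤
        ∫ ω, (β * N * (Nat.card {x // ε * N < l x ω} : ℝ) + N * (ε * N)) ∂μ := by
      refine integral_mono_ae (integrable_sum_length μ hl hb)
        ((hint.const_mul _).add (integrable_const _)) (hb.mono fun ω h => ?_)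
      dsimp only
      rw [card_long_eq, Finset.mul_sum]
      have : N * (ε * N) = ∑ _x : V, ε * N := by simp [hN]
      rw [this, ← Finset.sum_add_distrib]
      refine Finset.sum_le_sum fun x _ => ?_
      split_ifs with hx
      · have := (h x).2
        have : 0 < ε * N := mul_pos hε hN0
        linarith
      · linarith [not_lt.1 hx]
    rw [integral_add (hint.const_mul _) (integrable_const _), integral_const_mul] at h3
    simpa using h3
  simp only [longFraction, ← hN]
  constructor
  · rw [le_div_iff₀ (by positivity)]
    refine le_trans (le_of_eq ?_) h1
    field_simp
  · rw [div_le_iff₀ (by positivity)]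
    refine h2.trans (le_of_eq ?_)
    field_simp

end LongCount

/-! ### Averages over spin configurations -/

section Averages

variable {S : Type} [Fintype S]

/-- The mean of `m` under an exponentially tilted weight increases with the tilt. -/
theorem tilted_mean_monotone [Nonempty S] (m ρ : S → ℝ) (hρ : ∀ s, 0 < ρ s) :
    Monotone fun t : ℝ => (∑ s, m s * Real.exp (t * m s) * ρ s) /
      ∑ s, Real.exp (t * m s) * ρ s := by
  intro t t' ht
  have hpos : ∀ t : ℝ, 0 < ∑ s, Real.exp (t * m s) * ρ s := fun t =>
    Finset.sum_pos (fun s _ => mul_pos (Real.exp_pos _) (hρ s)) Finset.univ_nonempty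
  dsimp only
  rw [div_le_div_iff₀ (hpos t) (hpos t'), ← sub_nonneg, Finset.sum_mul_sum, Finset.sum_mul_sum,
    ← Finset.sum_sub_distrib]
  simp only [← Finset.sum_sub_distrib]
  -- the double sum is symmetrized
  have h2 : ∀ F : S → S → ℝ, (∀ i j, 0 ≤ F i j + F j i) → 0 ≤ ∑ i, ∑ j, F i j := by
    intro F hF
    have h3 : ∑ i, ∑ j, F j i = ∑ i, ∑ j, F i j := Finset.sum_comm
    have h4 : 0 ≤ ∑ i, ∑ j, (F i j + F j i) :=
      Finset.sum_nonneg fun i _ => Finset.sum_nonneg fun j _ => hF i j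
    simp only [Finset.sum_add_distrib, h3] at h4
    linarith
  refine h2 _ fun i j => ?_
  have key : 0 ≤ (m i - m j) * (Real.exp (t' * m i) * Real.exp (t * m j) -
      Real.exp (t * m i) * Real.exp (t' * m j)) := by
    rw [← Real.exp_add, ← Real.exp_add]
    rcases le_total (m i) (m j) with h | h
    · refine mul_nonneg_of_nonpos_of_nonpos (sub_nonpos.2 h) (sub_nonpos.2 (Real.exp_le_exp.2 ?_))
      nlinarith
    · refine mul_nonneg (sub_nonneg.2 h) (sub_nonneg.2 (Real.exp_le_exp.2 ?_))
      nlinarith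
  have := mul_nonneg key (mul_pos (hρ i) (hρ j)).le
  linarith

theorem abs_totalSpin_le {V : Type} [Fintype V] (s : V → Fin 2) :
    |totalSpin s| ≤ Fintype.card V / 2 := by
  refine (Finset.abs_sum_le_sum_abs _ _).trans ?_
  have h : ∀ a : Fin 2, |spinVal a| = 1 / 2 := by
    intro a
    fin_cases a <;> simp [spinVal, abs_of_nonneg, abs_div]
  simp only [h, Finset.sum_const, Finset.card_univ, nsmul_eq_mul]
  exact le_of_eq (by ring)

theorem average_le {ρ f g : S → ℝ} (hρ : ∀ s, 0 ≤ ρ s) (h : ∀ s, f s ≤ g s) :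
    (∑ s, f s * ρ s) / ∑ s, ρ s ≤ (∑ s, g s * ρ s) / ∑ s, ρ s :=
  div_le_div_of_nonneg_right (Finset.sum_le_sum fun s _ => mul_le_mul_of_nonneg_right (h s) (hρ s))
    (Finset.sum_nonneg fun s _ => hρ s)

theorem average_const [Nonempty S] {ρ : S → ℝ} (hρ : ∀ s, 0 < ρ s) (a : ℝ) :
    (∑ s, a * ρ s) / ∑ s, ρ s = a := by
  rw [← Finset.mul_sum, mul_div_assoc, div_self, mul_one]
  exact (Finset.sum_pos (fun s _ => hρ s) Finset.univ_nonempty).ne'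

end Averages

/-! ### Boxes -/

theorem card_box (d n : ℕ) : (Fintype.card (Fin d → Fin n) : ℝ) = (n : ℝ) ^ d := by
  simp

theorem degree_boxGraph_le (d n : ℕ) (x : Fin d → Fin n) : (boxGraph d n).degree x ≤ 3 ^ d := by
  have h : ((boxGraph d n).neighborFinset x).card ≤
      (Fintype.piFinset fun i : Fin d => Finset.Icc (((x i : ℕ) : ℤ) - 1) ((x i : ℕ) + 1)).card := by
    refine Finset.card_le_card_of_injOn (fun y i => ((y i : ℕ) : ℤ)) ?_ ?_
    · intro y hy
      have hy' : ∑ i, (((x i : ℕ) : ℤ) - ((y i : ℕ) : ℤ)) ^ 2 = 1 :=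
        (SimpleGraph.mem_neighborFinset _ _ _).1 hy
      simp only [Finset.mem_coe, Fintype.mem_piFinset, Finset.mem_Icc]
      intro i
      have h1 : (((x i : ℕ) : ℤ) - ((y i : ℕ) : ℤ)) ^ 2 ≤ 1 := by
        rw [← hy']
        exact Finset.single_le_sum (f := fun i => (((x i : ℕ) : ℤ) - ((y i : ℕ) : ℤ)) ^ 2)
          (fun j _ => sq_nonneg _) (Finset.mem_univ i)
      have h2 := abs_le.1 ((sq_le_one_iff_abs_le_one _).1 h1)
      constructor <;> linarith
    · intro y _ z _ hyz
      funext i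
      have h1 : ((y i : ℕ) : ℤ) = ((z i : ℕ) : ℤ) := congrFun hyz i
      exact Fin.ext (by exact_mod_cast h1)
  refine h.trans (le_of_eq ?_)
  rw [Fintype.card_piFinset]
  simp only [Int.card_Icc]
  have : ∀ a : ℤ, (a + 1 + 1 - (a - 1)).toNat = 3 := fun a => by
    rw [show a + 1 + 1 - (a - 1) = 3 by ring]; rfl
  simp [this]

theorem card_edge_boxGraph_le (d n : ℕ) :
    ((boxGraph d n).edgeFinset.card : ℝ) ≤ 3 ^ d * (n : ℝ) ^ d := by
  have h1 := (boxGraph d n).sum_degrees_eq_twice_card_edges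
  have h2 : ∑ x, (boxGraph d n).degree x ≤ ∑ _x : Fin d → Fin n, 3 ^ d :=
    Finset.sum_le_sum fun x _ => degree_boxGraph_le d n x
  simp only [Finset.sum_const, Finset.card_univ, Fintype.card_pi, Fintype.card_fin,
    Finset.prod_const, smul_eq_mul] at h2
  have h3 : (boxGraph d n).edgeFinset.card ≤ 3 ^ d * n ^ d := by
    rw [mul_comm]
    omega
  exact_mod_cast h3

/-! ### Order parameters on finite graphs -/

section FiniteGraph

variable {V : Type} [Fintype V] [DecidableEq V] (G : SimpleGraph V) [DecidableRel G.Adj]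

theorem gibbs_magnetization (β h : ℝ) :
    (gibbs (hamFerro G h) (2 * β) (magnetization V)).re =
      (∑ s, totalSpin s * Real.exp (2 * (β * h) * totalSpin s) * ferroWeight G β s) /
        ∑ s, Real.exp (2 * (β * h) * totalSpin s) * ferroWeight G β s := by
  rw [magnetization_eq, gibbs_hamFerro]
  rfl

theorem gibbs_abs_magnetization (β : ℝ) :
    (gibbs (hamFerro G 0) (2 * β) (CFC.abs (magnetization V))).re =
      (∑ s, |totalSpin s| * ferroWeight G β s) / ∑ s, ferroWeight G β s := by
  rw [abs_magnetization, gibbs_hamFerro]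
  simp [ferroWeight]

theorem gibbs_magnetization_monotone {β : ℝ} (hβ : 0 < β) :
    Monotone fun h => (gibbs (hamFerro G h) (2 * β) (magnetization V)).re := by
  intro h h' hh
  simp only [gibbs_magnetization]
  refine tilted_mean_monotone totalSpin (ferroWeight G β) (ferroWeight_pos G hβ) ?_
  nlinarith

theorem abs_gibbs_magnetization_le {β : ℝ} (hβ : 0 < β) (h : ℝ) :
    |(gibbs (hamFerro G h) (2 * β) (magnetization V)).re| ≤ Fintype.card V / 2 := by
  rw [gibbs_magnetization, abs_le]
  have hρ : ∀ s, 0 < Real.exp (2 * (β * h) * totalSpin s) * ferroWeight G β s := fun s =>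
    mul_pos (Real.exp_pos _) (ferroWeight_pos G hβ s)
  simp only [mul_assoc (totalSpin _)]
  constructor
  · rw [← average_const hρ (-((Fintype.card V : ℝ) / 2))]
    exact average_le (fun s => (hρ s).le) fun s => (abs_le.1 (abs_totalSpin_le s)).1
  · rw [← average_const hρ ((Fintype.card V : ℝ) / 2)]
    exact average_le (fun s => (hρ s).le) fun s => (abs_le.1 (abs_totalSpin_le s)).2

omit [DecidableRel G.Adj] in
theorem measurable_cycleLengthAt (β : ℝ) (x : V) : Measurable (cycleLengthAt G β x) := by
  simp only [funext fun ω => cycleLengthAt_eq G β x ω]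
  exact measurable_of_sections G fun p => (measurable_const :
    Measurable fun _ => β * (levelCount (cycleNext G p.2) 0 (Quotient.mk _ (x, 0)) : ℝ))

omit [DecidableRel G.Adj] in
theorem cycleLengthAt_mem {β : ℝ} (hβ : 0 < β) (x : V) (ω : BridgeConfig G) :
    0 ≤ cycleLengthAt G β x ω ∧ cycleLengthAt G β x ω ≤ β * Fintype.card V := by
  rw [cycleLengthAt_eq]
  exact ⟨by positivity, mul_le_mul_of_nonneg_left (by exact_mod_cast levelCount_le _ _ _) hβ.le⟩

/-- In a field `h`, cycles longer than `K` have mean spin at least `½ tanh (h K)`. -/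
theorem tanh_mul_longFraction_le {β h K : ℝ} (hβ : 0 < β) (hh : 0 < h) :
    1 / 2 * Real.tanh (h * K) * longFraction (cycleMeasure G β h) (cycleLengthAt G β) K ≤
      1 / (Fintype.card V : ℝ) * (gibbs (hamFerro G h) (2 * β) (magnetization V)).re := by
  have := isProbabilityMeasure_cycleMeasure G hβ h
  rw [gibbs_magnetization, ← integral_tanh_cycleLength G hβ hh.le, longFraction, mul_left_comm]
  refine mul_le_mul_of_nonneg_left ?_ (by positivity)
  rw [← integral_const_mul]
  refine integral_mono ((integrable_card_long _ (measurable_cycleLengthAt G β) K).const_mul _) ?_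
    fun ω => ?_
  · refine Integrable.of_bound (C := ∑ _x : V, 1 / 2) (Measurable.aestronglyMeasurable ?_)
      (Eventually.of_forall fun ω => ?_)
    · exact Finset.measurable_sum _ fun x _ => (tanh_monotone.measurable.comp
        ((measurable_cycleLengthAt G β x).const_mul h)).const_mul _
    · refine norm_sum_le_of_le _ fun x _ => ?_
      rw [norm_mul, Real.norm_of_nonneg (by norm_num), Real.norm_eq_abs]
      have := (Real.abs_tanh_lt_one (h * cycleLengthAt G β x ω)).le
      linarith
  · dsimp only
    rw [card_long_eq, Finset.mul_sum]
    refine Finset.sum_le_sum fun x _ => ?_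
    have h0 : ∀ y, 0 ≤ y → 0 ≤ Real.tanh y := fun y hy => Real.tanh_zero ▸ tanh_monotone hy
    split_ifs with hx
    · rw [mul_one]
      exact mul_le_mul_of_nonneg_left (tanh_monotone (mul_le_mul_of_nonneg_left hx.le hh.le))
        (by norm_num)
    · rw [mul_zero]
      exact mul_nonneg (by norm_num) (h0 _ (mul_nonneg hh.le (cycleLengthAt_mem G hβ x ω).1))

end FiniteGraph

theorem tendsto_tanh_atTop : Tendsto Real.tanh atTop (𝓝 1) := by
  have h : ∀ x, Real.tanh x = (1 - Real.exp (-(2 * x))) / (1 + Real.exp (-(2 * x))) := by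
    intro x
    have h1 : Real.exp (-(2 * x)) = Real.exp (-x) * Real.exp (-x) := by
      rw [← Real.exp_add]; congr 1; ring
    have h2 : Real.exp x * Real.exp (-x) = 1 := by rw [← Real.exp_add]; simp
    rw [Real.tanh_eq_sinh_div_cosh, Real.sinh_eq, Real.cosh_eq, h1,
      div_eq_div_iff (by positivity) (by positivity)]
    linear_combination (Real.exp (-x)) * h2
  have he : Tendsto (fun x : ℝ => Real.exp (-(2 * x))) atTop (𝓝 0) :=
    Real.tendsto_exp_neg_atTop_nhds_zero.comp (tendsto_id.const_mul_atTop two_pos)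
  have := (tendsto_const_nhds (x := (1 : ℝ)).sub he).div (tendsto_const_nhds (x := (1 : ℝ)).add he)
    (by norm_num)
  rw [sub_zero, add_zero, div_one] at this
  exact this.congr fun x => (h x).symm

/-! ### Order parameters on boxes -/

section Box

variable {d : ℕ} {β : ℝ}

theorem cycleFraction_eq (d : ℕ) (β h : ℝ) (n : ℕ) (K : ℝ) : cycleFraction d β h n K =
    longFraction (cycleMeasure (boxGraph d n) β h) (cycleLengthAt (boxGraph d n) β) K := by
  rw [cycleFraction, longFraction, card_box]

theorem loopFraction_eq (d : ℕ) (β : ℝ) (n : ℕ) (K : ℝ) : loopFraction d β n K =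
    longFraction (loopMeasure (boxGraph d n) (boxColoring d n) β)
      (loopLengthAt (boxGraph d n) (boxColoring d n) β) K := by
  rw [loopFraction, longFraction, card_box]

theorem cycleFraction_mem (hβ : 0 < β) (h : ℝ) (n : ℕ) (K : ℝ) :
    0 ≤ cycleFraction d β h n K ∧ cycleFraction d β h n K ≤ 1 := by
  have := isProbabilityMeasure_cycleMeasure (boxGraph d n) hβ h
  rw [cycleFraction_eq]
  exact ⟨longFraction_nonneg _ _ _, longFraction_le_one _ (measurable_cycleLengthAt _ β) _⟩

theorem cycleFraction_antitone (hβ : 0 < β) (h : ℝ) (n : ℕ) :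
    Antitone (cycleFraction d β h n) := by
  have := isProbabilityMeasure_cycleMeasure (boxGraph d n) hβ h
  simp only [funext fun K => cycleFraction_eq d β h n K]
  exact longFraction_antitone _ (measurable_cycleLengthAt _ β)

theorem loopFraction_mem (hβ : 0 < β) (n : ℕ) (K : ℝ) :
    0 ≤ loopFraction d β n K ∧ loopFraction d β n K ≤ 1 := by
  have := isProbabilityMeasure_loopMeasure (boxGraph d n) (boxColoring d n) hβ
  rw [loopFraction_eq]
  exact ⟨longFraction_nonneg _ _ _, longFraction_le_one _ (measurable_loopLengthAt _ _ β) _⟩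

theorem loopFraction_antitone (hβ : 0 < β) (n : ℕ) : Antitone (loopFraction d β n) := by
  have := isProbabilityMeasure_loopMeasure (boxGraph d n) (boxColoring d n) hβ
  simp only [funext fun K => loopFraction_eq d β n K]
  exact longFraction_antitone _ (measurable_loopLengthAt _ _ β)

theorem abs_magnetization_density_le (hβ : 0 < β) (h : ℝ) (n : ℕ) :
    |1 / (n : ℝ) ^ d *
      (gibbs (hamFerro (boxGraph d n) h) (2 * β) (magnetization (Fin d → Fin n))).re| ≤ 1 := by
  have h1 := abs_gibbs_magnetization_le (boxGraph d n) hβ h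
  rw [card_box] at h1
  rw [abs_mul, abs_of_nonneg (by positivity), one_div_mul_eq_div]
  refine div_le_one_of_le₀ (h1.trans ?_) (by positivity)
  have : 0 ≤ (n : ℝ) ^ d := by positivity
  linarith

theorem magnetizationDensity_monotone (hβ : 0 < β) :
    Monotone fun h => magnetizationDensity d (2 * β) h := fun h h' hh =>
  liminf_mono (fun n => (abs_le.1 (abs_magnetization_density_le hβ h n)).1)
    (fun n => (abs_le.1 (abs_magnetization_density_le hβ h' n)).2) fun n =>
    mul_le_mul_of_nonneg_left (gibbs_magnetization_monotone (boxGraph d n) hβ hh) (by positivity)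

/-- The residual magnetization exists because the magnetization increases with the field. -/
theorem tendsto_mRes (hβ : 0 < β) :
    Tendsto (fun h : ℝ => magnetizationDensity d (2 * β) h) (𝓝[>] 0) (𝓝 (mRes d (2 * β))) := by
  have h := (magnetizationDensity_monotone (d := d) hβ).tendsto_nhdsGT 0
  rw [mRes, h.limUnder_eq]
  exact h

theorem tendsto_etaInfCycles (hβ : 0 < β) (h : ℝ) :
    Tendsto (fun K : ℝ => cycleFractionLong d β h K) atTop (𝓝 (etaInfCycles d β h)) := by
  have hA : Antitone fun K : ℝ => cycleFractionLong d β h K := fun K K' hK =>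
    liminf_mono (fun n => (cycleFraction_mem hβ h n K').1)
      (fun n => (cycleFraction_mem hβ h n K).2) fun n => cycleFraction_antitone hβ h n hK
  have hT := tendsto_atTop_ciInf hA ⟨0, by
    rintro _ ⟨K, rfl⟩
    exact (liminf_mem (fun n => (cycleFraction_mem hβ h n K).1)
      (fun n => (cycleFraction_mem hβ h n K).2)).1⟩
  rw [etaInfCycles, hT.limUnder_eq]
  exact hT

theorem etaInfCycles_nonneg (hβ : 0 < β) (h : ℝ) : 0 ≤ etaInfCycles d β h :=
  ge_of_tendsto' (tendsto_etaInfCycles hβ h) fun K =>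
    (liminf_mem (fun n => (cycleFraction_mem hβ h n K).1)
      (fun n => (cycleFraction_mem hβ h n K).2)).1

theorem half_etaInfCycles_le (hβ : 0 < β) {h : ℝ} (hh : 0 < h) :
    1 / 2 * etaInfCycles d β h ≤ magnetizationDensity d (2 * β) h := by
  have hK : ∀ K, 0 ≤ K → 1 / 2 * Real.tanh (h * K) * cycleFractionLong d β h K ≤
      magnetizationDensity d (2 * β) h := by
    intro K hK
    have ht : 0 ≤ 1 / 2 * Real.tanh (h * K) := mul_nonneg (by norm_num)
      (Real.tanh_zero ▸ tanh_monotone (mul_nonneg hh.le hK))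
    have hn : ∀ n : ℕ, 1 / 2 * Real.tanh (h * K) * cycleFraction d β h n K ≤ 1 / (n : ℝ) ^ d *
        (gibbs (hamFerro (boxGraph d n) h) (2 * β) (magnetization (Fin d → Fin n))).re := by
      intro n
      rw [cycleFraction_eq, ← card_box]
      exact tanh_mul_longFraction_le (boxGraph d n) hβ hh
    -- every number below the lower limit of the fractions yields an eventual lower bound
    refine le_of_forall_lt_imp_le_of_dense fun a ha => ?_
    rcases le_or_gt a 0 with ha0 | ha0
    · refine ha0.trans (le_liminf_of_eventually
        (fun n => (abs_le.1 (abs_magnetization_density_le hβ h n)).2)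
        (Eventually.of_forall fun n => le_trans ?_ (hn n)))
      exact mul_nonneg ht (cycleFraction_mem hβ h n K).1
    · have ht' : 0 < 1 / 2 * Real.tanh (h * K) := lt_of_le_of_ne ht fun h0 => by
        rw [← h0, zero_mul] at ha
        exact absurd ha (not_lt.2 ha0.le)
      have h1 : a / (1 / 2 * Real.tanh (h * K)) < cycleFractionLong d β h K := by
        rwa [div_lt_iff₀ ht', mul_comm]
      refine le_liminf_of_eventually
        (fun n => (abs_le.1 (abs_magnetization_density_le hβ h n)).2)
        ((eventually_lt_of_lt_liminf' (fun n => (cycleFraction_mem hβ h n K).1) h1).mono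
          fun n hn1 => le_trans ?_ (hn n))
      rw [div_lt_iff₀ ht', mul_comm] at hn1
      exact hn1.le
  have hlim : Tendsto (fun K : ℝ => 1 / 2 * Real.tanh (h * K) * cycleFractionLong d β h K) atTop
      (𝓝 (1 / 2 * 1 * etaInfCycles d β h)) :=
    ((tendsto_tanh_atTop.comp (tendsto_id.const_mul_atTop hh)).const_mul _).mul
      (tendsto_etaInfCycles hβ h)
  rw [mul_one] at hlim
  exact le_of_tendsto hlim ((eventually_ge_atTop 0).mono hK)

theorem half_limsup_etaInfCycles_le (hβ : 0 < β) :
    1 / 2 * limsup (fun h : ℝ => etaInfCycles d β h) (𝓝[>] 0) ≤ mRes d (2 * β) := by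
  have hT := (tendsto_mRes (d := d) hβ).const_mul 2
  have h1 : limsup (fun h : ℝ => etaInfCycles d β h) (𝓝[>] 0) ≤ 2 * mRes d (2 * β) := by
    rw [← hT.limsup_eq]
    refine limsup_le_limsup ?_ ?_ hT.isBoundedUnder_le
    · filter_upwards [self_mem_nhdsWithin] with h hh
      linarith [half_etaInfCycles_le (d := d) hβ hh]
    · exact (isBoundedUnder_of ⟨0, fun h => etaInfCycles_nonneg hβ h⟩ :
        IsBoundedUnder (· ≥ ·) (𝓝[>] (0 : ℝ)) fun h : ℝ => etaInfCycles d β h).isCoboundedUnder_le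
  linarith

/-- The ferromagnetic `⟨M²⟩ / n^{2d}` at `h = 0`. -/
noncomputable def ferroSecondMoment (d : ℕ) (β : ℝ) (n : ℕ) : ℝ :=
  (∑ s, totalSpin s ^ 2 * ferroWeight (boxGraph d n) β s) /
    (∑ s, ferroWeight (boxGraph d n) β s) / ((n : ℝ) ^ d) ^ 2

/-- The staggered analogue of `ferroSecondMoment` for the antiferromagnet. -/
noncomputable def antiSecondMoment (d : ℕ) (β : ℝ) (n : ℕ) : ℝ :=
  (∑ s, totalSpin s ^ 2 * antiWeight (boxGraph d n) β s) /
    (∑ s, antiWeight (boxGraph d n) β s) / ((n : ℝ) ^ d) ^ 2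

theorem etaMacroCycles_tendsto_and_pos_iff (hβ : 0 < β) :
    Tendsto (fun ε : ℝ => cycleFractionMacro d β 0 ε) (𝓝[>] 0) (𝓝 (etaMacroCycles d β 0)) ∧
    (0 < etaMacroCycles d β 0 ↔ ∃ c > 0, ∀ᶠ n in atTop, c ≤ ferroSecondMoment d β n) := by
  have hb : ∀ n (ε : ℝ), 0 < ε → ε * cycleFraction d β 0 n (ε * (n : ℝ) ^ d) ≤
      4 * β * ferroSecondMoment d β n ∧ 4 * β * ferroSecondMoment d β n ≤
        β * cycleFraction d β 0 n (ε * (n : ℝ) ^ d) + ε := by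
    intro n ε hε
    have := isProbabilityMeasure_cycleMeasure (boxGraph d n) hβ 0
    have h := longFraction_bounds (cycleMeasure (boxGraph d n) β 0)
      (measurable_cycleLengthAt (boxGraph d n) β)
      (Eventually.of_forall fun ω x => cycleLengthAt_mem (boxGraph d n) hβ x ω) hε
    rw [integral_cycleLength _ hβ, card_box, ← cycleFraction_eq, mul_div_assoc] at h
    exact h
  have h := tendsto_and_pos_iff_of_comparison hβ
    (w := fun ε n => cycleFraction d β 0 n (ε * (n : ℝ) ^ d))
    (g := fun n => 4 * β * ferroSecondMoment d β n)
    (fun ε n => (cycleFraction_mem hβ 0 n _).1) (fun ε n => (cycleFraction_mem hβ 0 n _).2)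
    (fun n ε ε' h => cycleFraction_antitone hβ 0 n (mul_le_mul_of_nonneg_right h (by positivity)))
    (fun ε hε n => (hb n ε hε).1) (fun ε hε n => (hb n ε hε).2)
  refine ⟨h.1, h.2.trans ⟨?_, ?_⟩⟩
  · rintro ⟨c, hc, h⟩
    refine ⟨c / (4 * β), by positivity, h.mono fun n hn => ?_⟩
    rwa [div_le_iff₀' (by positivity)]
  · rintro ⟨c, hc, h⟩
    exact ⟨4 * β * c, by positivity, h.mono fun n hn =>
      mul_le_mul_of_nonneg_left hn (by positivity)⟩

/-- The mean of `|M|` and the second moment of `M` control each other, because `|M|` is bounded by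
the number of sites. -/
theorem mSp_pos_iff (hβ : 0 < β) :
    0 < mSp d (2 * β) ↔ ∃ c > 0, ∀ᶠ n in atTop, c ≤ ferroSecondMoment d β n := by
  set u : ℕ → ℝ := fun n => 1 / (n : ℝ) ^ d *
    ((∑ s, |totalSpin s| * ferroWeight (boxGraph d n) β s) /
      ∑ s, ferroWeight (boxGraph d n) β s) with hu
  have hmSp : mSp d (2 * β) = liminf u atTop := by
    rw [mSp]
    simp only [gibbs_abs_magnetization, hu]
  have hρ : ∀ (n : ℕ) s, 0 < ferroWeight (boxGraph d n) β s := fun n => ferroWeight_pos _ hβ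
  have hu0 : ∀ n, 0 ≤ u n := fun n => mul_nonneg (by positivity) (div_nonneg
    (Finset.sum_nonneg fun s _ => mul_nonneg (abs_nonneg _) (hρ n s).le)
    (Finset.sum_nonneg fun s _ => (hρ n s).le))
  have hu1 : ∀ n, u n ≤ 1 := by
    intro n
    rw [hu]
    dsimp only
    rw [one_div_mul_eq_div]
    refine div_le_one_of_le₀ ?_ (by positivity)
    rw [← average_const (hρ n) ((n : ℝ) ^ d)]
    refine average_le (fun s => (hρ n s).le) fun s => (abs_totalSpin_le s).trans ?_
    rw [card_box]
    have : 0 ≤ (n : ℝ) ^ d := by positivity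
    linarith
  -- `M² ≤ (N / 2) |M|`
  have hlow : ∀ n : ℕ, 0 < n → ferroSecondMoment d β n ≤ 1 / 2 * u n := by
    intro n hn
    have hN : 0 < (n : ℝ) ^ d := by positivity
    rw [ferroSecondMoment, hu, div_le_iff₀ (by positivity)]
    have h1 : (∑ s, totalSpin s ^ 2 * ferroWeight (boxGraph d n) β s) /
        (∑ s, ferroWeight (boxGraph d n) β s) ≤
        (∑ s, (n : ℝ) ^ d / 2 * |totalSpin s| * ferroWeight (boxGraph d n) β s) /
          ∑ s, ferroWeight (boxGraph d n) β s := by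
      refine average_le (fun s => (hρ n s).le) fun s => ?_
      rw [← sq_abs, sq, ← card_box]
      exact mul_le_mul_of_nonneg_right (abs_totalSpin_le s) (abs_nonneg _)
    simp only [mul_assoc ((n : ℝ) ^ d / 2), ← Finset.mul_sum] at h1
    rw [mul_div_assoc] at h1
    refine h1.trans (le_of_eq ?_)
    dsimp only
    field_simp
  -- `2 a |M| ≤ M² / N + a² N`
  have hup : ∀ (n : ℕ), 0 < n → ∀ a > 0, 2 * a * u n ≤ ferroSecondMoment d β n + a ^ 2 := by
    intro n hn a ha
    set N : ℝ := (n : ℝ) ^ d with hNdef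
    have hN : 0 < N := by positivity
    have h1 : (∑ s, 2 * a / N * |totalSpin s| * ferroWeight (boxGraph d n) β s) /
        (∑ s, ferroWeight (boxGraph d n) β s) ≤
        (∑ s, (1 / N ^ 2 * totalSpin s ^ 2 + a ^ 2) * ferroWeight (boxGraph d n) β s) /
          ∑ s, ferroWeight (boxGraph d n) β s := by
      refine average_le (fun s => (hρ n s).le) fun s => ?_
      have h2 := sq_nonneg (|totalSpin s| / N - a)
      have h3 : (|totalSpin s| / N - a) ^ 2 =
          1 / N ^ 2 * totalSpin s ^ 2 + a ^ 2 - 2 * a / N * |totalSpin s| := by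
        rw [← sq_abs (totalSpin s)]
        field_simp
        ring
      linarith
    simp only [add_mul, Finset.sum_add_distrib, add_div, average_const (hρ n)] at h1
    simp only [mul_assoc (2 * a / N), mul_assoc (1 / N ^ 2), ← Finset.mul_sum] at h1
    rw [mul_div_assoc, mul_div_assoc] at h1
    rw [ferroSecondMoment, ← hNdef]
    refine le_trans (le_of_eq ?_) (h1.trans (le_of_eq ?_))
    · simp only [hu, ← hNdef]
      ring
    · ring
  rw [hmSp, liminf_pos_iff hu0 hu1]
  constructor
  · rintro ⟨c, hc, h⟩
    refine ⟨c ^ 2, by positivity, ?_⟩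
    filter_upwards [h, eventually_gt_atTop 0] with n hn hn0
    have := hup n hn0 c hc
    nlinarith
  · rintro ⟨c, hc, h⟩
    refine ⟨c, hc, ?_⟩
    filter_upwards [h, eventually_gt_atTop 0] with n hn hn0
    have := hlow n hn0
    linarith [hu0 n]

theorem antiSecondMoment_mem (hβ : 0 < β) (n : ℕ) :
    0 ≤ antiSecondMoment d β n ∧ antiSecondMoment d β n ≤ 1 := by
  have hρ : ∀ s, 0 < antiWeight (boxGraph d n) β s := antiWeight_pos _ hβ
  refine ⟨div_nonneg (div_nonneg (Finset.sum_nonneg fun s _ => mul_nonneg (sq_nonneg _) (hρ s).le)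
    (Finset.sum_nonneg fun s _ => (hρ s).le)) (by positivity), div_le_one_of_le₀ ?_ (by positivity)⟩
  rw [← average_const hρ (((n : ℝ) ^ d) ^ 2)]
  refine average_le (fun s => (hρ s).le) fun s => ?_
  have h1 := abs_totalSpin_le s
  rw [card_box] at h1
  have : 0 ≤ (n : ℝ) ^ d := by positivity
  rw [← sq_abs]
  exact pow_le_pow_left₀ (abs_nonneg _) (by linarith) 2

theorem sigmaBar_pos_iff (hβ : 0 < β) :
    0 < sigmaBar d (2 * β) ↔ ∃ c > 0, ∀ᶠ n in atTop, c ≤ antiSecondMoment d β n := by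
  have h : sigmaBar d (2 * β) = Real.sqrt (liminf (antiSecondMoment d β) atTop) := by
    rw [sigmaBar]
    congr 2
    funext n
    rw [sum_staggeredCorr, one_div_mul_eq_div]
    rfl
  rw [h, Real.sqrt_pos, liminf_pos_iff (fun n => (antiSecondMoment_mem hβ n).1)
    (fun n => (antiSecondMoment_mem hβ n).2)]

theorem etaMacroLoops_tendsto_and_pos_iff (hd : 0 < d) (hβ : 0 < β) :
    Tendsto (fun ε : ℝ => loopFractionMacro d β ε) (𝓝[>] 0) (𝓝 (etaMacroLoops d β)) ∧
    (0 < etaMacroLoops d β ↔ ∃ c > 0, ∀ᶠ n in atTop, c ≤ antiSecondMoment d β n) := by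
  set g : ℕ → ℝ := fun n => (∫ ω, ∑ x, loopLengthAt (boxGraph d n) (boxColoring d n) β x ω
    ∂loopMeasure (boxGraph d n) (boxColoring d n) β) / ((n : ℝ) ^ d) ^ 2 with hg
  have hb : ∀ n (ε : ℝ), 0 < ε → ε * loopFraction d β n (ε * (n : ℝ) ^ d) ≤ g n ∧
      g n ≤ β * loopFraction d β n (ε * (n : ℝ) ^ d) + ε := by
    intro n ε hε
    have := isProbabilityMeasure_loopMeasure (boxGraph d n) (boxColoring d n) hβ
    have h := longFraction_bounds (loopMeasure (boxGraph d n) (boxColoring d n) β)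
      (measurable_loopLengthAt (boxGraph d n) (boxColoring d n) β) (β := β)
      ((ae_reweight _).mono fun ω hω x => ⟨loopLengthAt_nonneg _ _ hβ x hω,
        loopLengthAt_le _ _ hβ x hω⟩) hε
    rw [card_box, ← loopFraction_eq] at h
    exact h
  have h := tendsto_and_pos_iff_of_comparison hβ
    (w := fun ε n => loopFraction d β n (ε * (n : ℝ) ^ d)) (g := g)
    (fun ε n => (loopFraction_mem hβ n _).1) (fun ε n => (loopFraction_mem hβ n _).2)
    (fun n ε ε' h => loopFraction_antitone hβ n (mul_le_mul_of_nonneg_right h (by positivity)))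
    (fun ε hε n => (hb n ε hε).1) (fun ε hε n => (hb n ε hε).2)
  refine ⟨h.1, h.2.trans ?_⟩
  have hgup : ∀ n, g n ≤ 4 * β * antiSecondMoment d β n := by
    intro n
    have h1 := (integral_loopLength_bounds (boxGraph d n) (boxColoring d n) hβ).2
    rw [antiSecondMoment, ← mul_div_assoc]
    exact div_le_div_of_nonneg_right h1 (by positivity)
  have hglow : ∀ n : ℕ, 0 < n →
      4 * β * antiSecondMoment d β n - 16 * β ^ 2 * 3 ^ d / (n : ℝ) ^ d ≤ g n := by
    intro n hn
    have hN : 0 < (n : ℝ) ^ d := by positivity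
    have h1 := (integral_loopLength_bounds (boxGraph d n) (boxColoring d n) hβ).1
    have h2 := mul_le_mul_of_nonneg_left (card_edge_boxGraph_le d n)
      (by positivity : 0 ≤ 16 * β ^ 2)
    have h3 := div_le_div_of_nonneg_right h1 (by positivity : 0 ≤ ((n : ℝ) ^ d) ^ 2)
    refine le_trans ?_ h3
    rw [antiSecondMoment, sub_div, ← mul_div_assoc]
    refine sub_le_sub_left ?_ _
    rw [div_le_div_iff₀ (by positivity) hN]
    have h4 := mul_le_mul_of_nonneg_right h2 hN.le
    linarith
  -- the error term vanishes in the limit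
  have herr : Tendsto (fun n : ℕ => 16 * β ^ 2 * 3 ^ d / (n : ℝ) ^ d) atTop (𝓝 0) :=
    tendsto_const_nhds.div_atTop ((tendsto_pow_atTop hd.ne').comp tendsto_natCast_atTop_atTop)
  constructor
  · rintro ⟨c, hc, h⟩
    refine ⟨c / (4 * β), by positivity, h.mono fun n hn => ?_⟩
    rw [div_le_iff₀' (by positivity)]
    exact hn.trans (hgup n)
  · rintro ⟨c, hc, h⟩
    have hc' : 0 < 2 * β * c := by positivity
    refine ⟨2 * β * c, hc', ?_⟩
    filter_upwards [h, eventually_gt_atTop 0, herr.eventually_lt_const hc'] with n h1 h2 h3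
    have h4 := hglow n h2
    have h5 := mul_le_mul_of_nonneg_left h1 (by positivity : 0 ≤ 4 * β)
    linarith

end Box

end Heisenberg

theorem mainTheorem8 (d : ℕ) (hd : 0 < d) (β : ℝ) (hβ : 0 < β) :
    -- the limits that define the order parameters exist
    (Filter.Tendsto (fun h : ℝ => Heisenberg.magnetizationDensity d (2 * β) h)
        (nhdsWithin 0 (Set.Ioi 0)) (nhds (Heisenberg.mRes d (2 * β))) ∧
      (∀ h : ℝ, 0 < h → Filter.Tendsto (fun K : ℝ => Heisenberg.cycleFractionLong d β h K)
        Filter.atTop (nhds (Heisenberg.etaInfCycles d β h))) ∧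
      Filter.Tendsto (fun ε : ℝ => Heisenberg.cycleFractionMacro d β 0 ε)
        (nhdsWithin 0 (Set.Ioi 0)) (nhds (Heisenberg.etaMacroCycles d β 0)) ∧
      Filter.Tendsto (fun ε : ℝ => Heisenberg.loopFractionMacro d β ε)
        (nhdsWithin 0 (Set.Ioi 0)) (nhds (Heisenberg.etaMacroLoops d β))) ∧
    -- (a)
    1 / 2 * Filter.limsup (fun h : ℝ => Heisenberg.etaInfCycles d β h)
        (nhdsWithin 0 (Set.Ioi 0)) ≤ Heisenberg.mRes d (2 * β) ∧
    -- (b)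
    (0 < Heisenberg.mSp d (2 * β) ↔ 0 < Heisenberg.etaMacroCycles d β 0) ∧
    -- (c)
    (0 < Heisenberg.sigmaBar d (2 * β) ↔ 0 < Heisenberg.etaMacroLoops d β) := by
  have hcyc := Heisenberg.etaMacroCycles_tendsto_and_pos_iff (d := d) hβ
  have hloop := Heisenberg.etaMacroLoops_tendsto_and_pos_iff hd hβ
  exact ⟨⟨Heisenberg.tendsto_mRes hβ, fun h _ => Heisenberg.tendsto_etaInfCycles hβ h, hcyc.1,
    hloop.1⟩, Heisenberg.half_limsup_etaInfCycles_le hβ,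
    (Heisenberg.mSp_pos_iff hβ).trans hcyc.2.symm,
    (Heisenberg.sigmaBar_pos_iff hβ).trans hloop.2.symm⟩
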